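/- **Proposition 3.** All Lie algebras are finite-dimensional and real. For $n\in\mathbb N$ let $\mathcal L^n$ be the variety of Lie algebra laws on $\mathbb R^n$: the structure tensors $(C_{ij}^k)$ that are skew-symmetric in $i,j$ and satisfy the Jacobi identity, with the subspace topology. An $n$-dimensional Lie algebra $\mathfrak g$ is *stable* if its orbit (the set of all laws in $\mathcal L^n$ isomorphic to $\mathfrak g$) is open in $\mathcal L^n$. A Lie algebra $\mathfrak g'$ is a *contraction* of $\mathfrak g$ if there are invertible linear maps $\Phi_t$ of $\mathfrak g$ such that $[X,Y]_\infty=\lim_{t\to\infty}\Phi_t^{-1}[\Phi_tX,\Phi_tY]$ exists for all $X,Y\in\mathfrak g$ and $(\mathfrak g,[\cdot,\cdot]_\infty)\cong\mathfrak g'$. $\mathfrak g$ has a *nontrivial Levi decomposition* if $\mathfrak g=\mathfrak s\oplus\mathfrak r$ as a vector space, with $\mathfrak s\ne0$ a semisimple subalgebra, $\mathfrak r\neq 0$ the radical, and $\mathfrak s$ acting nontrivially on $\mathfrak r$; it is *indecomposable* if it is nonzero and not a direct sum of two nonzero ideals. $H^2(\mathfrak g,\mathfrak g)$ is the second cohomology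 with values in the adjoint module. Let $L_{6,1},\dots,L_{6,4}$ be the Lie algebras with basis $X_1,\dots,X_6$ and the following nonzero structure constants, $[X_i,X_j]=C_{ij}^kX_k$ (up to antisymmetry): - $L_{6,1}$: $C_{23}^1=1$, $C_{12}^3=1$, $C_{13}^2=-1$, $C_{15}^6=1$, $C_{16}^5=-1$, $C_{24}^6=-1$, $C_{26}^4=1$, $C_{34}^5=1$, $C_{35}^4=-1$; - $L_{6,2}$: $C_{12}^2=2$, $C_{13}^3=-2$, $C_{23}^1=1$, $C_{14}^4=1$, $C_{25}^4=1$, $C_{34}^5=1$, $C_{15}^5=-1$, $C_{45}^6=1$; - $L_{6,3}$: $C_{12}^2=2$, $C_{13}^3=-2$, $C_{23}^1=1$, $C_{14}^4=1$, $C_{25}^4=1$, $C_{34}^5=1$, $C_{15}^5=-1$, $C_{46}^4=1$, $C_{56}^5=1$; - $L_{6,4}$: $C_{12}^2=2$, $C_{13}^3=-2$, $C_{23}^1=1$, $C_{14}^4=2$, $C_{16}^6=-2$, $C_{25}^4=2$, $C_{26}^5=1$, $C_{34}^5=1$, $C_{35}^6=2$. Then: 1. Every 6-dimensional indecomposable Lie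 algebra with nontrivial Levi decomposition is isomorphic to one of $L_{6,1},\dots,L_{6,4}$, and it is either stable or a contraction of a semisimple Lie algebra, but not both. 2. $L_{6,1}$ is isomorphic to $I\mathfrak{so}(3)=\mathfrak{so}(3)\ltimes\mathbb R^3$ (standard action, $\mathbb R^3$ an abelian ideal). It is a contraction of a semisimple Lie algebra; moreover, it is a contraction of $\mathfrak{so}(4)$ and of $\mathfrak{so}(3,1)$. 3. $L_{6,4}$ is isomorphic to $I\mathfrak{sl}(2,\mathbb R)$, the semidirect sum of $\mathfrak{sl}(2,\mathbb R)$ with its adjoint module as an abelian ideal. It is a contraction of a semisimple Lie algebra; moreover, it is a contraction of $\mathfrak{so}(2,2)$ and of $\mathfrak{so}(3,1)$. 4. $H^2(L_{6,2},L_{6,2})=H^2(L_{6,3},L_{6,3})=0$, and $L_{6,2}$ and $L_{6,3}$ are stable. -/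

import Mathlib

namespace LowDimLie

open Filter Topology Module

/-! ### The variety of real Lie algebra laws, orbits and stability -/

/-- The variety `𝓛ⁿ` of real Lie algebra laws on an `n`-dimensional space, in coordinates: the
structure constants `C i j k` (the coefficient of `X k` in `[X i, X j]`) that are skew-symmetric
in `i, j` and satisfy the Jacobi identity. It carries the subspace topology. -/
def lieVariety (n : ℕ) : Set (Fin n → Fin n → Fin n → ℝ) :=
  {C | (∀ i j k, C i j k = -C j i k) ∧
    ∀ i j k l, ∑ m, (C i j m * C m k l + C j k m * C m i l + C k i m * C m j l) = 0}

section General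

universe u v

variable (g : Type u) [LieRing g] [LieAlgebra ℝ g]

/-- The orbit `𝓞(g)` under the general linear group: all laws isomorphic to `g`, that is, the
structure constants of `g` with respect to all its bases. -/
def orbit : Set (lieVariety (finrank ℝ g)) :=
  {C | ∃ b : Basis (Fin (finrank ℝ g)) ℝ g, ∀ i j k, C.1 i j k = b.repr ⁅b i, b j⁆ k}

/-- A Lie algebra is stable if its orbit is open in the variety of Lie algebra laws. -/
def IsStable : Prop := IsOpen (orbit g)

/-! ### Contractions -/

/-- `g'` is a contraction of the finite-dimensional Lie algebra `g`: there are non-singular linear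
maps `Φ t` of `g` such that `(Φ t)⁻¹ [Φ t X, Φ t Y]` converges as `t → ∞` for all `X, Y`, and the
limit bracket makes the vector space `g` a Lie algebra isomorphic to `g'` (through `e`).
Convergence in the finite-dimensional space `g` is convergence of all linear functionals. -/
def IsContraction (g' : Type v) [LieRing g'] [LieAlgebra ℝ g'] : Prop :=
  ∃ (Φ : ℝ → (g ≃ₗ[ℝ] g)) (e : g' ≃ₗ[ℝ] g), ∀ (X Y : g') (f : Dual ℝ g),
    Tendsto (fun t : ℝ => f ((Φ t).symm ⁅Φ t (e X), Φ t (e Y)⁆)) atTop (𝓝 (f (e ⁅X, Y⁆)))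

/-- `g` is a contraction of some finite-dimensional real semisimple Lie algebra. -/
def IsContractionOfSemisimple : Prop :=
  ∃ (s : Type u) (_ : LieRing s) (_ : LieAlgebra ℝ s),
    FiniteDimensional ℝ s ∧ LieAlgebra.IsSemisimple ℝ s ∧ IsContraction s g

/-! ### Indecomposability and Levi decompositions -/

/-- `g` is nonzero and not a direct sum of two nonzero ideals. -/
def IsIndecomposable : Prop :=
  Nontrivial g ∧ ∀ I J : LieIdeal ℝ g, IsCompl I J → I = ⊥ ∨ J = ⊥

/-- `g` is the vector space direct sum of a semisimple subalgebra `s ≠ 0` and its radical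
`r ≠ 0`, with `s` acting nontrivially on `r`. -/
def HasNontrivialLeviDecomposition : Prop :=
  ∃ s : LieSubalgebra ℝ g,
    LieAlgebra.IsSemisimple ℝ s ∧ s ≠ ⊥ ∧ LieAlgebra.radical ℝ g ≠ ⊥ ∧
    IsCompl s.toSubmodule (LieAlgebra.radical ℝ g).toSubmodule ∧
    ∃ x ∈ s, ∃ y ∈ LieAlgebra.radical ℝ g, ⁅x, y⁆ ≠ 0

/-! ### The second adjoint cohomology space -/

/-- The quotient `Z / B` of two subspaces `B ⊆ Z` of a real vector space (`Z / (Z ∩ B)` in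
general). -/
abbrev Subquotient {V : Type*} [AddCommGroup V] [Module ℝ V] (Z B : Submodule ℝ V) : Type _ :=
  Z ⧸ B.submoduleOf Z

/-- The 2-coboundaries with values in the adjoint module. -/
def B2 : Submodule ℝ (LieModule.Cohomology.twoCochain ℝ g g) :=
  LinearMap.range (LieModule.Cohomology.d₁₂ ℝ g g)

/-- `H²(g, g) = Z²(g, g) / B²(g, g)`, cohomology with values in the adjoint module. -/
abbrev H2 : Type u :=
  Subquotient (V := LieModule.Cohomology.twoCochain ℝ g g)
    (LieModule.Cohomology.twoCocycle ℝ g g) (B2 g)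

end General

/-! ### Lie algebras given by structure constants -/

/-- The Lie algebra on `ℝⁿ` with structure constants `C`. (A new type, since `Fin n → ℝ` carries
an abelian Lie bracket.) -/
def OfLaw {n : ℕ} (_ : lieVariety n) : Type := Fin n → ℝ

namespace OfLaw

variable {n : ℕ} (C : lieVariety n)

instance : AddCommGroup (OfLaw C) := inferInstanceAs (AddCommGroup (Fin n → ℝ))

noncomputable instance : Module ℝ (OfLaw C) := inferInstanceAs (Module ℝ (Fin n → ℝ))

noncomputable instance : Bracket (OfLaw C) (OfLaw C) where
  bracket x y := fun k => ∑ i, ∑ j, x i * y j * C.1 i j k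

variable {C}

theorem lie_apply (x y : OfLaw C) (k : Fin n) :
    ⁅x, y⁆ k = ∑ i, ∑ j, x i * y j * C.1 i j k := rfl

theorem add_apply (x y : OfLaw C) (k : Fin n) : (x + y) k = x k + y k := rfl

theorem neg_apply (x : OfLaw C) (k : Fin n) : (-x) k = -x k := rfl

theorem zero_apply (k : Fin n) : (0 : OfLaw C) k = 0 := rfl

theorem smul_apply (t : ℝ) (x : OfLaw C) (k : Fin n) : (t • x) k = t * x k := rfl

theorem skew (x y : OfLaw C) : ⁅x, y⁆ = -⁅y, x⁆ := by
  funext k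
  rw [neg_apply, lie_apply, lie_apply, Finset.sum_comm, ← Finset.sum_neg_distrib]
  refine Finset.sum_congr rfl fun j _ => ?_
  rw [← Finset.sum_neg_distrib]
  refine Finset.sum_congr rfl fun i _ => ?_
  rw [C.2.1 i j k]
  ring

theorem lie_lie_apply (x y z : OfLaw C) (l : Fin n) :
    ⁅⁅x, y⁆, z⁆ l = ∑ i, ∑ j, ∑ k, x i * y j * z k * ∑ m, C.1 i j m * C.1 m k l := by
  simp only [lie_apply, Finset.sum_mul, Finset.mul_sum]
  calc _ = ∑ k, ∑ m, ∑ i, ∑ j, x i * y j * C.1 i j m * z k * C.1 m k l := Finset.sum_comm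
    _ = ∑ k, ∑ i, ∑ j, ∑ m, x i * y j * C.1 i j m * z k * C.1 m k l := by
        refine Finset.sum_congr rfl fun k _ => ?_
        rw [Finset.sum_comm]
        exact Finset.sum_congr rfl fun i _ => Finset.sum_comm
    _ = ∑ i, ∑ j, ∑ k, ∑ m, x i * y j * C.1 i j m * z k * C.1 m k l := by
        rw [Finset.sum_comm]
        exact Finset.sum_congr rfl fun i _ => Finset.sum_comm
    _ = _ := by
        refine Finset.sum_congr rfl fun i _ => Finset.sum_congr rfl fun j _ =>
          Finset.sum_congr rfl fun k _ => Finset.sum_congr rfl fun m _ => ?_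
        ring

theorem jacobi (x y z : OfLaw C) : ⁅⁅x, y⁆, z⁆ + ⁅⁅y, z⁆, x⁆ + ⁅⁅z, x⁆, y⁆ = 0 := by
  funext l
  rw [add_apply, add_apply, zero_apply, lie_lie_apply, lie_lie_apply, lie_lie_apply]
  have h1 : ∑ i, ∑ j, ∑ k, y i * z j * x k * ∑ m, C.1 i j m * C.1 m k l
      = ∑ i, ∑ j, ∑ k, x i * y j * z k * ∑ m, C.1 j k m * C.1 m i l := by
    rw [Finset.sum_congr rfl fun i _ => Finset.sum_comm, Finset.sum_comm]
    refine Finset.sum_congr rfl fun i _ => Finset.sum_congr rfl fun j _ =>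
      Finset.sum_congr rfl fun k _ => ?_
    ring
  have h2 : ∑ i, ∑ j, ∑ k, z i * x j * y k * ∑ m, C.1 i j m * C.1 m k l
      = ∑ i, ∑ j, ∑ k, x i * y j * z k * ∑ m, C.1 k i m * C.1 m j l := by
    rw [Finset.sum_comm]
    refine Finset.sum_congr rfl fun i _ => ?_
    rw [Finset.sum_comm]
    refine Finset.sum_congr rfl fun j _ => Finset.sum_congr rfl fun k _ => ?_
    ring
  rw [h1, h2]
  simp only [← Finset.sum_add_distrib, ← mul_add]
  refine Finset.sum_eq_zero fun i _ => Finset.sum_eq_zero fun j _ =>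
    Finset.sum_eq_zero fun k _ => ?_
  rw [C.2.2 i j k l, mul_zero]

theorem add_lie' (x y z : OfLaw C) : ⁅x + y, z⁆ = ⁅x, z⁆ + ⁅y, z⁆ := by
  funext k
  simp only [lie_apply, add_apply, add_mul, Finset.sum_add_distrib]

theorem lie_add' (x y z : OfLaw C) : ⁅x, y + z⁆ = ⁅x, y⁆ + ⁅x, z⁆ := by
  funext k
  simp only [lie_apply, add_apply, mul_add, add_mul, Finset.sum_add_distrib]

variable (C)

noncomputable instance : LieRing (OfLaw C) where
  add_lie := add_lie'
  lie_add := lie_add'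
  lie_self x := by
    have h := skew x x
    funext k
    have hk := congrFun h k
    rw [neg_apply] at hk
    rw [zero_apply]
    linarith
  leibniz_lie x y z := by
    have h := jacobi x y z
    rw [skew x ⁅y, z⁆, skew y ⁅x, z⁆, skew x z]
    have h3 : ⁅-⁅z, x⁆, y⁆ = -⁅⁅z, x⁆, y⁆ := by
      funext k
      simp only [lie_apply, neg_apply, neg_mul, Finset.sum_neg_distrib]
    rw [h3, neg_neg]
    have h4 : ⁅⁅x, y⁆, z⁆ + ⁅⁅z, x⁆, y⁆ = -⁅⁅y, z⁆, x⁆ := by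
      rw [eq_neg_iff_add_eq_zero, ← h]
      abel
    exact h4.symm

noncomputable instance : LieAlgebra ℝ (OfLaw C) where
  lie_smul t x y := by
    funext k
    rw [smul_apply]
    simp only [lie_apply, smul_apply, Finset.mul_sum]
    refine Finset.sum_congr rfl fun i _ => Finset.sum_congr rfl fun j _ => ?_
    ring

end OfLaw

/-- Integer structure constants on `{X₁, …, Xₙ}` from a table: an entry `(i, j, k, c)` stands for
`C_{ij}^k = c` and `C_{ji}^k = -c`, and brackets that are not listed vanish. Indices in the table
start at 1. -/
def ofTable (n : ℕ) (T : List (ℕ × ℕ × ℕ × ℤ)) (i j k : Fin n) : ℤ :=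
  (T.map fun e =>
    if e.1 = i.1 + 1 ∧ e.2.1 = j.1 + 1 ∧ e.2.2.1 = k.1 + 1 then e.2.2.2
    else if e.1 = j.1 + 1 ∧ e.2.1 = i.1 + 1 ∧ e.2.2.1 = k.1 + 1 then -e.2.2.2
    else 0).sum

/-- An integral law, seen as a real one. -/
def realLaw {n : ℕ} (c : Fin n → Fin n → Fin n → ℤ)
    (h₁ : ∀ i j k, c i j k = -c j i k)
    (h₂ : ∀ i j k l, ∑ m, (c i j m * c m k l + c j k m * c m i l + c k i m * c m j l) = 0) :
    lieVariety n :=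
  ⟨fun i j k => (c i j k : ℝ),
    fun i j k => by
      have h := congrArg (Int.cast : ℤ → ℝ) (h₁ i j k)
      rwa [Int.cast_neg] at h,
    fun i j k l => by
      have h := congrArg (Int.cast : ℤ → ℝ) (h₂ i j k l)
      push_cast at h
      exact h⟩

/-- Structure constants of `L_{6,1}`. -/
def c61 : Fin 6 → Fin 6 → Fin 6 → ℤ :=
  ofTable 6 [(2, 3, 1, 1), (1, 2, 3, 1), (1, 3, 2, -1), (1, 5, 6, 1), (1, 6, 5, -1),
    (2, 4, 6, -1), (2, 6, 4, 1), (3, 4, 5, 1), (3, 5, 4, -1)]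

/-- Structure constants of `L_{6,2}`. -/
def c62 : Fin 6 → Fin 6 → Fin 6 → ℤ :=
  ofTable 6 [(1, 2, 2, 2), (1, 3, 3, -2), (2, 3, 1, 1), (1, 4, 4, 1), (2, 5, 4, 1),
    (3, 4, 5, 1), (1, 5, 5, -1), (4, 5, 6, 1)]

/-- Structure constants of `L_{6,3}`. -/
def c63 : Fin 6 → Fin 6 → Fin 6 → ℤ :=
  ofTable 6 [(1, 2, 2, 2), (1, 3, 3, -2), (2, 3, 1, 1), (1, 4, 4, 1), (2, 5, 4, 1),
    (3, 4, 5, 1), (1, 5, 5, -1), (4, 6, 4, 1), (5, 6, 5, 1)]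

/-- Structure constants of `L_{6,4}`. -/
def c64 : Fin 6 → Fin 6 → Fin 6 → ℤ :=
  ofTable 6 [(1, 2, 2, 2), (1, 3, 3, -2), (2, 3, 1, 1), (1, 4, 4, 2), (1, 6, 6, -2),
    (2, 5, 4, 2), (2, 6, 5, 1), (3, 4, 5, 1), (3, 5, 6, 2)]

abbrev L61 : Type := OfLaw (realLaw c61 (by decide +kernel) (by decide +kernel))

abbrev L62 : Type := OfLaw (realLaw c62 (by decide +kernel) (by decide +kernel))

abbrev L63 : Type := OfLaw (realLaw c63 (by decide +kernel) (by decide +kernel))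

abbrev L64 : Type := OfLaw (realLaw c64 (by decide +kernel) (by decide +kernel))

/-! ### Inhomogeneous Lie algebras -/

/-- The semidirect sum of a Lie algebra `L` with an `L`-module `M`, where `M` becomes an abelian
ideal: `[(x, v), (y, w)] = ([x, y], x w - y v)`. -/
def Inhom (L M : Type*) : Type _ := L × M

namespace Inhom

variable (L M : Type*) [LieRing L] [LieAlgebra ℝ L] [AddCommGroup M] [Module ℝ M]
  [LieRingModule L M] [LieModule ℝ L M]

instance : AddCommGroup (Inhom L M) := inferInstanceAs (AddCommGroup (L × M))

instance : Module ℝ (Inhom L M) := inferInstanceAs (Module ℝ (L × M))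

instance : Bracket (Inhom L M) (Inhom L M) where
  bracket p q := (⁅p.1, q.1⁆, ⁅p.1, q.2⁆ - ⁅q.1, p.2⁆)

instance : LieRing (Inhom L M) where
  add_lie p q r := Prod.ext (add_lie p.1 q.1 r.1) (by
    change ⁅p.1 + q.1, r.2⁆ - ⁅r.1, p.2 + q.2⁆ =
      (⁅p.1, r.2⁆ - ⁅r.1, p.2⁆) + (⁅q.1, r.2⁆ - ⁅r.1, q.2⁆)
    rw [add_lie, lie_add]; abel)
  lie_add p q r := Prod.ext (lie_add p.1 q.1 r.1) (by
    change ⁅p.1, q.2 + r.2⁆ - ⁅q.1 + r.1, p.2⁆ =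
      (⁅p.1, q.2⁆ - ⁅q.1, p.2⁆) + (⁅p.1, r.2⁆ - ⁅r.1, p.2⁆)
    rw [add_lie, lie_add]; abel)
  lie_self p := Prod.ext (lie_self p.1) (sub_self _)
  leibniz_lie p q r := Prod.ext (leibniz_lie p.1 q.1 r.1) (by
    change ⁅p.1, ⁅q.1, r.2⁆ - ⁅r.1, q.2⁆⁆ - ⁅⁅q.1, r.1⁆, p.2⁆ =
      (⁅⁅p.1, q.1⁆, r.2⁆ - ⁅r.1, ⁅p.1, q.2⁆ - ⁅q.1, p.2⁆⁆) +
      (⁅q.1, ⁅p.1, r.2⁆ - ⁅r.1, p.2⁆⁆ - ⁅⁅p.1, r.1⁆, q.2⁆)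
    simp only [lie_sub, lie_lie]; abel)

instance : LieAlgebra ℝ (Inhom L M) where
  lie_smul t p q := Prod.ext (lie_smul t p.1 q.1) (by
    change ⁅p.1, t • q.2⁆ - ⁅t • q.1, p.2⁆ = t • (⁅p.1, q.2⁆ - ⁅q.1, p.2⁆)
    rw [lie_smul, smul_lie, smul_sub])

end Inhom

/-- `I𝔰𝔬(3)`: rotations and translations of `ℝ³`, with `𝔰𝔬(3)` acting on `ℝ³` as matrices. -/
abbrev Iso3 : Type := Inhom (LieAlgebra.Orthogonal.so (Fin 3) ℝ) (Fin 3 → ℝ)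

/-- `I𝔰𝔩(2,ℝ)`: the semidirect sum of `𝔰𝔩(2,ℝ)` with its three-dimensional irreducible
representation (the adjoint one), turned into an abelian ideal. -/
abbrev Isl2 : Type :=
  Inhom (LieAlgebra.SpecialLinear.sl (Fin 2) ℝ) (LieAlgebra.SpecialLinear.sl (Fin 2) ℝ)

/-- The compact algebra `𝔰𝔬(4)`. -/
abbrev So4 : Type := LieAlgebra.Orthogonal.so (Fin 4) ℝ

/-- The Lorentz algebra `𝔰𝔬(3,1)`. -/
abbrev So31 : Type := LieAlgebra.Orthogonal.so' (Fin 3) (Fin 1) ℝ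

/-- The algebra `𝔰𝔬(2,2)`. -/
abbrev So22 : Type := LieAlgebra.Orthogonal.so' (Fin 2) (Fin 2) ℝ

end LowDimLie

/-
Vanishing of `H²` implies stability. Let `Y` be a complement of the coboundaries of the law `μ`. By
the implicit function theorem, every bilinear map near `μ` is transported by some `P` near the
identity to `μ + w` with `w ∈ Y` small. If it is a law, the linearized law equations at `μ` are
`O(‖w‖²)` at `w`; they are injective on `Y` because `H² = 0`, so `w = 0`. For `L_{6,2}` and
`L_{6,3}`, subtracting a coboundary from a cocycle leaves only its part of weight zero for the
diagonalizable `ad X₁`, where the cocycle equations are solved by hand.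

A contraction is a limit of isomorphic laws. Hence a stable algebra is a contraction only of
algebras isomorphic to it, and never of a semisimple one if its radical is nonzero.

In a nontrivial Levi decomposition of dimension six, the Levi factor has dimension three by counting
dimensions, so it is a copy of `𝔰𝔬(3)` or `𝔰𝔩(2,ℝ)`. The radical is then a nontrivial module of
dimension three: the vector, the adjoint, or the standard plus the trivial module. Equivariance
determines its bracket up to scalars, and solvability makes it zero in the irreducible cases.
-/

namespace LowDimLie

open Filter Topology Module

/-! ### Structure constants and bases -/

section Laws

variable {g g' : Type*} [LieRing g] [LieAlgebra ℝ g] [LieRing g'] [LieAlgebra ℝ g'] {n : ℕ}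

theorem lie_lie_cyclic {L : Type*} [LieRing L] (x y z : L) :
    ⁅⁅x, y⁆, z⁆ + ⁅⁅y, z⁆, x⁆ + ⁅⁅z, x⁆, y⁆ = 0 := by
  have h := lie_jacobi z x y
  rw [← lie_skew z ⁅x, y⁆, ← lie_skew x ⁅y, z⁆, ← lie_skew y ⁅z, x⁆] at h
  rw [← neg_eq_zero, ← h]
  abel

theorem repr_lie_eq_sum (b : Basis (Fin n) ℝ g) (x y : g) (l : Fin n) :
    b.repr ⁅x, y⁆ l = ∑ m, b.repr x m * b.repr ⁅b m, y⁆ l := by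
  conv_lhs => rw [← b.sum_repr x, sum_lie, map_sum]
  simp

/-- The structure constants of a Lie algebra with respect to a basis. -/
noncomputable def lawOfBasis (b : Basis (Fin n) ℝ g) : lieVariety n :=
  ⟨fun i j k => b.repr ⁅b i, b j⁆ k,
    fun i j k => by
      change b.repr ⁅b i, b j⁆ k = -b.repr ⁅b j, b i⁆ k
      rw [← lie_skew, map_neg, Finsupp.neg_apply],
    fun i j k l => by
      simp only [Finset.sum_add_distrib, ← repr_lie_eq_sum]
      rw [← Finsupp.add_apply, ← Finsupp.add_apply, ← map_add, ← map_add, lie_lie_cyclic,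
        map_zero, Finsupp.zero_apply]⟩

theorem lawOfBasis_apply (b : Basis (Fin n) ℝ g) (i j k : Fin n) :
    (lawOfBasis b).1 i j k = b.repr ⁅b i, b j⁆ k := rfl

theorem lie_basis_eq_sum (b : Basis (Fin n) ℝ g) (i j : Fin n) :
    ⁅b i, b j⁆ = ∑ k, (lawOfBasis b).1 i j k • b k :=
  (b.sum_repr _).symm

theorem lawOfBasis_map (b : Basis (Fin n) ℝ g) (e : g ≃ₗ⁅ℝ⁆ g') :
    lawOfBasis (b.map e.toLinearEquiv) = lawOfBasis b := by
  ext i j k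
  have h : e.toLinearEquiv.symm ⁅e (b i), e (b j)⁆ = ⁅b i, b j⁆ := by
    rw [← LieEquiv.map_lie]
    exact e.toLinearEquiv.symm_apply_apply _
  exact congrArg (fun x => b.repr x k) h

theorem lawOfBasis_eq_of_lt (b : Basis (Fin n) ℝ g) (C : lieVariety n)
    (h : ∀ i j, i < j → ⁅b i, b j⁆ = ∑ k, C.1 i j k • b k) : lawOfBasis b = C := by
  have key : ∀ i j k, i < j → (lawOfBasis b).1 i j k = C.1 i j k := fun i j k hij => by
    rw [lawOfBasis_apply, h i j hij]
    simp [Finsupp.single_apply]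
  ext i j k
  rcases lt_trichotomy i j with hij | rfl | hij
  · exact key i j k hij
  · linarith [C.2.1 i i k, (lawOfBasis b).2.1 i i k]
  · rw [C.2.1, (lawOfBasis b).2.1, key j i k hij]

/-- A linear isomorphism that respects the brackets of the members of a basis. -/
noncomputable def lieEquivOfBasis (b : Basis (Fin n) ℝ g) (e : g ≃ₗ[ℝ] g')
    (h : ∀ i j, e ⁅b i, b j⁆ = ⁅e (b i), e (b j)⁆) : g ≃ₗ⁅ℝ⁆ g' :=
  { e with
    map_lie' := by
      intro x y
      change e ⁅x, y⁆ = ⁅e x, e y⁆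
      rw [← b.sum_repr x, ← b.sum_repr y]
      simp only [sum_lie, lie_sum, map_sum, smul_lie, lie_smul, map_smul, h] }

namespace OfLaw

/-- The standard basis of the Lie algebra of a law. -/
noncomputable def basis (C : lieVariety n) : Basis (Fin n) ℝ (OfLaw C) :=
  Pi.basisFun ℝ (Fin n)

theorem basis_repr (C : lieVariety n) (x : OfLaw C) (k : Fin n) : (basis C).repr x k = x k :=
  rfl

theorem basis_apply (C : lieVariety n) (i j : Fin n) :
    basis C i j = if j = i then 1 else 0 := by
  rw [← basis_repr C (basis C i) j, Basis.repr_self, Finsupp.single_apply]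
  simp only [eq_comm]

theorem lie_basis_apply (C : lieVariety n) (i j k : Fin n) :
    ⁅basis C i, basis C j⁆ k = C.1 i j k := by
  rw [lie_apply]
  simp [basis_apply]

instance (C : lieVariety n) : FiniteDimensional ℝ (OfLaw C) :=
  Module.Finite.of_basis (basis C)

theorem finrank_eq (C : lieVariety n) : finrank ℝ (OfLaw C) = n := by
  rw [finrank_eq_card_basis (basis C), Fintype.card_fin]

theorem lawOfBasis_basis (C : lieVariety n) : lawOfBasis (basis C) = C := by
  ext i j k
  exact lie_basis_apply C i j k

end OfLaw

/-- The Lie algebra of the structure constants of `g`, identified with `g`. -/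
noncomputable def ofLawEquiv (b : Basis (Fin n) ℝ g) : OfLaw (lawOfBasis b) ≃ₗ⁅ℝ⁆ g :=
  lieEquivOfBasis (OfLaw.basis _) ((OfLaw.basis _).equiv b (Equiv.refl _)) fun i j => by
    rw [lie_basis_eq_sum, OfLaw.lawOfBasis_basis]
    simp [lie_basis_eq_sum b]

theorem nonempty_ofLaw_lieEquiv_iff {C : lieVariety n} :
    Nonempty (OfLaw C ≃ₗ⁅ℝ⁆ g) ↔ ∃ b : Basis (Fin n) ℝ g, lawOfBasis b = C := by
  constructor
  · rintro ⟨e⟩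
    exact ⟨_, (lawOfBasis_map (OfLaw.basis C) e).trans (OfLaw.lawOfBasis_basis C)⟩
  · rintro ⟨b, rfl⟩
    exact ⟨ofLawEquiv b⟩

end Laws

/-! ### Orbits and contractions -/

section Orbits

variable {g g' s s' : Type*} [LieRing g] [LieAlgebra ℝ g] [LieRing g'] [LieAlgebra ℝ g']
  [LieRing s] [LieAlgebra ℝ s] [LieRing s'] [LieAlgebra ℝ s'] {n : ℕ}

theorem mem_orbit_iff {C : lieVariety (finrank ℝ g)} :
    C ∈ orbit g ↔ Nonempty (OfLaw C ≃ₗ⁅ℝ⁆ g) := by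
  rw [nonempty_ofLaw_lieEquiv_iff]
  refine exists_congr fun b => ⟨fun h => ?_, ?_⟩
  · ext i j k
    exact (h i j k).symm
  · rintro rfl i j k
    rfl

theorem isStable_iff_isOpen (h : finrank ℝ g = n) :
    IsStable g ↔ IsOpen {C : lieVariety n | Nonempty (OfLaw C ≃ₗ⁅ℝ⁆ g)} := by
  subst h
  exact iff_of_eq (congrArg IsOpen (Set.ext fun C => mem_orbit_iff))

theorem IsStable.of_lieEquiv (h : IsStable g) (e : g ≃ₗ⁅ℝ⁆ g') : IsStable g' := by
  rw [isStable_iff_isOpen rfl] at h ⊢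
  rw [← e.toLinearEquiv.finrank_eq]
  convert h using 3
  exact ⟨fun ⟨f⟩ => ⟨f.trans e.symm⟩, fun ⟨f⟩ => ⟨f.trans e⟩⟩

theorem IsContraction.congr_right (h : IsContraction s g) (e : g' ≃ₗ⁅ℝ⁆ g) :
    IsContraction s g' := by
  obtain ⟨Φ, f, hf⟩ := h
  refine ⟨Φ, e.toLinearEquiv.trans f, fun X Y φ => ?_⟩
  have h := hf (e X) (e Y) φ
  rwa [← LieEquiv.map_lie] at h

theorem IsContraction.congr_left (h : IsContraction s g) (e : s ≃ₗ⁅ℝ⁆ s') :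
    IsContraction s' g := by
  obtain ⟨Φ, f, hf⟩ := h
  refine ⟨fun t => (e.toLinearEquiv.symm.trans (Φ t)).trans e.toLinearEquiv,
    f.trans e.toLinearEquiv, fun X Y φ => ?_⟩
  refine (hf X Y (φ ∘ₗ e.toLinearEquiv.toLinearMap)).congr fun t => congrArg φ ?_
  change e _ = e ((Φ t).symm (e.symm ⁅e (Φ t (e.symm (e (f X)))), e (Φ t (e.symm (e (f Y))))⁆))
  rw [← LieEquiv.map_lie, e.symm_apply_apply, e.symm_apply_apply, e.symm_apply_apply]

theorem IsContraction.exists_tendsto_lawOfBasis (h : IsContraction s g)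
    (b : Basis (Fin n) ℝ g) :
    ∃ c : ℝ → Basis (Fin n) ℝ s,
      Tendsto (fun t => lawOfBasis (c t)) atTop (𝓝 (lawOfBasis b)) := by
  obtain ⟨Φ, e, he⟩ := h
  refine ⟨fun t => b.map (e.trans (Φ t)), ?_⟩
  simp only [tendsto_subtype_rng, tendsto_pi_nhds]
  intro i j k
  have h := he (b i) (b j) ((b.map e).coord k)
  simpa [lawOfBasis_apply] using h

theorem isContraction_of_tendsto_lawOfBasis (b : ℝ → Basis (Fin n) ℝ g) {D : lieVariety n}
    (h : Tendsto (fun t => lawOfBasis (b t)) atTop (𝓝 D)) : IsContraction g (OfLaw D) := by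
  let E : ℝ → (Fin n → ℝ) ≃ₗ[ℝ] g := fun t => (ofLawEquiv (b t)).toLinearEquiv
  refine ⟨fun t => (E 0).symm.trans (E t), E 0, fun (X Y : Fin n → ℝ) f => ?_⟩
  let F : lieVariety n → Fin n → ℝ := fun C k => ∑ i, ∑ j, X i * Y j * C.1 i j k
  have hF : Continuous F := continuous_pi fun k => continuous_finsetSum _ fun i _ =>
    continuous_finsetSum _ fun j _ => continuous_const.mul
      ((continuous_apply k).comp ((continuous_apply_apply i j).comp continuous_subtype_val))
  have hf : Continuous (f ∘ₗ (E 0).toLinearMap) := LinearMap.continuous_of_finiteDimensional _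
  refine ((hf.comp hF).continuousAt.tendsto.comp h).congr fun t => congrArg f ?_
  have hlie : E t (F (lawOfBasis (b t))) = ⁅E t X, E t Y⁆ :=
    LieEquiv.map_lie (ofLawEquiv (b t)) X Y
  change E 0 (F _) = E 0 ((E t).symm ⁅E t ((E 0).symm (E 0 X)), E t ((E 0).symm (E 0 Y))⁆)
  simp only [LinearEquiv.symm_apply_apply, ← hlie]

theorem IsStable.nonempty_lieEquiv_of_isContraction [FiniteDimensional ℝ g] (hg : IsStable g)
    (h : IsContraction s g) : Nonempty (s ≃ₗ⁅ℝ⁆ g) := by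
  obtain ⟨c, hc⟩ := h.exists_tendsto_lawOfBasis (finBasis ℝ g)
  have hmem : lawOfBasis (finBasis ℝ g) ∈ orbit g := mem_orbit_iff.2 ⟨ofLawEquiv _⟩
  obtain ⟨t, ht⟩ := (hc.eventually (hg.mem_nhds hmem)).exists
  obtain ⟨e⟩ := mem_orbit_iff.1 ht
  exact ⟨(ofLawEquiv (c t)).symm.trans e⟩

theorem isContraction_of_filtration {C D : lieVariety n} (w : Fin n → ℤ)
    (hC : ∀ i j k, w i + w j < w k → C.1 i j k = 0)
    (hD : ∀ i j k, D.1 i j k = if w k = w i + w j then C.1 i j k else 0) :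
    IsContraction (OfLaw C) (OfLaw D) := by
  let u : ℝ → Fin n → ℝˣ := fun t i => Units.mk0 (Real.exp (-(w i * t))) (Real.exp_ne_zero _)
  refine isContraction_of_tendsto_lawOfBasis (fun t => (OfLaw.basis C).unitsSMul (u t)) ?_
  have hlaw : ∀ t i j k, (lawOfBasis ((OfLaw.basis C).unitsSMul (u t))).1 i j k =
      Real.exp ((w k - w i - w j : ℤ) * t) * C.1 i j k := fun t i j k => by
    rw [lawOfBasis_apply, Basis.repr_unitsSMul, Basis.unitsSMul_apply, Basis.unitsSMul_apply]
    simp only [Units.smul_def, smul_lie, lie_smul, map_smul, Finsupp.smul_apply, smul_eq_mul,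
      OfLaw.basis_repr, OfLaw.lie_basis_apply, u, Units.val_inv_eq_inv_val, Units.val_mk0,
      ← Real.exp_neg, ← mul_assoc, ← Real.exp_add]
    congr 2
    push_cast
    ring
  simp only [tendsto_subtype_rng, tendsto_pi_nhds, hlaw, hD]
  intro i j k
  rcases lt_trichotomy (w k) (w i + w j) with h | h | h
  · have hneg : ((w k - w i - w j : ℤ) : ℝ) < 0 := by exact_mod_cast (by lia)
    rw [if_neg h.ne, ← zero_mul (C.1 i j k)]
    exact (Real.tendsto_exp_atBot.comp (tendsto_id.const_mul_atTop_of_neg hneg)).mul_const _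
  · simp [h]
  · simp [hC i j k h]

end Orbits

/-! ### Adjoint two-cocycles -/

section Cocycles

variable {g : Type*} [LieRing g] [LieAlgebra ℝ g]

/-- Two-cocycles with values in the adjoint module, as alternating bilinear maps. The cocycle
identity is written cyclically, like the Jacobi identity of which it is the linearization. -/
structure IsAdjointCocycle (a : g →ₗ[ℝ] g →ₗ[ℝ] g) : Prop where
  alternating : ∀ x, a x x = 0
  cyclic : ∀ x y z, a ⁅x, y⁆ z + a ⁅y, z⁆ x + a ⁅z, x⁆ y +
    (⁅a x y, z⁆ + ⁅a y z, x⁆ + ⁅a z x, y⁆) = 0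

/-- Two-coboundaries with values in the adjoint module. -/
def IsAdjointCoboundary (a : g →ₗ[ℝ] g →ₗ[ℝ] g) : Prop :=
  ∃ f : g →ₗ[ℝ] g, ∀ x y, a x y = ⁅x, f y⁆ + ⁅f x, y⁆ - f ⁅x, y⁆

theorem IsAdjointCocycle.skew {a : g →ₗ[ℝ] g →ₗ[ℝ] g} (ha : IsAdjointCocycle a) (x y : g) :
    a x y = -a y x := by
  have h := ha.alternating (x + y)
  simp only [map_add, LinearMap.add_apply, ha.alternating, zero_add, add_zero] at h
  exact eq_neg_of_add_eq_zero_right h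

theorem subsingleton_subquotient_iff {V : Type*} [AddCommGroup V] [Module ℝ V]
    (Z B : Submodule ℝ V) : Subsingleton (Subquotient Z B) ↔ Z ≤ B := by
  rw [Submodule.Quotient.subsingleton_iff, Submodule.submoduleOf, Submodule.eq_top_iff']
  exact ⟨fun h a ha => h ⟨a, ha⟩, fun h a => h a.2⟩

open LieModule.Cohomology in
theorem mem_twoCocycle_iff_isAdjointCocycle (a : twoCochain ℝ g g) :
    a ∈ twoCocycle ℝ g g ↔ IsAdjointCocycle (a : g →ₗ[ℝ] g →ₗ[ℝ] g) := by
  have hd : ∀ x y z, d₂₃ ℝ g g a x y z = -(a.1 ⁅x, y⁆ z + a.1 ⁅y, z⁆ x + a.1 ⁅z, x⁆ y +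
      (⁅a.1 x y, z⁆ + ⁅a.1 y z, x⁆ + ⁅a.1 z x, y⁆)) := fun x y z => by
    have hskew : ∀ x y, a.1 x y = -a.1 y x := fun x y => (twoCochain_skew a y x).symm
    rw [d₂₃_apply]
    change ⁅x, a.1 y z⁆ - ⁅y, a.1 x z⁆ + ⁅z, a.1 x y⁆ - a.1 ⁅x, y⁆ z + a.1 ⁅x, z⁆ y -
      a.1 ⁅y, z⁆ x = _
    rw [hskew x z, ← lie_skew x z, ← lie_skew x, ← lie_skew y, ← lie_skew z]
    simp only [map_neg, neg_lie, LinearMap.neg_apply]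
    abel
  rw [mem_twoCocycle_iff]
  refine ⟨fun h => ⟨a.2, fun x y z => ?_⟩, fun h => ?_⟩
  · rw [← neg_eq_zero, ← hd, h]
    rfl
  · ext x y z
    rw [hd, h.cyclic, neg_zero]
    rfl

open LieModule.Cohomology in
theorem subsingleton_H2_iff : Subsingleton (H2 g) ↔
    ∀ a : g →ₗ[ℝ] g →ₗ[ℝ] g, IsAdjointCocycle a → IsAdjointCoboundary a := by
  have hd : ∀ (f : g →ₗ[ℝ] g) (x y : g),
      d₁₂ ℝ g g f x y = ⁅x, f y⁆ + ⁅f x, y⁆ - f ⁅x, y⁆ := fun f x y => by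
    rw [d₁₂_apply_apply, ← lie_skew y, sub_neg_eq_add]
  refine (subsingleton_subquotient_iff (V := twoCochain ℝ g g) _ _).trans ⟨fun h a ha => ?_,
    fun h a ha => ?_⟩
  · let c : twoCochain ℝ g g := ⟨a, ha.alternating⟩
    obtain ⟨f, hf⟩ := h ((mem_twoCocycle_iff_isAdjointCocycle c).2 ha)
    exact ⟨f, fun x y => (congrArg (fun c : twoCochain ℝ g g => c x y) hf).symm.trans (hd f x y)⟩
  · obtain ⟨f, hf⟩ := h a.1 ((mem_twoCocycle_iff_isAdjointCocycle a).1 ha)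
    refine ⟨f, ?_⟩
    ext x y
    exact (hd f x y).trans (hf x y).symm

end Cocycles

/-! ### Rigidity -/

section ImplicitFunction

variable {T X Y F : Type*} [NormedAddCommGroup T] [NormedSpace ℝ T] [NormedAddCommGroup X]
  [NormedSpace ℝ X] [NormedAddCommGroup Y] [NormedSpace ℝ Y] [NormedAddCommGroup F]
  [NormedSpace ℝ F]

theorem eventually_exists_eq_zero [CompleteSpace T] [CompleteSpace X] [CompleteSpace F]
    {f : T × X → F} {f' : T × X →L[ℝ] F} {t₀ : T} {x₀ : X}
    (hf : HasStrictFDerivAt f f' (t₀, x₀)) (h₀ : f (t₀, x₀) = 0)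
    (hsurj : ∀ z, ∃ x, f' (0, x) = z) {U : Set X} (hU : U ∈ 𝓝 x₀) :
    ∀ᶠ t in 𝓝 t₀, ∃ x ∈ U, f (t, x) = 0 := by
  have hgraph : HasStrictFDerivAt (fun q : T × X => (q.1, f q))
      ((ContinuousLinearMap.fst ℝ T X).prod f') (t₀, x₀) :=
    hasStrictFDerivAt_fst.prodMk hf
  have hmap := hgraph.map_nhds_eq_of_surj (by
    rw [LinearMap.range_eq_top]
    rintro ⟨t, z⟩
    obtain ⟨x, hx⟩ := hsurj (z - f' (t, 0))
    refine ⟨(t, x), Prod.ext rfl ?_⟩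
    have hsplit : f' (t, x) = f' (t, 0) + f' (0, x) := by simp [← map_add]
    simp [hsplit, hx])
  have himage : (fun q : T × X => (q.1, f q)) '' {q | q.2 ∈ U} ∈ 𝓝 ((t₀, 0) : T × F) := by
    rw [← h₀, ← hmap]
    exact image_mem_map (continuous_snd.continuousAt hU)
  have hlim : Tendsto (fun t => ((t, 0) : T × F)) (𝓝 t₀) (𝓝 (t₀, 0)) :=
    (Continuous.prodMk_left _).continuousAt
  filter_upwards [hlim himage] with t ht
  obtain ⟨⟨t', x⟩, hx, hq⟩ := ht
  obtain rfl : t' = t := congrArg Prod.fst hq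
  exact ⟨x, hx, congrArg Prod.snd hq⟩

theorem eventually_exists_transport [CompleteSpace T] [CompleteSpace X] [CompleteSpace Y]
    (push left right : T →L[ℝ] X →L[ℝ] T) (ι : Y →L[ℝ] T) (t₀ : T) (x₀ : X)
    (hpush : ∀ t, push t x₀ = t) (hleft : ∀ t, left t x₀ = t) (hright : ∀ t, right t x₀ = t)
    (hsurj : ∀ z, ∃ v w, left t₀ v + right t₀ v - push t₀ v + ι w = z)
    {U : Set (X × Y)} (hU : U ∈ 𝓝 ((x₀, 0) : X × Y)) :
    ∀ᶠ t in 𝓝 t₀, ∃ p ∈ U, push t p.1 = right (left (t₀ + ι p.2) p.1) p.1 := by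
  let q₀ : T × X × Y := (t₀, x₀, 0)
  have ht := hasStrictFDerivAt_fst (𝕜 := ℝ) (p := q₀)
  have hsnd := hasStrictFDerivAt_snd (𝕜 := ℝ) (p := q₀)
  have hx := (hasStrictFDerivAt_fst (𝕜 := ℝ) (p := q₀.2)).comp q₀ hsnd
  have hw := (ι.hasStrictFDerivAt.comp q₀
    ((hasStrictFDerivAt_snd (𝕜 := ℝ) (p := q₀.2)).comp q₀ hsnd)).const_add t₀
  have hpushed := (push.hasStrictFDerivAt.comp q₀ ht).clm_apply hx
  have hpulled := (right.hasStrictFDerivAt.comp q₀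
    ((left.hasStrictFDerivAt.comp q₀ hw).clm_apply hx)).clm_apply hx
  have hzero := eventually_exists_eq_zero (hpushed.sub hpulled)
    (by simp [hpush, hleft, hright])
    (fun z => by
      obtain ⟨v, w, rfl⟩ := hsurj z
      refine ⟨(-v, -w), ?_⟩
      simp [q₀, hleft, hright]
      abel) hU
  filter_upwards [hzero] with t ⟨p, hp, h⟩
  exact ⟨p, hp, sub_eq_zero.1 h⟩

theorem eventually_eq_zero_of_norm_le_sq [FiniteDimensional ℝ Y] (D : Y →ₗ[ℝ] F)
    (hD : LinearMap.ker D = ⊥) (c : ℝ) :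
    ∀ᶠ w in 𝓝 (0 : Y), ‖D w‖ ≤ c * ‖w‖ * ‖w‖ → w = 0 := by
  obtain ⟨K, -, hK⟩ := LinearMap.exists_antilipschitzWith D hD
  have hsmall : ∀ᶠ w in 𝓝 (0 : Y), K * (c * ‖w‖) < 1 :=
    (show Continuous fun w : Y => K * (c * ‖w‖) by fun_prop).continuousAt.eventually_lt
      continuousAt_const (by simp)
  filter_upwards [hsmall] with w hw hDw
  have hle : ‖w‖ ≤ K * ‖D w‖ := by simpa using hK.le_mul_dist w 0
  by_contra hne
  have hpos : 0 < ‖w‖ := norm_pos_iff.2 hne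
  refine lt_irrefl ‖w‖ (calc
    ‖w‖ ≤ K * (c * ‖w‖ * ‖w‖) := hle.trans (by gcongr)
    _ = K * (c * ‖w‖) * ‖w‖ := by ring
    _ < ‖w‖ := mul_lt_of_lt_one_left hpos hw)

end ImplicitFunction

section Rigidity

set_option maxSynthPendingDepth 4

variable {V : Type*} [NormedAddCommGroup V] [NormedSpace ℝ V]

/-- The products on a normed space `V`: its continuous bilinear maps. -/
abbrev Product (V : Type*) [NormedAddCommGroup V] [NormedSpace ℝ V] : Type _ := V →L[ℝ] V →L[ℝ] V

namespace Product

open ContinuousLinearMap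

/-- The product `P (μ x y)`, bilinearly in `μ` and `P`. -/
noncomputable def push : Product V →L[ℝ] (V →L[ℝ] V) →L[ℝ] Product V :=
  ((compL ℝ V (V →L[ℝ] V) (V →L[ℝ] V)) ∘L (compL ℝ V V V)).flip

/-- The product `μ (P x) y`, bilinearly in `μ` and `P`. -/
noncomputable def pullLeft : Product V →L[ℝ] (V →L[ℝ] V) →L[ℝ] Product V :=
  compL ℝ V V (V →L[ℝ] V)

/-- The product `μ x (P y)`, bilinearly in `μ` and `P`. -/
noncomputable def pullRight : Product V →L[ℝ] (V →L[ℝ] V) →L[ℝ] Product V :=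
  ((compL ℝ V (V →L[ℝ] V) (V →L[ℝ] V)) ∘L (compL ℝ V V V).flip).flip

/-- Cyclic permutation of the arguments of a trilinear map. -/
noncomputable def rotate : (V →L[ℝ] Product V) →L[ℝ] (V →L[ℝ] Product V) :=
  (flipₗᵢ ℝ V V (V →L[ℝ] V)).toContinuousLinearEquiv.toContinuousLinearMap ∘L
    compL ℝ V (Product V) (Product V)
      (flipₗᵢ ℝ V V V).toContinuousLinearEquiv.toContinuousLinearMap

/-- The polarized Jacobi expression of two products. -/
noncomputable def jacobiator : Product V →L[ℝ] Product V →L[ℝ] (V →L[ℝ] Product V) :=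
  compL ℝ (Product V) (V →L[ℝ] Product V) (V →L[ℝ] Product V)
    (ContinuousLinearMap.id ℝ _ + rotate + rotate ∘L rotate) ∘L
      (compL ℝ V (V →L[ℝ] V) (Product V) ∘L compL ℝ V V (V →L[ℝ] V))

theorem jacobiator_apply (μ ν : Product V) (x y z : V) :
    jacobiator μ ν x y z = μ (ν x y) z + μ (ν y z) x + μ (ν z x) y := rfl

/-- The product is a Lie bracket: anticommutative, with the Jacobi identity. -/
def IsLieBracket (μ : Product V) : Prop := μ + μ.flip = 0 ∧ jacobiator μ μ = 0

/-- The equations of Lie brackets, linearized at `μ`. -/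
noncomputable def linearizedEquations (μ : Product V) :
    Product V →L[ℝ] (V →L[ℝ] Product V) × Product V :=
  (jacobiator μ + jacobiator.flip μ).prod
    (ContinuousLinearMap.id ℝ _ + (flipₗᵢ ℝ V V V).toContinuousLinearEquiv.toContinuousLinearMap)

/-- The infinitesimal change of `μ` under a linear vector field. -/
noncomputable def coboundary (μ : Product V) : (V →L[ℝ] V) →L[ℝ] Product V :=
  pullLeft μ + pullRight μ - push μ

theorem coboundary_apply (μ : Product V) (φ : V →L[ℝ] V) (x y : V) :
    coboundary μ φ x y = μ (φ x) y + μ x (φ y) - φ (μ x y) := rfl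

theorem IsLieBracket.of_equiv {μ ν : Product V} (hμ : IsLieBracket μ) (P : V ≃L[ℝ] V)
    (h : ∀ x y, P (μ x y) = ν (P x) (P y)) : IsLieBracket ν := by
  have hν : ∀ x y, ν x y = P (μ (P.symm x) (P.symm y)) := fun x y => by simp [h]
  constructor
  · ext x y
    have := congr($(hμ.1) (P.symm x) (P.symm y))
    simpa [hν, ← map_add] using this
  · ext x y z
    have := congr($(hμ.2) (P.symm x) (P.symm y) (P.symm z))
    rw [jacobiator_apply] at this
    simp only [jacobiator_apply, hν, P.symm_apply_apply, ← map_add, this]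
    simp

theorem norm_linearizedEquations_le {μ w : Product V} (hμ : IsLieBracket μ)
    (hw : IsLieBracket (μ + w)) :
    ‖linearizedEquations μ w‖ ≤ ‖jacobiator (V := V)‖ * ‖w‖ * ‖w‖ := by
  have hjac : jacobiator μ w + jacobiator w μ = -jacobiator w w := by
    have := hw.2
    simp only [map_add, add_apply, hμ.2, zero_add] at this
    rw [eq_neg_iff_add_eq_zero, ← this]
    abel
  have hskew : w + w.flip = 0 := by
    have h := hw.1
    rwa [flip_add, add_add_add_comm, hμ.1, zero_add] at h
  have hval : linearizedEquations μ w = (-jacobiator w w, 0) :=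
    Prod.ext hjac hskew
  rw [hval, Prod.norm_mk, norm_neg, norm_zero, max_eq_left (norm_nonneg _)]
  exact le_opNorm₂ _ _ _

variable [FiniteDimensional ℝ V]

theorem eventually_exists_continuousLinearEquiv {μ₀ : Product V} (hμ₀ : IsLieBracket μ₀)
    (h : ∀ w, linearizedEquations μ₀ w = 0 → ∃ φ, coboundary μ₀ φ = w) :
    ∀ᶠ μ in 𝓝 μ₀, IsLieBracket μ →
      ∃ P : V ≃L[ℝ] V, ∀ x y, P (μ x y) = μ₀ (P x) (P y) := by
  obtain ⟨Y, hY⟩ := (LinearMap.range (coboundary μ₀).toLinearMap).exists_isCompl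
  have hker : LinearMap.ker ((linearizedEquations μ₀).toLinearMap ∘ₗ Y.subtype) = ⊥ := by
    rw [LinearMap.ker_eq_bot']
    intro w hw
    exact Subtype.ext (hY.disjoint.le_bot ⟨h _ hw, w.2⟩)
  have hunit : ∀ᶠ P in 𝓝 (ContinuousLinearMap.id ℝ V), IsUnit P := Units.nhds 1
  have hrigid := eventually_eq_zero_of_norm_le_sq _ hker ‖jacobiator (V := V)‖
  have htransport := eventually_exists_transport push pullLeft pullRight Y.subtypeL μ₀
    (ContinuousLinearMap.id ℝ V) (fun _ => rfl) (fun _ => rfl) (fun _ => rfl)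
    (fun z => by
      obtain ⟨_, ⟨φ, rfl⟩, w, hw, hz⟩ :=
        Submodule.mem_sup.1 (hY.sup_eq_top ▸ Submodule.mem_top : z ∈ _ ⊔ Y)
      exact ⟨φ, ⟨w, hw⟩, hz⟩)
    (hunit.prod_nhds hrigid)
  filter_upwards [htransport] with μ ⟨⟨P, w⟩, ⟨⟨u, hu⟩, hw⟩, hPw⟩ hμ
  let e : V ≃L[ℝ] V := ContinuousLinearEquiv.ofUnit u
  have he : ∀ x y, e (μ x y) = (μ₀ + w.1) (e x) (e y) := fun x y => by
    have := congr($hPw x y)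
    rwa [← hu] at this
  have hzero : w = 0 := hw (norm_linearizedEquations_le hμ₀ (hμ.of_equiv e he))
  exact ⟨e, fun x y => by simpa [hzero] using he x y⟩

end Product

end Rigidity

section Stability

set_option maxSynthPendingDepth 4

variable {g : Type*} [LieRing g] [LieAlgebra ℝ g]
  {V : Type*} [NormedAddCommGroup V] [NormedSpace ℝ V] {μ : Product V}

theorem isLieBracket_of_linearEquiv (ε : g ≃ₗ[ℝ] V)
    (hμ : ∀ x y, μ (ε x) (ε y) = ε ⁅x, y⁆) : μ.IsLieBracket := by
  have hμ' : ∀ v w, μ v w = ε ⁅ε.symm v, ε.symm w⁆ := fun v w => by simp [← hμ]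
  constructor
  · ext v w
    change μ v w + μ w v = 0
    rw [hμ', hμ', ← lie_skew, map_neg, neg_add_cancel]
  · ext u v w
    rw [Product.jacobiator_apply]
    simp only [hμ', ε.symm_apply_apply]
    rw [← map_add, ← map_add, lie_lie_cyclic, map_zero]
    rfl

theorem exists_coboundary_eq [FiniteDimensional ℝ V] (h : Subsingleton (H2 g)) (ε : g ≃ₗ[ℝ] V)
    (hμ : ∀ x y, μ (ε x) (ε y) = ε ⁅x, y⁆) {w : Product V}
    (hw : Product.linearizedEquations μ w = 0) : ∃ φ, Product.coboundary μ φ = w := by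
  let a : g →ₗ[ℝ] g →ₗ[ℝ] g :=
    LinearMap.mk₂ ℝ (fun x y => ε.symm (w (ε x) (ε y))) (by simp) (by simp) (by simp) (by simp)
  have ha : ∀ x y, a x y = ε.symm (w (ε x) (ε y)) := fun x y => rfl
  have hcocycle : IsAdjointCocycle a := by
    constructor
    · intro x
      have h2 : w (ε x) (ε x) + w (ε x) (ε x) = 0 := congr($(congrArg Prod.snd hw) (ε x) (ε x))
      rw [← two_smul ℝ, smul_eq_zero_iff_right two_ne_zero] at h2
      rw [ha, h2, map_zero]
    · intro x y z
      have hlin : Product.jacobiator μ w (ε x) (ε y) (ε z) +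
          Product.jacobiator w μ (ε x) (ε y) (ε z) = 0 :=
        congr($(congrArg Prod.fst hw) (ε x) (ε y) (ε z))
      rw [Product.jacobiator_apply, Product.jacobiator_apply, hμ, hμ, hμ, add_comm] at hlin
      have hlie : ∀ x y z, ⁅a x y, z⁆ = ε.symm (μ (w (ε x) (ε y)) (ε z)) := fun x y z => by
        rw [ha, LinearEquiv.eq_symm_apply, ← hμ, LinearEquiv.apply_symm_apply]
      rw [hlie, hlie, hlie, ha, ha, ha]
      simp only [← map_add]
      rw [hlin, map_zero]
  obtain ⟨f, hf⟩ := subsingleton_H2_iff.1 h a hcocycle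
  refine ⟨LinearMap.toContinuousLinearMap (ε.conj f), ?_⟩
  ext u v
  have huv := congrArg ε (hf (ε.symm u) (ε.symm v))
  simp only [ha, LinearEquiv.apply_symm_apply, map_add, map_sub, ← hμ] at huv
  rw [huv, Product.coboundary_apply, add_comm (μ u _)]
  have hμ' : μ u v = ε ⁅ε.symm u, ε.symm v⁆ := by simp [← hμ]
  simp [LinearEquiv.conj_apply, hμ']

variable {n : ℕ}

open ContinuousLinearMap in
/-- The bracket with structure constants `C`, as a product on `ℝⁿ`. -/
noncomputable def productOfLaw (C : lieVariety n) : Product (Fin n → ℝ) :=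
  ∑ i, ∑ j, (proj i).smulRight ((proj j).smulRight (C.1 i j))

theorem productOfLaw_equivFun (C : lieVariety n) (x y : OfLaw C) :
    productOfLaw C ((OfLaw.basis C).equivFun x) ((OfLaw.basis C).equivFun y) =
      (OfLaw.basis C).equivFun ⁅x, y⁆ := by
  ext k
  rw [Basis.equivFun_apply, Basis.equivFun_apply, Basis.equivFun_apply, OfLaw.basis_repr,
    OfLaw.lie_apply]
  simp [productOfLaw, OfLaw.basis_repr, mul_assoc]

theorem continuous_productOfLaw : Continuous (productOfLaw (n := n)) :=
  continuous_finsetSum _ fun i _ => continuous_finsetSum _ fun j _ => by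
    have h : Continuous fun C : lieVariety n => C.1 i j :=
      (continuous_apply_apply i j).comp continuous_subtype_val
    exact (ContinuousLinearMap.smulRightL ℝ _ _ _).continuous.comp
      ((ContinuousLinearMap.smulRightL ℝ _ _ _).continuous.comp h)

theorem isStable_of_subsingleton_H2 (h : Subsingleton (H2 g)) : IsStable g := by
  refine isOpen_iff_mem_nhds.2 fun C₀ hC₀ => ?_
  obtain ⟨e⟩ := mem_orbit_iff.1 hC₀
  let E := fun C : lieVariety (finrank ℝ g) => (OfLaw.basis C).equivFun
  have hbracket : ∀ C, (productOfLaw C).IsLieBracket := fun C =>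
    isLieBracket_of_linearEquiv (E C) (productOfLaw_equivFun C)
  have hε : ∀ x y, productOfLaw C₀ (E C₀ (e.symm x)) (E C₀ (e.symm y)) = E C₀ (e.symm ⁅x, y⁆) :=
    fun x y => by rw [LieEquiv.map_lie]; exact productOfLaw_equivFun C₀ _ _
  have hrigid := Product.eventually_exists_continuousLinearEquiv (hbracket C₀)
    fun w => exists_coboundary_eq h (e.symm.toLinearEquiv.trans (E C₀)) hε
  filter_upwards [continuous_productOfLaw.continuousAt.eventually hrigid] with C hC
  obtain ⟨P, hP⟩ := hC (hbracket C)
  let f : OfLaw C ≃ₗ⁅ℝ⁆ OfLaw C₀ :=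
    lieEquivOfBasis (OfLaw.basis C) ((E C).trans (P.toLinearEquiv.trans (E C₀).symm))
      fun i j => (E C₀).injective (by
        rw [← productOfLaw_equivFun C₀]
        simp only [LinearEquiv.trans_apply, LinearEquiv.apply_symm_apply,
          ← productOfLaw_equivFun C, E]
        exact hP _ _)
  exact mem_orbit_iff.2 ⟨f.trans e⟩

end Stability

/-! ### Weights of cocycles -/

section Weights

variable {g : Type*} [LieRing g] [LieAlgebra ℝ g] {n : ℕ}

open LieModule LieModule.Cohomology

theorem repr_apply_of_eigenbasis {V : Type*} [AddCommGroup V] [Module ℝ V]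
    (b : Basis (Fin n) ℝ V) {T : End ℝ V} {w : Fin n → ℝ} (hT : ∀ i, T (b i) = w i • b i)
    (v : V) (k : Fin n) : b.repr (T v) k = w k * b.repr v k := by
  conv_lhs => rw [← b.sum_repr v, map_sum, map_sum]
  simp [hT, Finsupp.single_apply, mul_comm]

theorem exists_eq_add_lie_of_eigenbasis {V : Type*} [AddCommGroup V] [Module ℝ V]
    (b : Basis (Fin n) ℝ V) {T : End ℝ V} {w : Fin n → ℝ} (hT : ∀ i, T (b i) = w i • b i)
    (F : End ℝ V) : ∃ F₀ f : End ℝ V, ⁅T, F₀⁆ = 0 ∧ F = F₀ + ⁅T, f⁆ := by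
  let f : End ℝ V := b.constr ℝ fun j => ∑ k, (b.repr (F (b j)) k / (w k - w j)) • b k
  have hf : ∀ j k, b.repr (f (b j)) k = b.repr (F (b j)) k / (w k - w j) := fun j k => by
    simp only [f, Basis.constr_basis]
    simp [Finsupp.single_apply]
  have hlie : ∀ (φ : End ℝ V) (j k : Fin n),
      b.repr (⁅T, φ⁆ (b j)) k = (w k - w j) * b.repr (φ (b j)) k := fun φ j k => by
    rw [Ring.lie_def, LinearMap.sub_apply, Module.End.mul_apply, Module.End.mul_apply, hT, map_sub,
      Finsupp.sub_apply, repr_apply_of_eigenbasis b hT]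
    simp [sub_mul]
  refine ⟨F - ⁅T, f⁆, f, b.ext fun j => b.ext_elem fun k => ?_, (sub_add_cancel _ _).symm⟩
  rw [hlie, LinearMap.sub_apply, map_sub, Finsupp.sub_apply, hlie, hf]
  by_cases hkj : w k - w j = 0
  · simp [hkj]
  · simp [mul_div_cancel₀, hkj]

theorem d₁₂_apply_of_mem_twoCocycle {a : twoCochain ℝ g g} (ha : a ∈ twoCocycle ℝ g g)
    (h x y : g) : d₁₂ ℝ g g (a h) x y = ⁅h, a x y⁆ - a ⁅h, x⁆ y - a x ⁅h, y⁆ := by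
  have hcocycle : d₂₃ ℝ g g a h x y = 0 := by
    rw [(mem_twoCocycle_iff ℝ g g a).1 ha]
    rfl
  rw [d₂₃_apply, ← twoCochain_skew a h ⁅x, y⁆, ← twoCochain_skew a x ⁅h, y⁆] at hcocycle
  rw [d₁₂_apply_apply, ← sub_eq_zero, ← neg_eq_zero, ← hcocycle]
  abel

theorem d₁₂_lie_toEnd (h : g) (f : g →ₗ[ℝ] g) (x y : g) :
    d₁₂ ℝ g g ⁅toEnd ℝ g g h, f⁆ x y =
      ⁅h, d₁₂ ℝ g g f x y⁆ - d₁₂ ℝ g g f ⁅h, x⁆ y - d₁₂ ℝ g g f x ⁅h, y⁆ := by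
  simp only [d₁₂_apply_apply, Ring.lie_def, LinearMap.sub_apply, Module.End.mul_apply,
    toEnd_apply_apply, lie_sub, leibniz_lie h x, leibniz_lie h y, map_add]
  abel

variable (b : Basis (Fin n) ℝ g) {h : g} {w : Fin n → ℝ} (hw : ∀ i, ⁅h, b i⁆ = w i • b i)

include hw

theorem repr_lieDerivative (a : twoCochain ℝ g g) (i j k : Fin n) :
    b.repr (⁅h, a (b i) (b j)⁆ - a ⁅h, b i⁆ (b j) - a (b i) ⁅h, b j⁆) k =
      (w k - w i - w j) * b.repr (a (b i) (b j)) k := by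
  have hrepr := repr_apply_of_eigenbasis b (T := toEnd ℝ g g h) hw
  simp only [toEnd_apply_apply] at hrepr
  simp only [hw, map_sub, map_smul, LinearMap.smul_apply, Finsupp.sub_apply, Finsupp.smul_apply,
    hrepr, smul_eq_mul]
  ring

theorem exists_sub_d₁₂_weight_zero {a : twoCochain ℝ g g} (ha : a ∈ twoCocycle ℝ g g) :
    ∃ f, ∀ i j k, w i + w j ≠ w k → b.repr ((a - d₁₂ ℝ g g f) (b i) (b j)) k = 0 := by
  obtain ⟨F₀, f, hF₀, hF⟩ := exists_eq_add_lie_of_eigenbasis b (T := toEnd ℝ g g h) hw (a h)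
  refine ⟨f, fun i j k hne => ?_⟩
  have hwt : w k - w i - w j ≠ 0 := fun h0 => hne (by linarith)
  have hd₀ : b.repr (d₁₂ ℝ g g F₀ (b i) (b j)) k = 0 := by
    refine (mul_eq_zero.1 ?_).resolve_left hwt
    rw [← repr_lieDerivative b hw, ← d₁₂_lie_toEnd, hF₀, map_zero]
    exact congrArg (fun v => b.repr v k) (rfl : (0 : g) = 0) |>.trans (by simp)
  refine (mul_eq_zero.1 ?_).resolve_left hwt
  have hderiv : ∀ x y : g, ⁅h, (a - d₁₂ ℝ g g f) x y⁆ - (a - d₁₂ ℝ g g f) ⁅h, x⁆ y -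
      (a - d₁₂ ℝ g g f) x ⁅h, y⁆ = d₁₂ ℝ g g F₀ x y := fun x y => by
    have hsplit : d₁₂ ℝ g g (a h) x y =
        d₁₂ ℝ g g F₀ x y + d₁₂ ℝ g g ⁅toEnd ℝ g g h, f⁆ x y := by
      rw [hF, map_add]
      rfl
    rw [d₁₂_apply_of_mem_twoCocycle ha, d₁₂_lie_toEnd] at hsplit
    have hsub : ∀ x y : g, (a - d₁₂ ℝ g g f) x y = a x y - d₁₂ ℝ g g f x y := fun _ _ => rfl
    simp only [hsub, lie_sub]
    rw [← sub_eq_iff_eq_add.2 hsplit]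
    abel
  rw [← repr_lieDerivative b hw, hderiv, hd₀]

theorem subsingleton_H2_of_weight_zero
    (H : ∀ a : g →ₗ[ℝ] g →ₗ[ℝ] g, IsAdjointCocycle a →
      (∀ i j k, w i + w j ≠ w k → b.repr (a (b i) (b j)) k = 0) → IsAdjointCoboundary a) :
    Subsingleton (H2 g) := by
  refine subsingleton_H2_iff.2 fun a ha => ?_
  obtain ⟨c, rfl⟩ : ∃ c : twoCochain ℝ g g, c.1 = a := ⟨⟨a, ha.alternating⟩, rfl⟩
  have hc : c ∈ twoCocycle ℝ g g := (mem_twoCocycle_iff_isAdjointCocycle c).2 ha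
  obtain ⟨f, hf⟩ := exists_sub_d₁₂_weight_zero b hw hc
  have hd : d₂₃ ℝ g g (c - d₁₂ ℝ g g f) = 0 := by
    have hdd : d₂₃ ℝ g g (d₁₂ ℝ g g f) = 0 := LinearMap.congr_fun (d₂₃_comp_d₁₂ ℝ g g) f
    exact (map_sub (d₂₃ ℝ g g) _ _).trans
      (sub_eq_zero.2 (((mem_twoCocycle_iff ℝ g g c).1 hc).trans hdd.symm))
  have hsub := (mem_twoCocycle_iff_isAdjointCocycle _).1 ((mem_twoCocycle_iff ℝ g g _).2 hd)
  obtain ⟨f', hf'⟩ := H _ hsub hf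
  refine ⟨f + f', fun x y => ?_⟩
  have hxy : c x y - d₁₂ ℝ g g f x y = ⁅x, f' y⁆ + ⁅f' x, y⁆ - f' ⁅x, y⁆ := hf' x y
  change c x y = _
  rw [sub_eq_iff_eq_add.1 hxy, d₁₂_apply_apply, ← lie_skew y]
  simp only [LinearMap.add_apply, lie_add, add_lie]
  abel

end Weights

/-! ### The cohomology of `L_{6,2}` and `L_{6,3}` -/

section PlaneCohomology

/-- The minors of a pair of vectors: every alternating bilinear map is a linear combination of
them. -/
def minor {n : ℕ} (x y : Fin n → ℝ) (i j : Fin n) : ℝ := x i * y j - x j * y i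

/-- The common shape of the brackets of `L_{6,2}`, where `(α, β) = (1, 0)`, and of `L_{6,3}`, where
`(α, β) = (0, 1)`: the semidirect sum of `𝔰𝔩(2,ℝ)` and its natural module `ℝ²`, extended by `X₆`
with `[X₄, X₅] = α X₆` and `[v, X₆] = β v` for `v ∈ ℝ²`. -/
def planeBracket (α β : ℝ) (x y : Fin 6 → ℝ) : Fin 6 → ℝ :=
  ![minor x y 1 2, 2 * minor x y 0 1, -2 * minor x y 0 2,
    minor x y 0 3 + minor x y 1 4 + β * minor x y 3 5,
    minor x y 2 3 - minor x y 0 4 + β * minor x y 4 5, α * minor x y 3 4]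

/-- The weights of `X₁` in the algebras with bracket `planeBracket α β`. -/
def planeWeight : Fin 6 → ℤ := ![0, 2, -2, 1, -1, 0]

/-- The alternating bilinear maps of weight zero for `planeWeight`. -/
def planeForm (A : Fin 6 → Fin 6 → Fin 6 → ℝ) (x y : Fin 6 → ℝ) : Fin 6 → ℝ :=
  ![minor x y 0 5 * A 0 5 0 + minor x y 1 2 * A 1 2 0 + minor x y 3 4 * A 3 4 0,
    minor x y 0 1 * A 0 1 1 + minor x y 1 5 * A 1 5 1,
    minor x y 0 2 * A 0 2 2 + minor x y 2 5 * A 2 5 2,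
    minor x y 0 3 * A 0 3 3 + minor x y 1 4 * A 1 4 3 + minor x y 3 5 * A 3 5 3,
    minor x y 0 4 * A 0 4 4 + minor x y 2 3 * A 2 3 4 + minor x y 4 5 * A 4 5 4,
    minor x y 0 5 * A 0 5 5 + minor x y 1 2 * A 1 2 5 + minor x y 3 4 * A 3 4 5]

theorem sum_eq_planeForm {A : Fin 6 → Fin 6 → Fin 6 → ℝ} (hskew : ∀ i j k, A i j k = -A j i k)
    (hzero : ∀ i j k, ¬planeWeight i + planeWeight j = planeWeight k → A i j k = 0)
    (x y : Fin 6 → ℝ) (k : Fin 6) : ∑ i, ∑ j, x i * y j * A i j k = planeForm A x y k := by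
  have hdiag : ∀ i k, A i i k = 0 := fun i k => by linarith [hskew i i k]
  fin_cases k <;>
    simp [Fin.sum_univ_six, hzero, hdiag, planeWeight, planeForm, minor, hskew 5 0, hskew 2 1,
      hskew 4 3, hskew 1 0, hskew 5 1, hskew 2 0, hskew 5 2, hskew 3 0, hskew 4 1, hskew 5 3,
      hskew 4 0, hskew 3 2, hskew 5 4] <;> ring

variable {g : Type*} [LieRing g] [LieAlgebra ℝ g] {b : Basis (Fin 6) ℝ g}
  {a : g →ₗ[ℝ] g →ₗ[ℝ] g}

theorem IsAdjointCocycle.equivFun_eq_planeForm (ha : IsAdjointCocycle a)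
    (hzero : ∀ i j k, (planeWeight i : ℝ) + planeWeight j ≠ planeWeight k →
      b.repr (a (b i) (b j)) k = 0) (x y : g) :
    b.equivFun (a x y) =
      planeForm (fun i j => b.repr (a (b i) (b j))) (b.equivFun x) (b.equivFun y) := by
  funext k
  have hskew : ∀ i j k, b.repr (a (b i) (b j)) k = -b.repr (a (b j) (b i)) k := fun i j k => by
    rw [ha.skew, map_neg, Finsupp.neg_apply]
  have hexpand := sum_eq_planeForm hskew fun i j k h => hzero i j k (by exact_mod_cast h)
  rw [← hexpand (b.equivFun x) (b.equivFun y)]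
  conv_lhs => rw [← b.sum_equivFun x, ← b.sum_equivFun y]
  simp only [map_sum, map_smul, LinearMap.sum_apply, LinearMap.smul_apply, Finset.sum_apply,
    Pi.smul_apply, smul_eq_mul, Finset.mul_sum]
  rw [Finset.sum_comm]
  exact Finset.sum_congr rfl fun i _ => Finset.sum_congr rfl fun j _ => by
    rw [mul_left_comm, mul_assoc]
    rfl

/-- The linear relations that the cocycle condition imposes on the coefficients of
`planeForm A`. -/
structure PlaneRelations (α β : ℝ) (A : Fin 6 → Fin 6 → Fin 6 → ℝ) : Prop where
  h050 : A 0 5 0 = 0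
  h055 : A 0 5 5 = 0
  h022 : A 0 2 2 = -A 0 1 1
  h033 : A 0 3 3 = A 0 1 1 / 2 + β * A 1 2 5
  h044 : A 0 4 4 = A 0 3 3 - A 0 1 1
  h234 : A 2 3 4 = A 1 2 0 + A 0 1 1 / 2 - A 1 4 3
  h252 : A 2 5 2 = -A 1 5 1
  h340 : A 3 4 0 = α * A 1 5 1 / 2
  h454 : A 4 5 4 = A 3 5 3 - A 1 5 1
  h353 : α * (A 3 5 3 - A 1 5 1 / 2) = 0
  h345 : β * A 3 4 5 = 0

theorem IsAdjointCocycle.planeRelations {α β : ℝ} (h01 : α = 1 ∧ β = 0 ∨ α = 0 ∧ β = 1)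
    (hlie : ∀ x y, b.equivFun ⁅x, y⁆ = planeBracket α β (b.equivFun x) (b.equivFun y))
    (ha : IsAdjointCocycle a) {A : Fin 6 → Fin 6 → Fin 6 → ℝ}
    (hA : ∀ x y, b.equivFun (a x y) = planeForm A (b.equivFun x) (b.equivFun y)) :
    PlaneRelations α β A := by
  have hJ := fun i j k l : Fin 6 =>
    congrFun (congrArg b.equivFun (ha.cyclic (b i) (b j) (b k))) l
  simp only [map_add, Pi.add_apply, map_zero, Pi.zero_apply, hA, hlie] at hJ
  have h0120 := hJ 0 1 2 0
  have h0143 := hJ 0 1 4 3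
  have h0151 := hJ 0 1 5 1
  have h1233 := hJ 1 2 3 3
  have h1244 := hJ 1 2 4 4
  have h1250 := hJ 1 2 5 0
  have h1255 := hJ 1 2 5 5
  have h1341 := hJ 1 3 4 1
  have h1453 := hJ 1 4 5 3
  have h3455 := hJ 3 4 5 5
  simp [planeForm, planeBracket, minor]
    at h0120 h0143 h0151 h1233 h1244 h1250 h1255 h1341 h1453 h3455
  rcases h01 with ⟨rfl, rfl⟩ | ⟨rfl, rfl⟩ <;> constructor <;> linarith

/-- The linear map of weight zero whose coboundary is `planeForm A`, for cocycles. -/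
noncomputable def planeMap (A : Fin 6 → Fin 6 → Fin 6 → ℝ) : (Fin 6 → ℝ) →ₗ[ℝ] (Fin 6 → ℝ) where
  toFun x := ![A 0 1 1 / 2 * x 0 - A 1 5 1 / 2 * x 5, A 1 4 3 * x 1, A 2 3 4 * x 2, 0, 0,
    (A 3 5 3 - A 1 5 1 / 2 - A 3 4 5) * x 5 - A 1 2 5 * x 0]
  map_add' x y := by
    funext k
    fin_cases k <;> simp <;> ring
  map_smul' t x := by
    funext k
    fin_cases k <;> simp <;> ring

theorem planeForm_eq_of_planeRelations {α β : ℝ} (h01 : α = 1 ∧ β = 0 ∨ α = 0 ∧ β = 1)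
    {A : Fin 6 → Fin 6 → Fin 6 → ℝ} (h : PlaneRelations α β A) (x y : Fin 6 → ℝ) :
    planeForm A x y = planeBracket α β x (planeMap A y) + planeBracket α β (planeMap A x) y -
      planeMap A (planeBracket α β x y) := by
  obtain ⟨h050, h055, h022, h033, h044, h234, h252, h340, h454, h353, h345⟩ := h
  funext k
  rcases h01 with ⟨rfl, rfl⟩ | ⟨rfl, rfl⟩
  · replace h353 : A 3 5 3 = A 1 5 1 / 2 := by linarith
    fin_cases k <;>
      simp [planeForm, planeMap, planeBracket, minor, h050, h055, h022, h033, h044, h234, h252,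
        h340, h454, h353] <;> ring
  · replace h345 : A 3 4 5 = 0 := by linarith
    fin_cases k <;>
      simp [planeForm, planeMap, planeBracket, minor, h050, h055, h022, h033, h044, h234, h252,
        h340, h454, h345] <;> ring

theorem subsingleton_H2_of_planeBracket {α β : ℝ} (h01 : α = 1 ∧ β = 0 ∨ α = 0 ∧ β = 1)
    (hlie : ∀ x y, b.equivFun ⁅x, y⁆ = planeBracket α β (b.equivFun x) (b.equivFun y)) :
    Subsingleton (H2 g) := by
  have hweight : ∀ i, ⁅b 0, b i⁆ = (planeWeight i : ℝ) • b i := fun i =>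
    b.equivFun.injective (by
      rw [hlie]
      funext k
      fin_cases i <;> fin_cases k <;>
        simp [planeBracket, planeWeight, minor])
  refine subsingleton_H2_of_weight_zero b hweight fun a ha hzero => ?_
  have hA := ha.equivFun_eq_planeForm hzero
  let A : Fin 6 → Fin 6 → Fin 6 → ℝ := fun i j => b.repr (a (b i) (b j))
  refine ⟨b.equivFun.symm.conj (planeMap A), fun x y => b.equivFun.injective ?_⟩
  rw [hA, planeForm_eq_of_planeRelations h01 (ha.planeRelations h01 hlie hA)]
  simp only [map_add, map_sub, hlie, LinearEquiv.conj_apply_apply, LinearEquiv.symm_symm,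
    LinearEquiv.apply_symm_apply]
  rfl

theorem OfLaw.equivFun_lie {n : ℕ} {C : lieVariety n} (x y : OfLaw C) (k : Fin n) :
    (OfLaw.basis C).equivFun ⁅x, y⁆ k =
      ∑ i, ∑ j, (OfLaw.basis C).equivFun x i * (OfLaw.basis C).equivFun y j * C.1 i j k :=
  rfl

theorem subsingleton_H2_L62 : Subsingleton (H2 L62) :=
  subsingleton_H2_of_planeBracket (b := OfLaw.basis _) (Or.inl ⟨rfl, rfl⟩) fun x y => by
    funext k
    rw [OfLaw.equivFun_lie]
    generalize (OfLaw.basis _).equivFun x = u, (OfLaw.basis _).equivFun y = v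
    fin_cases k <;> simp [Fin.sum_univ_six, realLaw, c62, ofTable, planeBracket, minor] <;> ring

theorem subsingleton_H2_L63 : Subsingleton (H2 L63) :=
  subsingleton_H2_of_planeBracket (b := OfLaw.basis _) (Or.inr ⟨rfl, rfl⟩) fun x y => by
    funext k
    rw [OfLaw.equivFun_lie]
    generalize (OfLaw.basis _).equivFun x = u, (OfLaw.basis _).equivFun y = v
    fin_cases k <;> simp [Fin.sum_univ_six, realLaw, c63, ofTable, planeBracket, minor] <;> ring

end PlaneCohomology

/-! ### Matrix realizations -/

theorem nonempty_ofLaw_lieEquiv_of_basis {g : Type*} [LieRing g] [LieAlgebra ℝ g] {n : ℕ}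
    {C : lieVariety n} (b : Basis (Fin n) ℝ g)
    (h : ∀ i j, i < j → ⁅b i, b j⁆ = ∑ k, C.1 i j k • b k) : Nonempty (OfLaw C ≃ₗ⁅ℝ⁆ g) :=
  nonempty_ofLaw_lieEquiv_iff.2 ⟨b, lawOfBasis_eq_of_lt b C h⟩

section Matrices

open Matrix LieAlgebra LieAlgebra.Orthogonal LieAlgebra.SpecialLinear

attribute [local instance] LieRing.ofAssociativeRing LieAlgebra.ofAssociativeAlgebra

variable {m : Type*} [Fintype m] {n : ℕ}

theorem linearIndependent_of_trace_transpose_mul {ι : Type*} {v : ι → Matrix m m ℝ}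
    (horth : ∀ a b, ((v a)ᵀ * v b).trace = 0 ↔ a ≠ b) : LinearIndependent ℝ v := by
  let B : Matrix m m ℝ →ₗ[ℝ] Matrix m m ℝ →ₗ[ℝ] ℝ :=
    LinearMap.mk₂ ℝ (fun A A' => (Aᵀ * A').trace) (by simp [add_mul]) (by simp)
      (by simp [mul_add]) (by simp)
  exact LinearMap.linearIndependent_of_isOrthoᵢ (B := B)
    (fun a b hab => (horth a b).2 hab) fun a h => (horth a a).1 h rfl

theorem exists_basis_of_orthogonal {K : Submodule ℝ (Matrix m m ℝ)}
    (hK : finrank ℝ K ≤ n) {M : Fin n → Matrix m m ℤ} (hM : ∀ a, (M a).map (↑) ∈ K)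
    (horth : ∀ a b, ((M a)ᵀ * M b).trace = 0 ↔ a ≠ b) :
    ∃ b : Basis (Fin n) ℝ K, ∀ a, (b a : Matrix m m ℝ) = (M a).map (↑) := by
  have hli : LinearIndependent ℝ fun a => (M a).map ((↑) : ℤ → ℝ) :=
    linearIndependent_of_trace_transpose_mul fun a b => by
      rw [← horth, ← Int.cast_eq_zero (α := ℝ)]
      simp [Matrix.trace, Matrix.mul_apply]
  have hliK : LinearIndependent ℝ fun a => (⟨(M a).map (↑), hM a⟩ : K) :=
    .of_comp K.subtype hli
  have hcard : Fintype.card (Fin n) = finrank ℝ K :=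
    le_antisymm hliK.fintype_card_le_finrank (by simpa using hK)
  rcases isEmpty_or_nonempty (Fin n) with hn | hn
  · exact ⟨(basisOfLinearIndependentOfCardEqFinrank' _ hliK hcard), fun a => hn.elim a⟩
  · exact ⟨basisOfLinearIndependentOfCardEqFinrank hliK hcard, fun a => by simp⟩

theorem lie_map_intCast_eq_sum [DecidableEq m] {M : Fin n → Matrix m m ℤ} {A B : Matrix m m ℤ}
    {c : Fin n → ℤ} (h : A * B - B * A = ∑ k, c k • M k) :
    ⁅A.map ((↑) : ℤ → ℝ), B.map (↑)⁆ = ∑ k, (c k : ℝ) • (M k).map ((↑) : ℤ → ℝ) := by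
  have hcast := congrArg (Int.castRingHom ℝ).mapMatrix h
  rw [map_sub, map_mul, map_mul, map_sum] at hcast
  refine (Ring.lie_def _ _).trans (hcast.trans (Finset.sum_congr rfl fun k _ => ?_))
  ext i j
  simp only [RingHom.mapMatrix_apply, map_apply, Matrix.smul_apply]
  simp

theorem lie_eq_sum_of_coe_eq_map [DecidableEq m] {K : LieSubalgebra ℝ (Matrix m m ℝ)}
    {M : Fin n → Matrix m m ℤ} {A B : Matrix m m ℤ} {x y : K} {v : Fin n → K}
    (hx : x.1 = A.map (↑)) (hy : y.1 = B.map (↑)) (hv : ∀ k, (v k).1 = (M k).map (↑))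
    {c : Fin n → ℤ} (h : A * B - B * A = ∑ k, c k • M k) : ⁅x, y⁆ = ∑ k, (c k : ℝ) • v k :=
  Subtype.ext (by simpa [hx, hy, hv] using lie_map_intCast_eq_sum h)

variable {c : Fin n → Fin n → Fin n → ℤ}

theorem nonempty_realLaw_lieEquiv_of_matrices [DecidableEq m]
    {K : LieSubalgebra ℝ (Matrix m m ℝ)} (hK : finrank ℝ K ≤ n) {h₁ h₂}
    {M : Fin n → Matrix m m ℤ} (hM : ∀ a, (M a).map (↑) ∈ K)
    (horth : ∀ a b, ((M a)ᵀ * M b).trace = 0 ↔ a ≠ b)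
    (hlie : ∀ a b, a < b → M a * M b - M b * M a = ∑ k, c a b k • M k) :
    Nonempty (OfLaw (realLaw c h₁ h₂) ≃ₗ⁅ℝ⁆ K) := by
  obtain ⟨b, hb⟩ := exists_basis_of_orthogonal (K := K.toSubmodule) hK hM horth
  exact nonempty_ofLaw_lieEquiv_of_basis (g := K) b fun i j hij =>
    lie_eq_sum_of_coe_eq_map (hb i) (hb j) hb (hlie i j hij)

theorem mem_skewAdjoint_diagonal [DecidableEq m] {d : m → ℝ} {A : Matrix m m ℝ} :
    A ∈ skewAdjointMatricesLieSubalgebra (diagonal d) ↔ ∀ i j, A j i * d j = -(d i * A i j) := by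
  rw [mem_skewAdjointMatricesLieSubalgebra, mem_skewAdjointMatricesSubmodule,
    Matrix.IsSkewAdjoint, Matrix.IsAdjointPair, ← Matrix.ext_iff]
  simp [mul_diagonal, diagonal_mul]

/- A matrix that is skew-adjoint for a nondegenerate diagonal form is determined by one of its
entries `A i j`, `A j i` for each unordered pair `{i, j}`. -/
theorem finrank_skewAdjoint_diagonal_le [DecidableEq m] {d : m → ℝ} (hd : ∀ i, d i ≠ 0) :
    finrank ℝ (skewAdjointMatricesLieSubalgebra (diagonal d)) ≤ (Fintype.card m).choose 2 := by
  let φ : skewAdjointMatricesLieSubalgebra (diagonal d) →ₗ[ℝ]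
      ({z : Sym2 m // ¬z.IsDiag} → ℝ) :=
    LinearMap.pi fun z => entryLinearMap ℝ ℝ z.1.out.1 z.1.out.2 ∘ₗ Submodule.subtype _
  have hφ : Function.Injective φ := by
    refine (injective_iff_map_eq_zero φ).2 fun A hA => Subtype.ext ?_
    have hskew := mem_skewAdjoint_diagonal.1 A.2
    have hswap : ∀ i j, A.1 i j = 0 → A.1 j i = 0 := fun i j h => by
      simpa [h, hd] using hskew i j
    ext i j
    by_cases hij : i = j
    · subst hij
      have h2 : d i * A.1 i i = 0 := by linarith [hskew i i]
      simpa [hd] using h2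
    · have hz : A.1 s(i, j).out.1 s(i, j).out.2 = 0 :=
        congrFun hA ⟨s(i, j), by simpa using hij⟩
      have hout : s(s(i, j).out.1, s(i, j).out.2) = s(i, j) := Quot.out_eq _
      rcases Sym2.eq_iff.1 hout with ⟨hi, hj⟩ | ⟨hi, hj⟩
      · rwa [hi, hj] at hz
      · rw [hi, hj] at hz
        exact hswap _ _ hz
  calc
    _ ≤ finrank ℝ ({z : Sym2 m // ¬z.IsDiag} → ℝ) :=
      LinearMap.finrank_le_finrank_of_injective hφ
    _ = _ := by rw [finrank_fintype_fun_eq_card, Sym2.card_subtype_not_diag]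

theorem finrank_sl_add_one [DecidableEq m] [Nonempty m] :
    finrank ℝ (sl m ℝ) + 1 = Fintype.card m * Fintype.card m := by
  have h := LinearMap.finrank_range_add_finrank_ker (traceLinearMap m ℝ ℝ)
  rw [LinearMap.range_eq_top.2 (trace_surjective), finrank_top, finrank_self,
    finrank_matrix, finrank_self, mul_one] at h
  rw [← h, add_comm]
  rfl

theorem finrank_so_le [DecidableEq m] : finrank ℝ (so m ℝ) ≤ (Fintype.card m).choose 2 := by
  rw [so, ← diagonal_one]
  exact finrank_skewAdjoint_diagonal_le fun _ => one_ne_zero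

theorem map_intCast_mem_so [DecidableEq m] {A : Matrix m m ℤ} (hA : Aᵀ = -A) :
    A.map (↑) ∈ so m ℝ := by
  rw [mem_so, ← transpose_map, hA]
  ext i j
  simp

theorem exists_basis_so [DecidableEq m] (hn : (Fintype.card m).choose 2 = n)
    {M : Fin n → Matrix m m ℤ} (hskew : ∀ a, (M a)ᵀ = -M a)
    (horth : ∀ a b, ((M a)ᵀ * M b).trace = 0 ↔ a ≠ b) :
    ∃ b : Basis (Fin n) ℝ (so m ℝ), ∀ a, (b a).1 = (M a).map (↑) :=
  exists_basis_of_orthogonal (K := (so m ℝ).toSubmodule) (finrank_so_le.trans_eq hn)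
    (fun a => map_intCast_mem_so (hskew a)) horth

theorem exists_basis_sl [DecidableEq m] [Nonempty m]
    (hn : Fintype.card m * Fintype.card m = n + 1) {M : Fin n → Matrix m m ℤ}
    (htr : ∀ a, (M a).trace = 0) (horth : ∀ a b, ((M a)ᵀ * M b).trace = 0 ↔ a ≠ b) :
    ∃ b : Basis (Fin n) ℝ (sl m ℝ), ∀ a, (b a).1 = (M a).map (↑) := by
  refine exists_basis_of_orthogonal (K := (sl m ℝ).toSubmodule) ?_ (fun a => ?_) horth
  · have h := finrank_sl_add_one (m := m)
    exact Nat.le_of_succ_le_succ (h.trans hn).le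
  · have h := congrArg (Int.cast : ℤ → ℝ) (htr a)
    simpa [sl, Matrix.trace] using h

theorem nonempty_realLaw_lieEquiv_so' {p q : ℕ} (hn : (p + q).choose 2 = n) {h₁ h₂}
    {M : Fin n → Matrix (Fin p ⊕ Fin q) (Fin p ⊕ Fin q) ℤ}
    (hskew : ∀ a i j, M a j i * (Sum.elim (fun _ => 1) (fun _ => -1) j) =
      -((Sum.elim (fun _ => 1) (fun _ => -1) i) * M a i j))
    (horth : ∀ a b, ((M a)ᵀ * M b).trace = 0 ↔ a ≠ b)
    (hlie : ∀ a b, a < b → M a * M b - M b * M a = ∑ k, c a b k • M k) :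
    Nonempty (OfLaw (realLaw c h₁ h₂) ≃ₗ⁅ℝ⁆ so' (Fin p) (Fin q) ℝ) := by
  refine nonempty_realLaw_lieEquiv_of_matrices ?_ (fun a => ?_) horth hlie
  · refine (finrank_skewAdjoint_diagonal_le ?_).trans_eq (by simp [hn])
    rintro (_ | _) <;> simp
  · refine mem_skewAdjoint_diagonal.2 fun i j => ?_
    have h := congrArg (Int.cast : ℤ → ℝ) (hskew a i j)
    rcases i with i | i <;> rcases j with j | j <;> simpa using h

end Matrices

section Inhom

theorem nonempty_realLaw_lieEquiv_inhom {L V : Type*} [LieRing L] [LieAlgebra ℝ L]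
    [AddCommGroup V] [Module ℝ V] [LieRingModule L V] [LieModule ℝ L V] {p q : ℕ}
    {c : Fin (p + q) → Fin (p + q) → Fin (p + q) → ℤ} {h₁ h₂}
    (b : Basis (Fin p) ℝ L) (v : Basis (Fin q) ℝ V)
    (hb : ∀ i j, i < j →
      ⁅b i, b j⁆ = ∑ k, (c (.castAdd q i) (.castAdd q j) (.castAdd q k) : ℝ) • b k)
    (hv : ∀ i j, ⁅b i, v j⁆ = ∑ k, (c (.castAdd q i) (.natAdd p j) (.natAdd p k) : ℝ) • v k)
    (hbb : ∀ i j k, c (.castAdd q i) (.castAdd q j) (.natAdd p k) = 0)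
    (hbv : ∀ i j k, c (.castAdd q i) (.natAdd p j) (.castAdd q k) = 0)
    (hvv : ∀ i j k, c (.natAdd p i) (.natAdd p j) k = 0) :
    Nonempty (OfLaw (realLaw c h₁ h₂) ≃ₗ⁅ℝ⁆ Inhom L V) := by
  let u : Basis (Fin (p + q)) ℝ (L × V) := (b.prod v).reindex finSumFinEquiv
  have hu₁ : ∀ i, u (.castAdd q i) = (b i, 0) := fun i => by simp [u]
  have hu₂ : ∀ i, u (.natAdd p i) = (0, v i) := fun i => by simp [u]
  have hsum : ∀ d : Fin (p + q) → ℝ, ∑ k, d k • u k =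
      (∑ k, d (.castAdd q k) • b k, ∑ k, d (.natAdd p k) • v k) := fun d => by
    simp [Fin.sum_univ_add, hu₁, hu₂, Prod.ext_iff, Prod.fst_sum, Prod.snd_sum]
  have hlie : ∀ x y : L × V, Bracket.bracket (L := Inhom L V) (M := Inhom L V) x y =
      (⁅x.1, y.1⁆, ⁅x.1, y.2⁆ - ⁅y.1, x.2⁆) := fun _ _ => rfl
  refine nonempty_ofLaw_lieEquiv_of_basis (g := Inhom L V) u fun i j hij => ?_
  refine (hlie (u i) (u j)).trans (Eq.trans (Prod.ext ?_ ?_) (hsum _).symm)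
  all_goals
    induction i using Fin.addCases with
    | left i =>
      induction j using Fin.addCases with
      | left j => simp [hu₁, realLaw, hbb, hb i j hij]
      | right j => simp [hu₁, hu₂, realLaw, hbv, hv]
    | right i =>
      induction j using Fin.addCases with
      | left j => exact absurd hij (by simp [Fin.lt_def]; omega)
      | right j => simp [hu₂, realLaw, hvv]

end Inhom

/-- Structure constants deforming those of `L_{6,1}` by `σ` times the brackets of the last three
basis elements: those of `𝔰𝔬(4)` for `σ = 1`, and those of `𝔰𝔬(3,1)` for `σ = -1`. -/
def rotationTable (σ : ℤ) : Fin 6 → Fin 6 → Fin 6 → ℤ :=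
  ofTable 6 [(2, 3, 1, 1), (1, 2, 3, 1), (1, 3, 2, -1), (1, 5, 6, 1), (1, 6, 5, -1),
    (2, 4, 6, -1), (2, 6, 4, 1), (3, 4, 5, 1), (3, 5, 4, -1), (5, 6, 1, σ), (4, 5, 3, σ),
    (4, 6, 2, -σ)]

/-- Structure constants deforming those of `L_{6,4}` by `σ` times the brackets of the last three
basis elements: those of `𝔰𝔬(2,2)` for `σ = 1`, and those of `𝔰𝔬(3,1)` for `σ = -1`. -/
def slTable (σ : ℤ) : Fin 6 → Fin 6 → Fin 6 → ℤ :=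
  ofTable 6 [(1, 2, 2, 2), (1, 3, 3, -2), (2, 3, 1, 1), (1, 4, 4, 2), (1, 6, 6, -2),
    (2, 5, 4, 2), (2, 6, 5, 1), (3, 4, 5, 1), (3, 5, 6, 2), (4, 5, 2, 2 * σ), (4, 6, 1, -σ),
    (5, 6, 3, -(2 * σ))]

/-- The law of `𝔰𝔬(4)` in a basis adapted to the contraction onto `L_{6,1}`. -/
abbrev so4Law : lieVariety 6 := realLaw (rotationTable 1) (by decide +kernel) (by decide +kernel)

/-- The law of `𝔰𝔬(3,1)` in a basis adapted to the contraction onto `L_{6,1}`. -/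
abbrev so31Law : lieVariety 6 :=
  realLaw (rotationTable (-1)) (by decide +kernel) (by decide +kernel)

/-- The law of `𝔰𝔬(2,2)` in a basis adapted to the contraction onto `L_{6,4}`. -/
abbrev so22Law : lieVariety 6 := realLaw (slTable 1) (by decide +kernel) (by decide +kernel)

/-- The law of `𝔰𝔬(3,1)` in a basis adapted to the contraction onto `L_{6,4}`. -/
abbrev so31SlLaw : lieVariety 6 := realLaw (slTable (-1)) (by decide +kernel) (by decide +kernel)

section Realizations

open Matrix

attribute [local instance] LieRing.ofAssociativeRing LieAlgebra.ofAssociativeAlgebra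

/-- The element of `𝔰𝔬(4)` (`σ = 1`) or `𝔰𝔬(3,1)` (`σ = -1`) with coordinates `a` in a basis with
structure constants `rotationTable σ`. -/
def rotationMatrix (σ : ℤ) (a : Fin 6 → ℤ) : Matrix (Fin 4) (Fin 4) ℤ :=
  !![0, -a 2, a 1, a 3; a 2, 0, -a 0, a 4; -a 1, a 0, 0, a 5; -(σ * a 3), -(σ * a 4), -(σ * a 5), 0]

/-- The element of `𝔰𝔬(2,2)` with coordinates `a` in a basis with structure constants
`slTable 1`. -/
def so22Matrix (a : Fin 6 → ℤ) : Matrix (Fin 4) (Fin 4) ℤ :=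
  !![0, -a 3 - a 5, -(2 * a 4), a 3 - a 5;
    a 3 + a 5, 0, -a 1 - a 2, 2 * a 0;
    -(2 * a 4), -a 1 - a 2, 0, a 1 - a 2;
    a 3 - a 5, 2 * a 0, -a 1 + a 2, 0]

/-- The element of `𝔰𝔬(3,1)` with coordinates `a` in a basis with structure constants
`slTable (-1)`. -/
def so31SlMatrix (a : Fin 6 → ℤ) : Matrix (Fin 4) (Fin 4) ℤ :=
  !![0, 2 * a 4, -a 3 + a 5, a 3 + a 5;
    -(2 * a 4), 0, a 1 - a 2, -a 1 - a 2;
    a 3 - a 5, -a 1 + a 2, 0, 2 * a 0;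
    a 3 + a 5, -a 1 - a 2, 2 * a 0, 0]

theorem nonempty_so4Law_lieEquiv : Nonempty (OfLaw so4Law ≃ₗ⁅ℝ⁆ So4) :=
  nonempty_realLaw_lieEquiv_of_matrices (M := fun a => rotationMatrix 1 (Pi.single a 1))
    (finrank_so_le.trans_eq rfl) (fun a => map_intCast_mem_so (by decide +kernel +revert))
    (by decide +kernel) (by decide +kernel)

theorem nonempty_so31Law_lieEquiv : Nonempty (OfLaw so31Law ≃ₗ⁅ℝ⁆ So31) :=
  nonempty_realLaw_lieEquiv_so' (n := 6) rfl
    (M := fun a => (rotationMatrix (-1) (Pi.single a 1)).submatrix finSumFinEquiv finSumFinEquiv)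
    (by decide +kernel) (by decide +kernel) (by decide +kernel)

theorem nonempty_so31SlLaw_lieEquiv : Nonempty (OfLaw so31SlLaw ≃ₗ⁅ℝ⁆ So31) :=
  nonempty_realLaw_lieEquiv_so' (n := 6) rfl
    (M := fun a => (so31SlMatrix (Pi.single a 1)).submatrix finSumFinEquiv finSumFinEquiv)
    (by decide +kernel) (by decide +kernel) (by decide +kernel)

theorem nonempty_so22Law_lieEquiv : Nonempty (OfLaw so22Law ≃ₗ⁅ℝ⁆ So22) :=
  nonempty_realLaw_lieEquiv_so' (n := 6) rfl
    (M := fun a => (so22Matrix (Pi.single a 1)).submatrix finSumFinEquiv finSumFinEquiv)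
    (by decide +kernel) (by decide +kernel) (by decide +kernel)

theorem nonempty_L61_equiv_Iso3 : Nonempty (L61 ≃ₗ⁅ℝ⁆ Iso3) := by
  let M : Fin 3 → Matrix (Fin 3) (Fin 3) ℤ :=
    ![!![0, 0, 0; 0, 0, -1; 0, 1, 0], !![0, 0, 1; 0, 0, 0; -1, 0, 0],
      !![0, -1, 0; 1, 0, 0; 0, 0, 0]]
  obtain ⟨b, hb⟩ := exists_basis_so (m := Fin 3) (n := 3) (M := M)
    rfl (by decide +kernel) (by decide +kernel)
  refine nonempty_realLaw_lieEquiv_inhom (p := 3) (q := 3) b (Pi.basisFun ℝ (Fin 3))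
    (fun i j _ => lie_eq_sum_of_coe_eq_map (hb i) (hb j) hb ?_) (fun i j => ?_)
    (by decide +kernel) (by decide +kernel) (by decide +kernel)
  · revert i j
    decide +kernel
  · have hM : ∀ k, M i k j = c61 (.castAdd 3 i) (.natAdd 3 j) (.natAdd 3 k) := by
      revert i j
      decide +kernel
    ext k
    simp [hb, hM, Finset.sum_apply, Pi.single_apply]

theorem nonempty_L64_equiv_Isl2 : Nonempty (L64 ≃ₗ⁅ℝ⁆ Isl2) := by
  obtain ⟨b, hb⟩ := exists_basis_sl (m := Fin 2) (n := 3)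
    (M := ![!![1, 0; 0, -1], !![0, 1; 0, 0], !![0, 0; 1, 0]])
    rfl (by decide +kernel) (by decide +kernel)
  obtain ⟨v, hv⟩ := exists_basis_sl (m := Fin 2) (n := 3)
    (M := ![!![0, 1; 0, 0], !![-1, 0; 0, 1], !![0, 0; -1, 0]])
    rfl (by decide +kernel) (by decide +kernel)
  refine nonempty_realLaw_lieEquiv_inhom (p := 3) (q := 3) b v
    (fun i j _ => lie_eq_sum_of_coe_eq_map (hb i) (hb j) hb ?_)
    (fun i j => lie_eq_sum_of_coe_eq_map (hb i) (hv j) hv ?_)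
    (by decide +kernel) (by decide +kernel) (by decide +kernel)
  all_goals
    revert i j
    decide +kernel

end Realizations

theorem isContraction_realLaw {n : ℕ} {c d : Fin n → Fin n → Fin n → ℤ} {h₁ h₂ h₃ h₄}
    (w : Fin n → ℤ) (hc : ∀ i j k, w i + w j < w k → c i j k = 0)
    (hd : ∀ i j k, d i j k = if w k = w i + w j then c i j k else 0) :
    IsContraction (OfLaw (realLaw c h₁ h₂)) (OfLaw (realLaw d h₃ h₄)) :=
  isContraction_of_filtration w (fun i j k h => by simp [realLaw, hc i j k h])
    fun i j k => by simp [realLaw, hd i j k]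

theorem isContraction_So4_L61 : IsContraction So4 L61 :=
  (isContraction_realLaw ![0, 0, 0, 1, 1, 1] (by decide +kernel) (by decide +kernel)).congr_left
    nonempty_so4Law_lieEquiv.some

theorem isContraction_So31_L61 : IsContraction So31 L61 :=
  (isContraction_realLaw ![0, 0, 0, 1, 1, 1] (by decide +kernel) (by decide +kernel)).congr_left
    nonempty_so31Law_lieEquiv.some

theorem isContraction_So22_L64 : IsContraction So22 L64 :=
  (isContraction_realLaw ![0, 0, 0, 1, 1, 1] (by decide +kernel) (by decide +kernel)).congr_left
    nonempty_so22Law_lieEquiv.some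

theorem isContraction_So31_L64 : IsContraction So31 L64 :=
  (isContraction_realLaw ![0, 0, 0, 1, 1, 1] (by decide +kernel) (by decide +kernel)).congr_left
    nonempty_so31SlLaw_lieEquiv.some

universe u

theorem killingForm_basis_eq_sum {R L ι : Type*} [CommRing R] [LieRing L] [LieAlgebra R L]
    [Fintype ι] (b : Basis ι R L) (i j : ι) : killingForm R L (b i) (b j) =
      ∑ k, ∑ m, b.repr ⁅b j, b k⁆ m * b.repr ⁅b i, b m⁆ k := by
  classical
  rw [LieModule.traceForm_apply_apply, LinearMap.trace_eq_matrix_trace R b, Matrix.trace]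
  refine Finset.sum_congr rfl fun k _ => ?_
  calc LinearMap.toMatrix b b _ k k = b.repr ⁅b i, ⁅b j, b k⁆⁆ k := by
        simp [LinearMap.toMatrix_apply]
    _ = b.repr ⁅b i, ∑ m, b.repr ⁅b j, b k⁆ m • b m⁆ k := by rw [b.sum_repr]
    _ = _ := by
        simp only [lie_sum, lie_smul, map_sum, map_smul, Finsupp.finsetSum_apply,
          Finsupp.smul_apply, smul_eq_mul]

theorem isKilling_of_isOrthoᵢ {K L ι : Type*} [Field K] [LieRing L] [LieAlgebra K L]
    (b : Basis ι K L) (hb : (killingForm K L).IsOrthoᵢ b)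
    (hne : ∀ i, killingForm K L (b i) (b i) ≠ 0) : LieAlgebra.IsKilling K L := by
  have h := LinearMap.IsOrthoᵢ.separatingLeft_of_not_isOrtho_basis_self b hb hne
  refine ⟨(LieSubmodule.eq_bot_iff _).2 fun x hx => h x fun y => ?_⟩
  rw [LieModule.traceForm_comm]
  exact (LieIdeal.mem_killingCompl K L ⊤).1 hx y trivial

theorem isKilling_so31Law : LieAlgebra.IsKilling ℝ (OfLaw so31Law) := by
  have hκ : ∀ i j, killingForm ℝ _ (OfLaw.basis so31Law i) (OfLaw.basis so31Law j) =
      ((∑ k, ∑ m, rotationTable (-1) j k m * rotationTable (-1) i m k : ℤ) : ℝ) := fun i j => by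
    rw [killingForm_basis_eq_sum]
    simp only [← lawOfBasis_apply, OfLaw.lawOfBasis_basis]
    push_cast
    rfl
  refine isKilling_of_isOrthoᵢ (OfLaw.basis so31Law) (fun i j hij => ?_) fun i => ?_
  · refine (hκ i j).trans (Int.cast_eq_zero.2 ?_)
    revert i j
    decide +kernel
  · rw [hκ, Int.cast_ne_zero]
    revert i
    decide +kernel

theorem isContractionOfSemisimple_of_lieEquiv {g s' : Type u} [LieRing g] [LieAlgebra ℝ g]
    {s : Type*} [LieRing s] [LieAlgebra ℝ s] [FiniteDimensional ℝ s] [LieAlgebra.IsKilling ℝ s]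
    [LieRing s'] [LieAlgebra ℝ s'] (e : s ≃ₗ⁅ℝ⁆ s') (h : IsContraction s g) :
    IsContractionOfSemisimple g := by
  have := e.toLinearEquiv.finiteDimensional
  have := LieAlgebra.isKilling_of_equiv e
  exact ⟨s', inferInstance, inferInstance, inferInstance, inferInstance, h.congr_left e⟩

/- The universe of a semisimple algebra contracting to `g` has to be that of `g`, hence `ULift`. -/
theorem isContractionOfSemisimple_of_So31 {g : Type u} [LieRing g] [LieAlgebra ℝ g]
    (h : IsContraction So31 g) : IsContractionOfSemisimple g := by
  let _ : LieRing (ULift.{u} (OfLaw so31Law)) := Equiv.ulift.lieRing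
  let _ : LieAlgebra ℝ (ULift.{u} (OfLaw so31Law)) := Equiv.lieAlgebra ℝ Equiv.ulift
  have := isKilling_so31Law
  exact isContractionOfSemisimple_of_lieEquiv (Equiv.lieEquiv ℝ Equiv.ulift).symm
    (h.congr_left nonempty_so31Law_lieEquiv.some.symm)

/-! ### Three-dimensional representations of `𝔰𝔩₂` -/

section AssociativeAlgebra

attribute [local instance] LieRing.ofAssociativeRing

variable {K A : Type*} [Field K] [Ring A] [Algebra K A]

theorem lie_pow_of_lie_eq_smul {h e : A} {c : K} (he : ⁅h, e⁆ = c • e) (n : ℕ) :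
    ⁅h, e ^ n⁆ = (n * c) • e ^ n := by
  simp only [Ring.lie_def, sub_eq_iff_eq_add] at he ⊢
  induction n with
  | zero => simp
  | succ n ih =>
    rw [pow_succ, ← mul_assoc, ih, add_mul, mul_assoc, he]
    simp only [mul_add, smul_mul_assoc, mul_smul_comm, mul_assoc]
    push_cast
    module

theorem isNilpotent_of_lie_eq_smul [CharZero K] [FiniteDimensional K A] {h e : A} {c : K}
    (hc : c ≠ 0) (he : ⁅h, e⁆ = c • e) : IsNilpotent e := by
  by_contra hnil
  refine Set.infinite_of_injective_forall_mem (f := fun n : ℕ => n * c) (fun m n hmn => ?_)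
    (fun n => ?_) (LieAlgebra.ad K A h).finite_hasEigenvalue
  · exact Nat.cast_injective (mul_right_cancel₀ hc hmn)
  · exact Module.End.hasEigenvalue_of_hasEigenvector (x := e ^ n)
      ⟨Module.End.mem_eigenspace_iff.2 (lie_pow_of_lie_eq_smul he n), fun h0 => hnil ⟨n, h0⟩⟩

theorem lie_pow_succ_of_lie_eq {h e f : A} (hef : ⁅e, f⁆ = h) (he : ⁅h, e⁆ = (2 : K) • e) (n : ℕ) :
    ⁅e ^ (n + 1), f⁆ = (n + 1 : K) • (h * e ^ n - (n : K) • e ^ n) := by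
  have heh : e * h = h * e - (2 : K) • e := by rw [← he, Ring.lie_def, sub_sub_cancel]
  induction n with
  | zero => simpa using hef
  | succ n ih =>
    calc ⁅e ^ (n + 2), f⁆ = e * ⁅e ^ (n + 1), f⁆ + ⁅e, f⁆ * e ^ (n + 1) := by
          simp only [Ring.lie_def, pow_succ' e (n + 1)]
          noncomm_ring
      _ = (n + 1 : K) • ((e * h) * e ^ n - (n : K) • e ^ (n + 1)) + h * e ^ (n + 1) := by
          rw [ih, hef, mul_smul_comm, mul_sub, mul_smul_comm, ← pow_succ', mul_assoc]
      _ = _ := by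
          rw [heh, sub_mul, smul_mul_assoc, mul_assoc, ← pow_succ']
          push_cast
          module

end AssociativeAlgebra

section Sl2Modules

variable {K L M : Type*} [Field K] [LieRing L] [LieAlgebra K L] [AddCommGroup M] [Module K M]
  [LieRingModule L M] [LieModule K L M] {h e f : L}

open LieModule

theorem linearIndependent_of_lie_eq_smul {n : ℕ} {x : L} {μ : Fin n → K} {v : Fin n → M}
    (hμ : Function.Injective μ) (hx : ∀ i, ⁅x, v i⁆ = μ i • v i) (hv : ∀ i, v i ≠ 0) :
    LinearIndependent K v :=
  (toEnd K L M x).eigenvectors_linearIndependent' μ hμ v fun i =>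
    ⟨Module.End.mem_eigenspace_iff.2 (hx i), hv i⟩

variable [CharZero K]

theorem lie_e_lie_h_of_sq_eq_zero (t : IsSl2Triple h e f) (he : toEnd K L M e ^ 2 = 0) (m : M) :
    ⁅e, ⁅h, m⁆⁆ = -⁅e, m⁆ := by
  have hee (m : M) : ⁅e, ⁅e, m⁆⁆ = 0 := by simpa [pow_two] using LinearMap.congr_fun he m
  have hef := hee ⁅f, m⁆
  rw [leibniz_lie e f m, t.lie_e_f, lie_add, leibniz_lie e f, t.lie_e_f, hee, lie_zero, add_zero,
    leibniz_lie h, t.lie_h_e_smul K, smul_lie] at hef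
  refine smul_right_injective M (two_ne_zero (α := K)) ?_
  linear_combination (norm := module) (1 : K) • hef

theorem lie_h_lie_e_of_sq_eq_zero (t : IsSl2Triple h e f) (he : toEnd K L M e ^ 2 = 0) (m : M) :
    ⁅h, ⁅e, m⁆⁆ = ⁅e, m⁆ := by
  rw [leibniz_lie, t.lie_h_e_smul K, smul_lie, lie_e_lie_h_of_sq_eq_zero t he]
  module

theorem lie_h_lie_h_of_sq_eq_zero (t : IsSl2Triple h e f) (he : toEnd K L M e ^ 2 = 0) (m : M) :
    ⁅h, ⁅h, m⁆⁆ = (2 : K) • ⁅e, ⁅f, m⁆⁆ - ⁅h, m⁆ := by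
  have hef := lie_e_lie_h_of_sq_eq_zero t he ⁅f, m⁆
  rw [leibniz_lie h f, t.lie_lie_smul_f K, lie_add, neg_lie, smul_lie, lie_neg, lie_smul,
    leibniz_lie e f ⁅h, m⁆, t.lie_e_f, lie_e_lie_h_of_sq_eq_zero t he, lie_neg] at hef
  have hhm : ⁅h, m⁆ = ⁅e, ⁅f, m⁆⁆ - ⁅f, ⁅e, m⁆⁆ := by rw [← t.lie_e_f, lie_lie]
  linear_combination (norm := module) (1 : K) • hef + (1 : K) • hhm

variable [FiniteDimensional K M]

attribute [local instance] LieRing.ofAssociativeRing in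
theorem exists_hasPrimitiveVectorWith_succ (t : IsSl2Triple h e f) (he : toEnd K L M e ≠ 0) :
    ∃ (n : ℕ) (v : M), toEnd K L M e ^ (n + 2) = 0 ∧
      t.HasPrimitiveVectorWith v ((n + 1 : ℕ) : K) := by
  set H := toEnd K L M h
  set E := toEnd K L M e
  have hHE : ⁅H, E⁆ = (2 : K) • E := by rw [← LieHom.map_lie, t.lie_h_e_smul K, map_smul]
  have hEF : ⁅E, toEnd K L M f⁆ = H := by rw [← LieHom.map_lie, t.lie_e_f]
  have hnil : IsNilpotent E := isNilpotent_of_lie_eq_smul two_ne_zero hHE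
  obtain ⟨n, hn0, hn⟩ := Nat.exists_not_and_succ_of_not_zero_of_exists
    (p := fun k => E ^ (k + 1) = 0) (by simpa using he) (hnil.imp fun k hk => by
      rw [pow_succ, hk, zero_mul])
  obtain ⟨x, hx⟩ := DFunLike.exists_ne hn0
  refine ⟨n, (E ^ (n + 1)) x, hn, hx, ?_, ?_⟩
  · have hzero := lie_pow_succ_of_lie_eq hEF hHE (n + 1)
    rw [hn, zero_lie, eq_comm, smul_eq_zero_iff_right (by exact_mod_cast (n + 1).succ_ne_zero),
      sub_eq_zero] at hzero
    exact LinearMap.congr_fun hzero x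
  · exact (LinearMap.congr_fun (pow_succ' E (n + 1)) x).symm.trans (LinearMap.congr_fun hn x)

theorem lt_finrank_of_hasPrimitiveVectorWith {t : IsSl2Triple h e f} {v : M} {n : ℕ}
    (P : t.HasPrimitiveVectorWith v (n : K)) : n < finrank K M := by
  have hinj : Function.Injective fun i : Fin (n + 1) => (n : K) - 2 * (i : ℕ) := fun i j hij => by
    simpa [Fin.ext_iff] using hij
  have hli := (toEnd K L M h).eigenvectors_linearIndependent' _ hinj
    (fun i => (toEnd K L M f ^ (i : ℕ)) v) fun i =>
      ⟨Module.End.mem_eigenspace_iff.2 (P.lie_h_pow_toEnd_f i),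
        P.pow_toEnd_f_ne_zero_of_eq_nat rfl (Nat.lt_succ_iff.1 i.2)⟩
  simpa using hli.fintype_card_le_finrank

/-- The vectors `v₀`, `v₁`, `v₂` span a copy of the adjoint module of the `𝔰𝔩₂`-triple `h`, `e`,
`f`, as the vectors `-e`, `h`, `f` do in the adjoint module itself. -/
structure IsSl2AdjointTriple (K : Type*) {L M : Type*} [Semiring K] [LieRing L] [AddCommGroup M]
    [Module K M] [LieRingModule L M] (h e f : L) (v₀ v₁ v₂ : M) : Prop where
  lie_h_zero : ⁅h, v₀⁆ = (2 : K) • v₀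
  lie_h_one : ⁅h, v₁⁆ = 0
  lie_h_two : ⁅h, v₂⁆ = -((2 : K) • v₂)
  lie_e_zero : ⁅e, v₀⁆ = 0
  lie_e_one : ⁅e, v₁⁆ = (2 : K) • v₀
  lie_e_two : ⁅e, v₂⁆ = v₁
  lie_f_zero : ⁅f, v₀⁆ = v₁
  lie_f_one : ⁅f, v₁⁆ = (2 : K) • v₂
  lie_f_two : ⁅f, v₂⁆ = 0

/-- The vectors `v`, `w` span a copy of the standard module `K²` of the `𝔰𝔩₂`-triple `h`, `e`, `f`,
and `u` spans a trivial module. -/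
structure IsSl2StandardTriple {L M : Type*} [LieRing L] [AddCommGroup M] [LieRingModule L M]
    (h e f : L) (v w u : M) : Prop where
  lie_h_v : ⁅h, v⁆ = v
  lie_h_w : ⁅h, w⁆ = -w
  lie_h_u : ⁅h, u⁆ = 0
  lie_e_v : ⁅e, v⁆ = 0
  lie_e_w : ⁅e, w⁆ = v
  lie_e_u : ⁅e, u⁆ = 0
  lie_f_v : ⁅f, v⁆ = w
  lie_f_w : ⁅f, w⁆ = 0
  lie_f_u : ⁅f, u⁆ = 0

theorem exists_isSl2AdjointTriple {t : IsSl2Triple h e f} {v : M}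
    (P : t.HasPrimitiveVectorWith v ((2 : ℕ) : K)) :
    ∃ v₁ v₂ : M, LinearIndependent K ![v, v₁, v₂] ∧ IsSl2AdjointTriple K h e f v v₁ v₂ := by
  have hH (n : ℕ) := P.lie_h_pow_toEnd_f n
  have hE (n : ℕ) := P.lie_e_pow_succ_toEnd_f n
  have hT : IsSl2AdjointTriple K h e f v ⁅f, v⁆ ((2⁻¹ : K) • ⁅f, ⁅f, v⁆⁆) :=
    { lie_h_zero := P.lie_h
      lie_h_one := by simpa using hH 1
      lie_h_two := by
        have := hH 2
        norm_num [pow_succ] at this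
        rw [lie_smul, this]
        module
      lie_e_zero := P.lie_e
      lie_e_one := by simpa using hE 0
      lie_e_two := by
        have := hE 1
        norm_num [pow_succ] at this
        rw [lie_smul, this]
        module
      lie_f_zero := rfl
      lie_f_one := by module
      lie_f_two := by simpa [pow_succ] using P.pow_toEnd_f_eq_zero_of_eq_nat rfl }
  have hF2 : ⁅f, ⁅f, v⁆⁆ ≠ 0 := by
    simpa [pow_succ] using P.pow_toEnd_f_ne_zero_of_eq_nat rfl (i := 2) le_rfl
  have hF1 : ⁅f, v⁆ ≠ 0 := fun h0 => hF2 (by rw [h0, lie_zero])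
  refine ⟨_, _, linearIndependent_of_lie_eq_smul (x := h) (μ := ![2, 0, -2]) ?_ ?_ ?_, hT⟩
  · intro i j hij
    fin_cases i <;> fin_cases j <;> norm_num at hij <;> rfl
  · simp [Fin.forall_fin_succ, hT.lie_h_zero, hT.lie_h_one, hT.lie_h_two]
  · simp [Fin.forall_fin_succ, P.ne_zero, hF1, hF2]

theorem exists_isSl2StandardTriple {t : IsSl2Triple h e f} {v u : M}
    (P : t.HasPrimitiveVectorWith v ((1 : ℕ) : K)) (hu : u ≠ 0) (hhu : ⁅h, u⁆ = 0)
    (heu : ⁅e, u⁆ = 0) (hfu : ⁅f, u⁆ = 0) :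
    ∃ w : M, LinearIndependent K ![v, w, u] ∧ IsSl2StandardTriple h e f v w u := by
  have hT : IsSl2StandardTriple h e f v ⁅f, v⁆ u :=
    { lie_h_v := by simpa using P.lie_h
      lie_h_w := by
        have := P.lie_h_pow_toEnd_f 1
        norm_num at this
        exact this
      lie_h_u := hhu
      lie_e_v := P.lie_e
      lie_e_w := by simpa using P.lie_e_pow_succ_toEnd_f 0
      lie_e_u := heu
      lie_f_v := rfl
      lie_f_w := by simpa [pow_succ] using P.pow_toEnd_f_eq_zero_of_eq_nat rfl
      lie_f_u := hfu }
  have hF1 : ⁅f, v⁆ ≠ 0 := by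
    simpa using P.pow_toEnd_f_ne_zero_of_eq_nat rfl (i := 1) le_rfl
  refine ⟨_, linearIndependent_of_lie_eq_smul (x := h) (μ := ![1, -1, 0]) ?_ ?_ ?_, hT⟩
  · intro i j hij
    fin_cases i <;> fin_cases j <;> norm_num at hij <;> rfl
  · simp [Fin.forall_fin_succ, hT.lie_h_v, hT.lie_h_w, hhu]
  · simp [Fin.forall_fin_succ, P.ne_zero, hF1, hu]

/- If `h` were injective, then `h² = 2 e f - h` would give `ker e = range e`, and `M` would have
even dimension. -/
theorem exists_lie_h_eq_zero_of_sq_eq_zero (t : IsSl2Triple h e f) (he : toEnd K L M e ^ 2 = 0)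
    (hM : Odd (finrank K M)) : ∃ u : M, u ≠ 0 ∧ ⁅h, u⁆ = 0 := by
  by_contra! hinj
  have hker : LinearMap.range (toEnd K L M e) = LinearMap.ker (toEnd K L M e) := by
    refine le_antisymm ?_ fun m hm => ?_
    · rintro _ ⟨m, rfl⟩
      simpa [pow_two] using LinearMap.congr_fun he m
    · have hm0 : ⁅e, m⁆ = 0 := hm
      have hefm : ⁅e, ⁅f, m⁆⁆ = ⁅h, m⁆ := by
        rw [leibniz_lie, t.lie_e_f, hm0, lie_zero, add_zero]
      have hhm : ⁅h, m⁆ = m := by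
        by_contra hne
        refine hinj _ (sub_ne_zero.2 hne) ?_
        rw [lie_sub, lie_h_lie_h_of_sq_eq_zero t he, hefm]
        module
      exact ⟨⁅f, m⁆, hefm.trans hhm⟩
  have hdim := (toEnd K L M e).finrank_range_add_finrank_ker
  rw [hker] at hdim
  exact Nat.not_even_iff_odd.2 hM ⟨_, hdim.symm⟩

/- Evaluating `h e = e` at `f² u`, where `e f² u = -2 f u` has weight `-2`, gives `6 f u = 0`. -/
theorem exists_lie_eq_zero_of_sq_eq_zero (t : IsSl2Triple h e f) (he : toEnd K L M e ^ 2 = 0)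
    (hM : Odd (finrank K M)) : ∃ u : M, u ≠ 0 ∧ ⁅h, u⁆ = 0 ∧ ⁅e, u⁆ = 0 ∧ ⁅f, u⁆ = 0 := by
  obtain ⟨u, hu, hhu⟩ := exists_lie_h_eq_zero_of_sq_eq_zero t he hM
  have heu : ⁅e, u⁆ = 0 := by
    rw [← neg_eq_zero, ← lie_e_lie_h_of_sq_eq_zero t he, hhu, lie_zero]
  have hhfu : ⁅h, ⁅f, u⁆⁆ = -((2 : K) • ⁅f, u⁆) := by
    rw [leibniz_lie, t.lie_lie_smul_f K, hhu, lie_zero, add_zero, neg_lie, smul_lie]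
  have heffu : ⁅e, ⁅f, ⁅f, u⁆⁆⁆ = -((2 : K) • ⁅f, u⁆) := by
    rw [leibniz_lie, leibniz_lie e f u, t.lie_e_f, hhfu, hhu, heu, lie_zero, add_zero, lie_zero,
      add_zero]
  refine ⟨u, hu, hhu, heu, ?_⟩
  have hsix := lie_h_lie_e_of_sq_eq_zero t he ⁅f, ⁅f, u⁆⁆
  rw [heffu, lie_neg, lie_smul, hhfu] at hsix
  have hfu : (6 : K) • ⁅f, u⁆ = 0 := by linear_combination (norm := module) (1 : K) • hsix
  exact (smul_eq_zero_iff_right (by norm_num)).1 hfu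

theorem exists_isSl2AdjointTriple_or_isSl2StandardTriple (t : IsSl2Triple h e f)
    (hM : finrank K M = 3) (he : toEnd K L M e ≠ 0) :
    (∃ v₀ v₁ v₂ : M, LinearIndependent K ![v₀, v₁, v₂] ∧ IsSl2AdjointTriple K h e f v₀ v₁ v₂) ∨
      ∃ v w u : M, LinearIndependent K ![v, w, u] ∧ IsSl2StandardTriple h e f v w u := by
  obtain ⟨n, v, hen, P⟩ := exists_hasPrimitiveVectorWith_succ t he
  have hn : n + 1 < 3 := hM ▸ lt_finrank_of_hasPrimitiveVectorWith P
  obtain rfl | rfl : n = 1 ∨ n = 0 := by lia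
  · exact Or.inl ⟨v, exists_isSl2AdjointTriple P⟩
  · obtain ⟨u, hu, hhu, heu, hfu⟩ := exists_lie_eq_zero_of_sq_eq_zero t hen (hM ▸ by decide)
    obtain ⟨w, hw⟩ := exists_isSl2StandardTriple P hu hhu heu hfu
    exact Or.inr ⟨v, w, u, hw⟩

end Sl2Modules

/-! ### Three-dimensional representations of `𝔰𝔬(3)` -/

section Triples

variable {K M : Type*} [Field K] [AddCommGroup M] [Module K M] {x y z : M}

theorem linearIndependent_triple_iff :
    LinearIndependent K ![x, y, z] ↔
      ∀ a b c : K, a • x + b • y + c • z = 0 → a = 0 ∧ b = 0 ∧ c = 0 := by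
  simp only [Fintype.linearIndependent_iff, Fin.sum_univ_three]
  refine ⟨fun h a b c habc => ?_, fun h g hg => ?_⟩
  · exact ⟨h ![a, b, c] habc 0, h ![a, b, c] habc 1, h ![a, b, c] habc 2⟩
  · obtain ⟨h0, h1, h2⟩ := h _ _ _ hg
    intro i
    fin_cases i <;> assumption

theorem exists_eq_of_linearIndependent_triple (hli : LinearIndependent K ![x, y, z])
    (hM : finrank K M = 3) (m : M) : ∃ a b c : K, m = a • x + b • y + c • z := by
  have : FiniteDimensional K M := FiniteDimensional.of_finrank_pos (by lia)
  have hm : m ∈ Submodule.span K (Set.range ![x, y, z]) := by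
    rw [hli.span_eq_top_of_card_eq_finrank' (by simp [hM])]
    exact Submodule.mem_top
  obtain ⟨c, hc⟩ := (Submodule.mem_span_range_iff_exists_fun K).1 hm
  exact ⟨c 0, c 1, c 2, by simpa [Fin.sum_univ_three] using hc.symm⟩

end Triples

section Endomorphisms

variable {K M : Type*} [Field K] [AddCommGroup M] [Module K M]

theorem exists_eigenvector_of_odd_finrank {V : Type*} [AddCommGroup V] [Module ℝ V]
    [FiniteDimensional ℝ V] (hV : Odd (finrank ℝ V)) (A : End ℝ V) :
    ∃ (μ : ℝ) (v : V), v ≠ 0 ∧ A v = μ • v := by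
  obtain ⟨μ, hμ⟩ : ∃ μ, A.charpoly.IsRoot μ := by
    by_contra! h
    have hlead : 0 ≤ A.charpoly.leadingCoeff := by
      rw [A.charpoly_monic.leadingCoeff]
      exact zero_le_one
    have hpos := Polynomial.zero_lt_eval_of_roots_lt_of_leadingCoeff_nonneg (x := 0)
      (fun y hy => (h y hy).elim) hlead
    have hneg := Polynomial.zero_lt_negOnePow_mul_eval_of_lt_roots_of_leadingCoeff_nonneg (x := 0)
      (fun y hy => (h y hy).elim) hlead
    rw [A.charpoly_natDegree, Int.negOnePow_odd _ (by exact_mod_cast hV)] at hneg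
    push_cast at hneg
    linarith
  obtain ⟨v, hv⟩ := ((Module.End.hasEigenvalue_iff_isRoot_charpoly A μ).2 hμ).exists_hasEigenvector
  exact ⟨μ, v, hv.2, hv.apply_eq_smul⟩

theorem exists_sq_eq_smul_one_of_trace_eq_zero (hM : finrank K M = 2) {A : End K M}
    (hA : LinearMap.trace K M A = 0) : ∃ c : K, A ^ 2 = c • 1 := by
  have : FiniteDimensional K M := FiniteDimensional.of_finrank_pos (by lia)
  let b := finBasisOfFinrankEq K M hM
  have hch : A.charpoly = Polynomial.X ^ 2 + Polynomial.C (LinearMap.toMatrix b b A).det := by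
    rw [← LinearMap.charpoly_toMatrix A b, Matrix.charpoly_fin_two,
      ← LinearMap.trace_eq_matrix_trace, hA]
    simp
  have := LinearMap.aeval_self_charpoly A
  rw [hch, map_add, map_pow, Polynomial.aeval_X, Polynomial.aeval_C, Algebra.algebraMap_eq_smul_one,
    ← eq_neg_iff_add_eq_zero, ← neg_smul] at this
  exact ⟨_, this⟩

end Endomorphisms

/-- The relations of the standard basis of `𝔰𝔬(3)`, that is, of the cross product on `ℝ³`. -/
structure IsSo3Triple {L : Type*} [LieRing L] (x y z : L) : Prop where
  lie_x_y : ⁅x, y⁆ = z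
  lie_y_z : ⁅y, z⁆ = x
  lie_z_x : ⁅z, x⁆ = y

/-- The vectors `v₀`, `v₁`, `v₂` are transformed by the `𝔰𝔬(3)`-triple `x`, `y`, `z` as the standard
basis of `ℝ³` is by infinitesimal rotations. -/
structure IsSo3VectorTriple {L M : Type*} [LieRing L] [AddCommGroup M] [LieRingModule L M]
    (x y z : L) (v₀ v₁ v₂ : M) : Prop where
  lie_x_zero : ⁅x, v₀⁆ = 0
  lie_x_one : ⁅x, v₁⁆ = v₂
  lie_x_two : ⁅x, v₂⁆ = -v₁
  lie_y_zero : ⁅y, v₀⁆ = -v₂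
  lie_y_one : ⁅y, v₁⁆ = 0
  lie_y_two : ⁅y, v₂⁆ = v₀
  lie_z_zero : ⁅z, v₀⁆ = v₁
  lie_z_one : ⁅z, v₁⁆ = -v₀
  lie_z_two : ⁅z, v₂⁆ = 0

namespace IsSo3Triple

theorem rotate {L : Type*} [LieRing L] {x y z : L} (t : IsSo3Triple x y z) : IsSo3Triple y z x :=
  ⟨t.lie_y_z, t.lie_z_x, t.lie_x_y⟩

theorem map {R L L' : Type*} [CommRing R] [LieRing L] [LieAlgebra R L] [LieRing L']
    [LieAlgebra R L'] {x y z : L} (t : IsSo3Triple x y z) (φ : L →ₗ⁅R⁆ L') :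
    IsSo3Triple (φ x) (φ y) (φ z) :=
  ⟨by rw [← φ.map_lie, t.lie_x_y], by rw [← φ.map_lie, t.lie_y_z], by rw [← φ.map_lie, t.lie_z_x]⟩

section PlaneRepresentations

attribute [local instance] LieRing.ofAssociativeRing

variable {V : Type*} [AddCommGroup V] [Module ℝ V] {A B C : End ℝ V}

theorem trace_eq_zero (t : IsSo3Triple A B C) : LinearMap.trace ℝ V A = 0 := by
  rw [← t.lie_y_z, LinearMap.trace_lie]

theorem mul_add_mul_eq_zero (t : IsSo3Triple A B C) (hV : finrank ℝ V = 2) :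
    A * B + B * A = 0 := by
  obtain ⟨a, ha⟩ := exists_sq_eq_smul_one_of_trace_eq_zero hV t.trace_eq_zero
  have hcomm : A ^ 2 * C = C * A ^ 2 := by rw [ha, smul_one_mul, mul_smul_one]
  rw [← t.lie_z_x, Ring.lie_def]
  calc A * (C * A - A * C) + (C * A - A * C) * A = C * A ^ 2 - A ^ 2 * C := by noncomm_ring
    _ = 0 := by rw [hcomm, sub_self]

theorem eq_two_smul_mul (t : IsSo3Triple A B C) (hV : finrank ℝ V = 2) :
    C = (2 : ℝ) • (A * B) := by
  have hanti := t.mul_add_mul_eq_zero hV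
  rw [← t.lie_x_y, Ring.lie_def]
  linear_combination (norm := module) (-1 : ℝ) • hanti

theorem sq_eq_smul_one (t : IsSo3Triple A B C) (hV : finrank ℝ V = 2) (hA : A ≠ 0) :
    B ^ 2 = (-4⁻¹ : ℝ) • 1 := by
  obtain ⟨b, hb⟩ := exists_sq_eq_smul_one_of_trace_eq_zero hV t.rotate.trace_eq_zero
  have hBA : B * A = -(A * B) := eq_neg_of_add_eq_zero_right (t.mul_add_mul_eq_zero hV)
  have hmul : A = (-4 * b) • A := by
    calc A = (4 : ℝ) • (B * A * B) := by
          nth_rw 1 [t.rotate.eq_two_smul_mul hV, t.eq_two_smul_mul hV]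
          rw [mul_smul_comm, smul_smul, ← mul_assoc]
          norm_num
      _ = (4 : ℝ) • -(A * B ^ 2) := by rw [hBA, neg_mul, mul_assoc, pow_two]
      _ = (-4 * b) • A := by
          rw [hb, mul_smul_one]
          module
  have hb4 : (4 * b + 1) • A = 0 := by linear_combination (norm := module) (1 : ℝ) • hmul
  rw [hb, show b = -4⁻¹ by linarith [(smul_eq_zero.1 hb4).resolve_right hA]]

/- Otherwise `2A` and `2B` anticommute and square to `-1`, as two imaginary quaternions do, and the
plane would be a module over the quaternions. -/
theorem eq_zero_of_finrank_eq_two (t : IsSo3Triple A B C) (hV : finrank ℝ V = 2) : A = 0 := by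
  by_contra hA
  have hB2 := t.sq_eq_smul_one hV hA
  have hC : C ≠ 0 := by
    rintro rfl
    exact hA (by rw [← t.lie_y_z, lie_zero])
  have hA2 := t.rotate.rotate.sq_eq_smul_one hV hC
  obtain ⟨v, hv⟩ := DFunLike.exists_ne hA
  replace hv : v ≠ 0 := fun h => hv (by simp [h])
  have hli : LinearIndependent ℝ ![v, A v, B v] := by
    refine linearIndependent_triple_iff.2 fun p q r hpqr => ?_
    have hnorm : (p • (1 : End ℝ V) - q • A - r • B) * (p • 1 + q • A + r • B) =
        (p ^ 2 + q ^ 2 / 4 + r ^ 2 / 4) • 1 := by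
      calc _ = p ^ 2 • (1 : End ℝ V) - q ^ 2 • A ^ 2 - r ^ 2 • B ^ 2
            - (q * r) • (A * B + B * A) := by
            simp only [sub_mul, mul_add, smul_mul_smul_comm, one_mul, mul_one, pow_two]
            module
        _ = _ := by
            rw [hA2, hB2, t.mul_add_mul_eq_zero hV]
            module
    have hzero : (p ^ 2 + q ^ 2 / 4 + r ^ 2 / 4) • v = 0 := by
      have := LinearMap.congr_fun hnorm v
      simpa [hpqr] using this.symm
    have hsum := (smul_eq_zero.1 hzero).resolve_right hv
    refine ⟨?_, ?_, ?_⟩ <;> nlinarith [sq_nonneg p, sq_nonneg q, sq_nonneg r]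
  have : FiniteDimensional ℝ V := FiniteDimensional.of_finrank_pos (by lia)
  simpa [hV] using hli.fintype_card_le_finrank

theorem eq_zero_of_apply_eq_zero (t : IsSo3Triple A B C) (hV : finrank ℝ V = 3) {v : V}
    (hv : v ≠ 0) (hAv : A v = 0) (hBv : B v = 0) (hCv : C v = 0) : C = 0 := by
  let W := ℝ ∙ v
  have hmap {T : End ℝ V} (hT : T v = 0) : W ≤ W.comap T :=
    (Submodule.span_singleton_le_iff_mem _ _).2 (by simp [hT])
  have hquot : IsSo3Triple (W.mapQ W A (hmap hAv)) (W.mapQ W B (hmap hBv))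
      (W.mapQ W C (hmap hCv)) := by
    refine ⟨?_, ?_, ?_⟩ <;> refine Submodule.linearMap_qext _ (LinearMap.ext fun m => ?_)
    · exact congrArg W.mkQ (LinearMap.congr_fun t.lie_x_y m)
    · exact congrArg W.mkQ (LinearMap.congr_fun t.lie_y_z m)
    · exact congrArg W.mkQ (LinearMap.congr_fun t.lie_z_x m)
  have : FiniteDimensional ℝ V := FiniteDimensional.of_finrank_pos (by lia)
  have hdim : finrank ℝ (V ⧸ W) = 2 := by
    have := W.finrank_quotient_add_finrank
    rw [finrank_span_singleton hv] at this
    lia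
  have hmem {T : End ℝ V} (hT : T v = 0) (h0 : W.mapQ W T (hmap hT) = 0) (m : V) :
      ∃ c : ℝ, c • v = T m :=
    Submodule.mem_span_singleton.1 <| (Submodule.Quotient.mk_eq_zero W).1 <|
      LinearMap.congr_fun h0 (W.mkQ m)
  refine LinearMap.ext fun m => ?_
  obtain ⟨a, ha⟩ := hmem hAv (hquot.eq_zero_of_finrank_eq_two hdim) m
  obtain ⟨b, hb⟩ := hmem hBv (hquot.rotate.eq_zero_of_finrank_eq_two hdim) m
  have hlie : A (B m) - B (A m) = C m := LinearMap.congr_fun t.lie_x_y m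
  rw [← hlie, ← ha, ← hb, map_smul, map_smul, hAv, hBv, smul_zero, smul_zero, sub_zero,
    LinearMap.zero_apply]

end PlaneRepresentations

section Modules

open LieModule

variable {L M : Type*} [LieRing L] [AddCommGroup M] [LieRingModule L M] {x y z : L} {v : M}

theorem lie_lie_y (t : IsSo3Triple x y z) (m : M) : ⁅x, ⁅y, m⁆⁆ = ⁅z, m⁆ + ⁅y, ⁅x, m⁆⁆ := by
  rw [leibniz_lie, t.lie_x_y]

theorem lie_lie_z (t : IsSo3Triple x y z) (m : M) : ⁅x, ⁅z, m⁆⁆ = -⁅y, m⁆ + ⁅z, ⁅x, m⁆⁆ := by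
  rw [leibniz_lie, ← lie_skew, t.lie_z_x, neg_lie]

variable [LieAlgebra ℝ L] [Module ℝ M] [LieModule ℝ L M] {μ : ℝ}

theorem linearIndependent_of_lie_eq_smul (t : IsSo3Triple x y z) (hv : v ≠ 0) (hx : ⁅x, v⁆ = μ • v)
    (h0 : ¬(⁅y, v⁆ = 0 ∧ ⁅z, v⁆ = 0)) : LinearIndependent ℝ ![v, ⁅y, v⁆, ⁅z, v⁆] := by
  have hxy : ⁅x, ⁅y, v⁆⁆ = ⁅z, v⁆ + μ • ⁅y, v⁆ := by rw [t.lie_lie_y, hx, lie_smul]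
  have hxz : ⁅x, ⁅z, v⁆⁆ = -⁅y, v⁆ + μ • ⁅z, v⁆ := by rw [t.lie_lie_z, hx, lie_smul]
  refine linearIndependent_triple_iff.2 fun a b c h => ?_
  have h1 : b • ⁅z, v⁆ - c • ⁅y, v⁆ = 0 := by
    have := congrArg (fun m => ⁅x, m⁆) h
    simp only [lie_add, lie_smul, hx, hxy, hxz, lie_zero] at this
    linear_combination (norm := module) (1 : ℝ) • this - μ • h
  have h2 : b • ⁅y, v⁆ + c • ⁅z, v⁆ = 0 := by
    have := congrArg (fun m => ⁅x, m⁆) h1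
    simp only [lie_sub, lie_smul, hxy, hxz, lie_zero] at this
    linear_combination (norm := module) μ • h1 - (1 : ℝ) • this
  have hy : (b ^ 2 + c ^ 2) • ⁅y, v⁆ = 0 := by
    linear_combination (norm := module) b • h2 - c • h1
  have hz : (b ^ 2 + c ^ 2) • ⁅z, v⁆ = 0 := by
    linear_combination (norm := module) c • h2 + b • h1
  have hbc : b ^ 2 + c ^ 2 = 0 := by
    by_contra hne
    exact h0 ⟨(smul_eq_zero.1 hy).resolve_left hne, (smul_eq_zero.1 hz).resolve_left hne⟩
  obtain rfl : b = 0 := by nlinarith [sq_nonneg b, sq_nonneg c]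
  obtain rfl : c = 0 := by nlinarith [sq_nonneg c]
  simpa [hv] using h

attribute [local instance] LieRing.ofAssociativeRing in
theorem lie_eq_zero_of_lie_eq_smul (t : IsSo3Triple x y z) (hM : finrank ℝ M = 3)
    (hli : LinearIndependent ℝ ![v, ⁅y, v⁆, ⁅z, v⁆]) (hx : ⁅x, v⁆ = μ • v) : ⁅x, v⁆ = 0 := by
  let b : Basis (Fin 3) ℝ M := basisOfLinearIndependentOfCardEqFinrank hli (by simp [hM])
  have hb0 : b 0 = v := by simp [b]
  have hb1 : b 1 = ⁅y, v⁆ := by simp [b]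
  have hb2 : b 2 = ⁅z, v⁆ := by simp [b]
  have h0 : toEnd ℝ L M x (b 0) = μ • b 0 := by rw [hb0, toEnd_apply_apply, hx]
  have h1 : toEnd ℝ L M x (b 1) = b 2 + μ • b 1 := by
    rw [hb1, hb2, toEnd_apply_apply, t.lie_lie_y, hx, lie_smul]
  have h2 : toEnd ℝ L M x (b 2) = -b 1 + μ • b 2 := by
    rw [hb1, hb2, toEnd_apply_apply, t.lie_lie_z, hx, lie_smul]
  have htr := trace_eq_zero (t.map (toEnd ℝ L M))
  rw [LinearMap.trace_eq_matrix_trace ℝ b, Matrix.trace_fin_three] at htr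
  simp only [LinearMap.toMatrix_apply, h0, h1, h2] at htr
  simp at htr
  rw [hx, show μ = 0 by linarith, zero_smul]

/- On the span of `v`, `⁅y, v⁆` and `⁅z, v⁆` we have `x³ = -x`, whereas `x² ⁅y, ⁅z, v⁆⁆` is
`-4 ⁅y, ⁅z, v⁆⁆`. -/
theorem lie_lie_of_lie_eq_zero (t : IsSo3Triple x y z) (hM : finrank ℝ M = 3)
    (hli : LinearIndependent ℝ ![v, ⁅y, v⁆, ⁅z, v⁆]) (hx : ⁅x, v⁆ = 0) :
    ⁅y, ⁅z, v⁆⁆ = 0 ∧ ⁅z, ⁅z, v⁆⁆ = ⁅y, ⁅y, v⁆⁆ := by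
  have hxy : ⁅x, ⁅y, v⁆⁆ = ⁅z, v⁆ := by rw [t.lie_lie_y, hx, lie_zero, add_zero]
  have hxz : ⁅x, ⁅z, v⁆⁆ = -⁅y, v⁆ := by rw [t.lie_lie_z, hx, lie_zero, add_zero]
  have hzy : ⁅z, ⁅y, v⁆⁆ = ⁅y, ⁅z, v⁆⁆ := by rw [t.rotate.lie_lie_y, hx, zero_add]
  have hxxx (m : M) : ⁅x, ⁅x, ⁅x, m⁆⁆⁆ = -⁅x, m⁆ := by
    obtain ⟨a, b, c, rfl⟩ := exists_eq_of_linearIndependent_triple hli hM m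
    simp only [lie_add, lie_smul, lie_neg, hx, hxy, hxz, lie_zero]
    module
  have hxyz : ⁅x, ⁅y, ⁅z, v⁆⁆⁆ = ⁅z, ⁅z, v⁆⁆ - ⁅y, ⁅y, v⁆⁆ := by
    rw [t.lie_lie_y, hxz, lie_neg, sub_eq_add_neg]
  have hxxyz : ⁅x, ⁅x, ⁅y, ⁅z, v⁆⁆⁆⁆ = -((4 : ℝ) • ⁅y, ⁅z, v⁆⁆) := by
    rw [hxyz, lie_sub, t.lie_lie_y, t.lie_lie_z, hxy, hxz, lie_neg, hzy]
    module
  have hxyz0 : ⁅x, ⁅y, ⁅z, v⁆⁆⁆ = 0 := by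
    have := hxxx ⁅y, ⁅z, v⁆⁆
    rw [hxxyz, lie_neg, lie_smul] at this
    linear_combination (norm := module) (-3⁻¹ : ℝ) • this
  refine ⟨?_, sub_eq_zero.1 (hxyz ▸ hxyz0)⟩
  rw [hxyz0, lie_zero] at hxxyz
  linear_combination (norm := module) (4⁻¹ : ℝ) • hxxyz

theorem isSo3VectorTriple_of_lie_eq_zero (t : IsSo3Triple x y z) (hM : finrank ℝ M = 3)
    (hli : LinearIndependent ℝ ![v, ⁅y, v⁆, ⁅z, v⁆]) (hx : ⁅x, v⁆ = 0) :
    IsSo3VectorTriple x y z v ⁅z, v⁆ (-⁅y, v⁆) := by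
  obtain ⟨hyz, hzz⟩ := t.lie_lie_of_lie_eq_zero hM hli hx
  have hxy : ⁅x, ⁅y, v⁆⁆ = ⁅z, v⁆ := by rw [t.lie_lie_y, hx, lie_zero, add_zero]
  have hxz : ⁅x, ⁅z, v⁆⁆ = -⁅y, v⁆ := by rw [t.lie_lie_z, hx, lie_zero, add_zero]
  have hzy : ⁅z, ⁅y, v⁆⁆ = 0 := by rw [← hyz, t.rotate.lie_lie_y, hx, zero_add]
  have hker {m : M} (hm : ⁅x, m⁆ = 0) : ∃ a : ℝ, m = a • v := by
    obtain ⟨a, b, c, rfl⟩ := exists_eq_of_linearIndependent_triple hli hM m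
    simp only [lie_add, lie_smul, hx, hxy, hxz] at hm
    obtain ⟨-, hc, hb⟩ := linearIndependent_triple_iff.1 hli 0 (-c) b
      (by linear_combination (norm := module) (1 : ℝ) • hm)
    exact ⟨a, by rw [hb, neg_eq_zero.1 hc]; module⟩
  obtain ⟨a, ha⟩ := hker (m := ⁅y, ⁅y, v⁆⁆) (by rw [t.lie_lie_y, hxy, hyz, hzy, add_zero])
  have hyy : ⁅y, ⁅y, v⁆⁆ = -v := by
    have ha1 : (1 + a) • ⁅z, v⁆ = 0 := by
      have := t.rotate.lie_lie_y ⁅y, v⁆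
      rw [hzy, lie_zero, hxy, ha, lie_smul] at this
      linear_combination (norm := module) (-1 : ℝ) • this
    rw [ha, eq_neg_of_add_eq_zero_right ((smul_eq_zero.1 ha1).resolve_right (hli.ne_zero 2)),
      neg_one_smul]
  exact ⟨hx, hxz, by rw [lie_neg, hxy], (neg_neg _).symm, hyz, by rw [lie_neg, hyy, neg_neg], rfl,
    hzz.trans hyy, by rw [lie_neg, hzy, neg_zero]⟩

attribute [local instance] LieRing.ofAssociativeRing in
theorem exists_isSo3VectorTriple (t : IsSo3Triple x y z) (hM : finrank ℝ M = 3)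
    (hxM : toEnd ℝ L M x ≠ 0) :
    ∃ v₀ v₁ v₂ : M, LinearIndependent ℝ ![v₀, v₁, v₂] ∧ IsSo3VectorTriple x y z v₀ v₁ v₂ := by
  have : FiniteDimensional ℝ M := FiniteDimensional.of_finrank_pos (by lia)
  obtain ⟨μ, v, hv, hx⟩ := exists_eigenvector_of_odd_finrank (hM ▸ by decide) (toEnd ℝ L M x)
  have hyz : ¬(⁅y, v⁆ = 0 ∧ ⁅z, v⁆ = 0) := by
    rintro ⟨hy, hz⟩
    have hx0 : ⁅x, v⁆ = 0 := by rw [← t.lie_y_z, lie_lie, hy, hz, lie_zero, lie_zero, sub_zero]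
    exact hxM ((t.map (toEnd ℝ L M)).rotate.eq_zero_of_apply_eq_zero hM hv hy hz hx0)
  have hli := t.linearIndependent_of_lie_eq_smul hv hx hyz
  refine ⟨v, ⁅z, v⁆, -⁅y, v⁆, linearIndependent_triple_iff.2 fun a b c h => ?_,
    t.isSo3VectorTriple_of_lie_eq_zero hM hli (t.lie_eq_zero_of_lie_eq_smul hM hli hx)⟩
  obtain ⟨ha, hc, hb⟩ := linearIndependent_triple_iff.1 hli a (-c) b
    (by linear_combination (norm := module) (1 : ℝ) • h)
  exact ⟨ha, hb, neg_eq_zero.1 hc⟩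

end Modules

end IsSo3Triple

/-! ### Three-dimensional semisimple Lie algebras -/

section Killing

variable {K L ι : Type*} [Field K] [LieRing L] [LieAlgebra K L] {b : Basis ι K L}

theorem exists_basis_isOrthoᵢ_killingForm [CharZero K] [FiniteDimensional K L] {n : ℕ}
    (hn : finrank K L = n) : ∃ b : Basis (Fin n) K L, (killingForm K L).IsOrthoᵢ b := by
  have : Invertible (2 : K) := invertibleOfNonzero two_ne_zero
  obtain ⟨b, hb⟩ :=
    LinearMap.BilinForm.exists_orthogonal_basis (LieModule.traceForm_isSymm K L L)
  refine ⟨b.reindex (finCongr hn), fun i j hij => ?_⟩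
  simpa only [Function.onFun, Basis.reindex_apply] using
    hb ((finCongr hn).symm.injective.ne hij)

theorem killingForm_basis_right [Finite ι] (hb : (killingForm K L).IsOrthoᵢ b) (x : L) (i : ι) :
    killingForm K L x (b i) = b.repr x i * killingForm K L (b i) (b i) := by
  have := Fintype.ofFinite ι
  conv_lhs => rw [← b.sum_repr x]
  rw [map_sum, LinearMap.sum_apply, Finset.sum_eq_single i (fun j _ hji => ?_) (by simp)]
  · rw [map_smul, LinearMap.smul_apply, smul_eq_mul]
  · rw [map_smul, LinearMap.smul_apply, hb hji, smul_zero]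

variable [LieAlgebra.IsKilling K L]

theorem killingForm_basis_self_ne_zero (hb : (killingForm K L).IsOrthoᵢ b) (i : ι) :
    killingForm K L (b i) (b i) ≠ 0 :=
  hb.not_isOrtho_basis_self_of_separatingLeft
    (LieAlgebra.IsKilling.killingForm_nondegenerate K L).1 i

variable [Finite ι]

theorem repr_lie_basis_self (hb : (killingForm K L).IsOrthoᵢ b) (x : L) (i : ι) :
    b.repr ⁅x, b i⁆ i = 0 := by
  have h := killingForm_basis_right hb ⁅x, b i⁆ i
  rw [LieModule.traceForm_apply_lie_apply, lie_self, map_zero, eq_comm, mul_eq_zero] at h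
  exact h.resolve_right (killingForm_basis_self_ne_zero hb i)

theorem repr_basis_self_lie (hb : (killingForm K L).IsOrthoᵢ b) (x : L) (i : ι) :
    b.repr ⁅b i, x⁆ i = 0 := by
  rw [← lie_skew, map_neg, Finsupp.neg_apply, repr_lie_basis_self hb, neg_zero]

theorem lie_basis_eq_repr_smul (hb : (killingForm K L).IsOrthoᵢ b) {i j k : ι}
    (hk : ∀ l, l ≠ k → l = i ∨ l = j) : ⁅b i, b j⁆ = b.repr ⁅b i, b j⁆ k • b k := by
  refine b.ext_elem fun l => ?_
  rcases eq_or_ne l k with rfl | hl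
  · simp
  · rw [map_smul, Finsupp.smul_apply, b.repr_self, Finsupp.single_eq_of_ne hl, smul_zero]
    rcases hk l hl with rfl | rfl
    exacts [repr_basis_self_lie hb _ _, repr_lie_basis_self hb _ _]

theorem exists_basis_lie_eq_smul [CharZero K] (h3 : finrank K L = 3) :
    ∃ (b : Basis (Fin 3) K L) (α β γ : K), α ≠ 0 ∧ β ≠ 0 ∧ γ ≠ 0 ∧
      ⁅b 1, b 2⁆ = α • b 0 ∧ ⁅b 2, b 0⁆ = β • b 1 ∧ ⁅b 0, b 1⁆ = γ • b 2 := by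
  have : FiniteDimensional K L := FiniteDimensional.of_finrank_pos (by lia)
  obtain ⟨b, hb⟩ := exists_basis_isOrthoᵢ_killingForm h3
  have h12 := lie_basis_eq_repr_smul hb (show ∀ l : Fin 3, l ≠ 0 → l = 1 ∨ l = 2 by decide)
  have h20 := lie_basis_eq_repr_smul hb (show ∀ l : Fin 3, l ≠ 1 → l = 2 ∨ l = 0 by decide)
  have h01 := lie_basis_eq_repr_smul hb (show ∀ l : Fin 3, l ≠ 2 → l = 0 ∨ l = 1 by decide)
  -- By invariance, `κ ⁅b i, b j⁆ (b k)` is the same number for all cyclic `(i, j, k)`.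
  have hα : killingForm K L ⁅b 0, b 1⁆ (b 2) =
      b.repr ⁅b 1, b 2⁆ 0 * killingForm K L (b 0) (b 0) := by
    rw [LieModule.traceForm_apply_lie_apply, h12, map_smul, smul_eq_mul, ← h12]
  have hβ : killingForm K L ⁅b 0, b 1⁆ (b 2) =
      b.repr ⁅b 2, b 0⁆ 1 * killingForm K L (b 1) (b 1) := by
    rw [LieModule.traceForm_apply_lie_apply, LieModule.traceForm_comm,
      LieModule.traceForm_apply_lie_apply, h20, map_smul, smul_eq_mul, ← h20]
  have hγ := killingForm_basis_right hb ⁅b 0, b 1⁆ 2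
  have hne : killingForm K L ⁅b 0, b 1⁆ (b 2) ≠ 0 := fun h0 => by
    have h := killingForm_basis_self_ne_zero hb
    rw [h0, eq_comm, mul_eq_zero_iff_right (h _)] at hβ hγ
    have hcen : b 0 ∈ LieAlgebra.center K L := by
      rw [hγ, zero_smul] at h01
      rw [hβ, zero_smul, ← lie_skew, neg_eq_zero] at h20
      have had : LieModule.toEnd K L L (b 0) = 0 := b.ext fun i => by
        fin_cases i
        exacts [lie_self _, h01, h20]
      exact (LieModule.mem_maxTrivSubmodule K L L _).2 fun x => by
        rw [← lie_skew, ← LieModule.toEnd_apply_apply K L L, had, LinearMap.zero_apply, neg_zero]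
    rw [LieAlgebra.center_eq_bot, LieSubmodule.mem_bot] at hcen
    exact b.ne_zero 0 hcen
  exact ⟨b, _, _, _, left_ne_zero_of_mul (hα ▸ hne), left_ne_zero_of_mul (hβ ▸ hne),
    left_ne_zero_of_mul (hγ ▸ hne), h12, h20, h01⟩

end Killing

theorem linearIndependent_of_isSl2Triple {K L : Type*} [Field K] [CharZero K] [LieRing L]
    [LieAlgebra K L] {h e f : L} (t : IsSl2Triple h e f) : LinearIndependent K ![h, e, f] := by
  refine linearIndependent_of_lie_eq_smul (x := h) (μ := ![0, 2, -2]) ?_ ?_ ?_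
  · intro i j hij
    fin_cases i <;> fin_cases j <;> first | rfl | (revert hij; norm_num)
  · intro i
    fin_cases i
    · simp
    · simpa using t.lie_h_e_smul K
    · simpa using t.lie_lie_smul_f K
  · intro i
    fin_cases i
    exacts [t.h_ne_zero, t.e_ne_zero, t.f_ne_zero]

section Real

variable {L : Type*} [LieRing L] [LieAlgebra ℝ L] {x y z : L} {α β γ : ℝ}

theorem IsSo3Triple.linearIndependent (t : IsSo3Triple x y z) (hz : z ≠ 0) :
    LinearIndependent ℝ ![x, y, z] := by
  refine linearIndependent_triple_iff.2 fun a b c h => ?_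
  have hxz : ⁅x, z⁆ = -y := by rw [← lie_skew, t.lie_z_x]
  have hyx : ⁅y, x⁆ = -z := by rw [← lie_skew, t.lie_x_y]
  have hx : b • z - c • y = 0 := by
    simpa [t.lie_x_y, hxz, sub_eq_add_neg] using congrArg (⁅x, ·⁆) h
  have hxx : -(b • y) - c • z = 0 := by
    simpa [t.lie_x_y, hxz] using congrArg (⁅x, ·⁆) hx
  have hbc : (b * b + c * c) • z = 0 := by
    linear_combination (norm := module) b • hx - c • hxx
  obtain ⟨rfl, rfl⟩ := mul_self_add_mul_self_eq_zero.1 ((smul_eq_zero_iff_left hz).1 hbc)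
  have hy : a • z = 0 := by simpa [hyx] using congrArg (⁅y, ·⁆) h
  exact ⟨(smul_eq_zero_iff_left hz).1 hy, rfl, rfl⟩

theorem exists_isSl2Triple_of_mul_neg (hyz : ⁅y, z⁆ = α • x) (hzx : ⁅z, x⁆ = β • y)
    (hxy : ⁅x, y⁆ = γ • z) (hz : z ≠ 0) (hγ : γ ≠ 0) (hαβ : α * β < 0) :
    ∃ h e f : L, IsSl2Triple h e f := by
  have hβ : β ≠ 0 := right_ne_zero_of_mul hαβ.ne
  obtain ⟨μ, hμ, hμ2⟩ : ∃ μ : ℝ, μ ≠ 0 ∧ μ * μ = -(α * β) :=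
    ⟨√(-(α * β)), (Real.sqrt_pos.2 (by linarith)).ne', Real.mul_self_sqrt (by linarith)⟩
  have hα : α = -(μ * μ) / β := by rw [hμ2, neg_neg, mul_div_cancel_right₀ α hβ]
  have hyx : ⁅y, x⁆ = -(γ • z) := by rw [← hxy, lie_skew]
  have hzy : ⁅z, y⁆ = -(α • x) := by rw [← hyz, lie_skew]
  -- `ad z` preserves the plane of `x` and `y`, where its eigenvalues are `±μ`.
  refine ⟨(2 / μ) • z, μ • x + β • y, (-1 / (μ * μ * β * γ)) • (μ • x - β • y),
    smul_ne_zero (div_ne_zero two_ne_zero hμ) hz, ?_, ?_, ?_⟩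
  · simp only [lie_smul, lie_sub, add_lie, smul_lie, lie_self, hxy, hyx]
    match_scalars
    field_simp
    ring
  · simp only [lie_add, lie_smul, smul_lie, hzx, hzy, hα]
    match_scalars <;> field_simp
  · simp only [lie_sub, lie_smul, smul_lie, hzx, hzy, hα]
    match_scalars <;> field_simp

theorem exists_isSo3Triple_of_mul_pos (hyz : ⁅y, z⁆ = α • x) (hzx : ⁅z, x⁆ = β • y)
    (hxy : ⁅x, y⁆ = γ • z) (hz : z ≠ 0) (hβγ : 0 < β * γ) (hαγ : 0 < α * γ) :
    ∃ x' y' z' : L, z' ≠ 0 ∧ IsSo3Triple x' y' z' := by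
  obtain ⟨p, hp, hp2⟩ : ∃ p : ℝ, p ≠ 0 ∧ p * p = β * γ :=
    ⟨√(β * γ), (Real.sqrt_pos.2 hβγ).ne', Real.mul_self_sqrt hβγ.le⟩
  obtain ⟨q, hq, hq2⟩ : ∃ q : ℝ, q ≠ 0 ∧ q * q = α * γ :=
    ⟨√(α * γ), (Real.sqrt_pos.2 hαγ).ne', Real.mul_self_sqrt hαγ.le⟩
  have hγ : γ ≠ 0 := right_ne_zero_of_mul hβγ.ne'
  have hα : α = q * q / γ := by rw [hq2, mul_div_cancel_right₀ α hγ]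
  have hβ : β = p * p / γ := by rw [hp2, mul_div_cancel_right₀ β hγ]
  refine ⟨p⁻¹ • x, q⁻¹ • y, (γ * p⁻¹ * q⁻¹) • z, smul_ne_zero ?_ hz, ?_, ?_, ?_⟩
  · positivity
  · simp only [lie_smul, smul_lie, hxy]
    match_scalars
    field_simp
  · simp only [lie_smul, smul_lie, hyz, hα]
    match_scalars
    field_simp
  · simp only [lie_smul, smul_lie, hzx, hβ]
    match_scalars
    field_simp

theorem exists_isSo3Triple_or_exists_isSl2Triple [LieAlgebra.IsKilling ℝ L]
    (h3 : finrank ℝ L = 3) :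
    (∃ x y z : L, z ≠ 0 ∧ IsSo3Triple x y z) ∨ ∃ h e f : L, IsSl2Triple h e f := by
  obtain ⟨b, α, β, γ, hα, hβ, hγ, h12, h20, h01⟩ := exists_basis_lie_eq_smul (K := ℝ) h3
  rcases (mul_ne_zero hβ hγ).lt_or_gt with hβγ | hβγ
  · exact Or.inr (exists_isSl2Triple_of_mul_neg h20 h01 h12 (b.ne_zero 0) hα hβγ)
  rcases (mul_ne_zero hα hγ).lt_or_gt with hαγ | hαγ
  · exact Or.inr (exists_isSl2Triple_of_mul_neg h01 h12 h20 (b.ne_zero 1) hβ (mul_comm α γ ▸ hαγ))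
  · exact Or.inl (exists_isSo3Triple_of_mul_pos h12 h20 h01 (b.ne_zero 2) hβγ hαγ)

end Real

/-! ### Dimensions in a Levi decomposition -/

section Solvable

variable {K L : Type*} [Field K] [LieRing L] [LieAlgebra K L]

theorem isSolvable_of_lie_mem_span_singleton {w : L}
    (h : ∀ u v : L, ⁅u, v⁆ ∈ Submodule.span K {w}) : LieAlgebra.IsSolvable L := by
  have hD : ∀ z ∈ LieAlgebra.derivedSeries K L 1, z ∈ Submodule.span K {w} := by
    intro z hz
    rw [LieAlgebra.derivedSeries_def, LieAlgebra.derivedSeriesOfIdeal_succ,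
      LieAlgebra.derivedSeriesOfIdeal_zero, ← LieSubmodule.mem_toSubmodule,
      LieSubmodule.lieIdeal_oper_eq_linear_span'] at hz
    refine Submodule.span_le.2 ?_ hz
    rintro _ ⟨u, -, v, -, rfl⟩
    exact h u v
  refine LieAlgebra.IsSolvable.mk (R := K) (k := 2) ?_
  rw [LieAlgebra.derivedSeries_def, LieAlgebra.derivedSeriesOfIdeal_succ,
    LieSubmodule.lie_eq_bot_iff]
  intro u hu v hv
  obtain ⟨s, rfl⟩ := Submodule.mem_span_singleton.1 (hD u hu)
  obtain ⟨t, rfl⟩ := Submodule.mem_span_singleton.1 (hD v hv)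
  rw [smul_lie, lie_smul, lie_self, smul_zero, smul_zero]

theorem linearIndependent_pair_of_lie_ne_zero {x y : L} (h : ⁅x, y⁆ ≠ 0) :
    LinearIndependent K ![x, y] := by
  refine LinearIndependent.pair_iff.2 fun a b hab => ⟨?_, ?_⟩
  · exact (smul_eq_zero_iff_left h).1 (by simpa using congrArg (⁅·, y⁆) hab)
  · exact (smul_eq_zero_iff_left h).1 (by simpa using congrArg (⁅x, ·⁆) hab)

theorem isSolvable_of_finrank_le_two [FiniteDimensional K L] (h : finrank K L ≤ 2) :
    LieAlgebra.IsSolvable L := by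
  by_cases hab : IsLieAbelian L
  · infer_instance
  obtain ⟨x, y, hxy⟩ : ∃ x y : L, ⁅x, y⁆ ≠ 0 := by
    by_contra! h0
    exact hab ⟨h0⟩
  have hli : LinearIndependent K ![x, y] := linearIndependent_pair_of_lie_ne_zero hxy
  have hspan : ∀ z : L, ∃ a b : K, a • x + b • y = z := fun z => by
    rw [← Submodule.mem_span_pair, ← Matrix.range_cons_cons_empty x y ![],
      hli.span_eq_top_of_card_eq_finrank' (le_antisymm hli.fintype_card_le_finrank (by simpa))]
    exact Submodule.mem_top
  refine isSolvable_of_lie_mem_span_singleton (K := K) (w := ⁅x, y⁆) fun u v => ?_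
  obtain ⟨a, b, rfl⟩ := hspan u
  obtain ⟨c, d, rfl⟩ := hspan v
  refine Submodule.mem_span_singleton.2 ⟨a * d - b * c, ?_⟩
  simp only [lie_add, add_lie, lie_smul, smul_lie, lie_self]
  rw [← lie_skew y x]
  module

end Solvable

section Semisimple

variable {K S V : Type*} [Field K] [LieRing S] [LieAlgebra K S] [FiniteDimensional K S]
  [AddCommGroup V] [Module K V] [FiniteDimensional K V] [LieRingModule S V] [LieModule K S V]

theorem finrank_le_finrank_ker_add_sq :
    finrank K S ≤ finrank K (LieModule.ker K S V) + finrank K V ^ 2 := by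
  have hrk := LinearMap.finrank_range_add_finrank_ker (LieModule.toEnd K S V : S →ₗ[K] End K V)
  have hle := Submodule.finrank_le (LinearMap.range (LieModule.toEnd K S V : S →ₗ[K] End K V))
  rw [Module.finrank_linearMap] at hle
  change _ + finrank K (LieModule.ker K S V) = _ at hrk
  lia

variable [LieAlgebra.IsSemisimple K S]

theorem ideal_eq_bot_of_finrank_le_two {I : LieIdeal K S} (h : finrank K I ≤ 2) : I = ⊥ :=
  have := isSolvable_of_finrank_le_two h
  LieAlgebra.HasTrivialRadical.eq_bot_of_isSolvable I

theorem ideal_eq_top_of_finrank_le_add_two {I : LieIdeal K S}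
    (h : finrank K S ≤ finrank K I + 2) : I = ⊤ := by
  have hd : finrank K I + finrank K (Iᶜ : LieIdeal K S) = finrank K S :=
    Submodule.finrank_add_eq_of_isCompl ((LieSubmodule.isCompl_toSubmodule).2 isCompl_compl)
  exact compl_eq_bot.1 (ideal_eq_bot_of_finrank_le_two (by lia))

theorem finrank_ne_sq_of_ker_eq_bot [Nontrivial V] (hker : LieModule.ker K S V = ⊥) :
    finrank K S ≠ finrank K V ^ 2 := by
  intro h
  have hinj : Function.Injective (LieModule.toEnd K S V : S →ₗ[K] End K V) :=
    LinearMap.ker_eq_bot.1 (congrArg LieSubmodule.toSubmodule hker)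
  have hsurj := (LinearMap.injective_iff_surjective_of_finrank_eq_finrank (by
    rw [Module.finrank_linearMap, h, sq])).1 hinj
  -- The identity of `V` is the action of a central element.
  obtain ⟨x, hx⟩ := hsurj 1
  have hx1 (v : V) : ⁅x, v⁆ = v := LinearMap.congr_fun hx v
  have hcen : x ∈ LieAlgebra.center K S := fun y => hinj <| LinearMap.ext fun v => by
    change ⁅⁅y, x⁆, v⁆ = LieModule.toEnd K S V 0 v
    rw [lie_lie, hx1, hx1, sub_self, map_zero, LinearMap.zero_apply]
  rw [LieAlgebra.center_eq_bot, LieSubmodule.mem_bot] at hcen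
  obtain ⟨v, hv⟩ := exists_ne (0 : V)
  exact hv (by rw [← hx1 v, hcen, zero_lie])

theorem finrank_eq_three_of_finrank_add_finrank_eq_six (hd : finrank K S + finrank K V = 6)
    (hV : 0 < finrank K V) (hact : ∃ (x : S) (v : V), ⁅x, v⁆ ≠ 0) : finrank K S = 3 := by
  have := nontrivial_of_finrank_pos hV
  have htop : LieModule.ker K S V ≠ ⊤ := fun h => by
    obtain ⟨x, v, hxv⟩ := hact
    exact hxv ((LieModule.mem_ker K S V x).1 (h ▸ LieSubmodule.mem_top x) v)
  have hker : finrank K (LieModule.ker K S V) + 2 < finrank K S := by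
    by_contra! h
    exact htop (ideal_eq_top_of_finrank_le_add_two h)
  have hle := finrank_le_finrank_ker_add_sq (K := K) (S := S) (V := V)
  obtain h | h | h : finrank K S = 3 ∨ finrank K S = 4 ∨ finrank K S = 5 := by lia
  · exact h
  · have hbot : LieModule.ker K S V = ⊥ := ideal_eq_bot_of_finrank_le_two (by lia)
    exact (finrank_ne_sq_of_ker_eq_bot hbot (by rw [h, show finrank K V = 2 by lia]; rfl)).elim
  · rw [show finrank K V = 1 by lia] at hle
    lia

end Semisimple

/-! ### Brackets on the radical -/

section ActionOfTriple

variable {K L M : Type*} [Field K] [LieRing L] [LieAlgebra K L] [AddCommGroup M] [Module K M]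
  [LieRingModule L M] [LieModule K L M]

theorem eq_top_of_mem_of_isSl2Triple [CharZero K] {I : LieIdeal K L} {h e f : L}
    (t : IsSl2Triple h e f) (hL : finrank K L = 3) (he : e ∈ I) : I = ⊤ := by
  have hh : h ∈ I := t.lie_e_f ▸ lie_mem_left K L I e f he
  have hf : f ∈ I := by
    have h2f : -((2 : K) • f) ∈ I := t.lie_lie_smul_f K ▸ lie_mem_left K L I h f hh
    exact (I.toSubmodule.smul_mem_iff two_ne_zero).1 (neg_mem_iff.1 h2f)
  refine eq_top_iff.2 fun m _ => ?_
  obtain ⟨a, b, c, rfl⟩ :=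
    exists_eq_of_linearIndependent_triple (linearIndependent_of_isSl2Triple t) hL m
  exact add_mem (add_mem (I.smul_mem a hh) (I.smul_mem b he)) (I.smul_mem c hf)

theorem IsSo3Triple.eq_top_of_mem [LieAlgebra ℝ L] {I : LieIdeal ℝ L} {x y z : L}
    (t : IsSo3Triple x y z) (hz : z ≠ 0) (hL : finrank ℝ L = 3) (hx : x ∈ I) : I = ⊤ := by
  have hz' : z ∈ I := t.lie_x_y ▸ lie_mem_left ℝ L I x y hx
  have hy : y ∈ I := t.lie_z_x ▸ lie_mem_left ℝ L I z x hz'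
  refine eq_top_iff.2 fun m _ => ?_
  obtain ⟨a, b, c, rfl⟩ := exists_eq_of_linearIndependent_triple (t.linearIndependent hz) hL m
  exact add_mem (add_mem (I.smul_mem a hx) (I.smul_mem b hy)) (I.smul_mem c hz')

theorem ker_ne_top_of_lie_ne_zero {p : L} {m : M} (h : ⁅p, m⁆ ≠ 0) : LieModule.ker K L M ≠ ⊤ :=
  fun htop => h ((LieModule.mem_ker K L M p).1 (htop ▸ LieSubmodule.mem_top p) m)

end ActionOfTriple

section BracketOfTriple

variable {K L : Type*} [Field K] [LieRing L] [LieAlgebra K L]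

theorem IsSo3VectorTriple.exists_lie_eq_smul {x y z v₀ v₁ v₂ : L}
    (h : IsSo3VectorTriple x y z v₀ v₁ v₂) (hli : LinearIndependent K ![v₀, v₁, v₂])
    (hmem : ⁅v₀, v₁⁆ ∈ Submodule.span K {v₀, v₁, v₂}) :
    ∃ c : K, ⁅v₀, v₁⁆ = c • v₂ ∧ ⁅v₁, v₂⁆ = c • v₀ ∧ ⁅v₂, v₀⁆ = c • v₁ := by
  obtain ⟨a, b, c, h01⟩ := Submodule.mem_span_triple.1 hmem
  have hz : ⁅z, ⁅v₀, v₁⁆⁆ = 0 := by simp [leibniz_lie z, h.lie_z_zero, h.lie_z_one]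
  obtain ⟨hb, ha, -⟩ := linearIndependent_triple_iff.1 hli (-b) a 0 <| by
    rw [← h01, lie_add, lie_add, lie_smul, lie_smul, lie_smul, h.lie_z_zero, h.lie_z_one,
      h.lie_z_two] at hz
    rw [← hz]
    module
  obtain rfl : b = 0 := neg_eq_zero.1 hb
  subst ha
  replace h01 : ⁅v₀, v₁⁆ = c • v₂ := by rw [← h01]; module
  have hy : ⁅y, ⁅v₀, v₁⁆⁆ = ⁅v₁, v₂⁆ := by simp [leibniz_lie y, h.lie_y_zero, h.lie_y_one]
  have hx : ⁅x, ⁅v₀, v₁⁆⁆ = -⁅v₂, v₀⁆ := by simp [leibniz_lie x, h.lie_x_zero, h.lie_x_one]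
  refine ⟨c, h01, ?_, neg_injective ?_⟩
  · rw [← hy, h01, lie_smul, h.lie_y_two]
  · rw [← hx, h01, lie_smul, h.lie_x_two, smul_neg]

theorem IsSl2AdjointTriple.exists_lie_eq_smul [CharZero K] {h e f v₀ v₁ v₂ : L}
    (hv : IsSl2AdjointTriple K h e f v₀ v₁ v₂) (hli : LinearIndependent K ![v₀, v₁, v₂])
    (hmem : ⁅v₀, v₁⁆ ∈ Submodule.span K {v₀, v₁, v₂}) :
    ∃ a : K, ⁅v₀, v₁⁆ = (2 * a) • v₀ ∧ ⁅v₀, v₂⁆ = a • v₁ ∧ ⁅v₁, v₂⁆ = (2 * a) • v₂ := by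
  obtain ⟨a, b, c, h01⟩ := Submodule.mem_span_triple.1 hmem
  have hh : ⁅h, ⁅v₀, v₁⁆⁆ = (2 : K) • ⁅v₀, v₁⁆ := by
    rw [leibniz_lie, hv.lie_h_zero, hv.lie_h_one, smul_lie, lie_zero, add_zero]
  obtain ⟨-, hb, hc⟩ := linearIndependent_triple_iff.1 hli 0 (2 * b) (4 * c) <| by
    rw [← h01, lie_add, lie_add, lie_smul, lie_smul, lie_smul, hv.lie_h_zero, hv.lie_h_one,
      hv.lie_h_two] at hh
    linear_combination (norm := module) -hh
  obtain rfl : b = 0 := by simpa using hb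
  obtain rfl : c = 0 := by simpa using hc
  replace h01 : ⁅v₀, v₁⁆ = a • v₀ := by rw [← h01]; module
  have hf : ⁅f, ⁅v₀, v₁⁆⁆ = (2 : K) • ⁅v₀, v₂⁆ := by
    simp [leibniz_lie f, hv.lie_f_zero, hv.lie_f_one]
  have h02 : ⁅v₀, v₂⁆ = (a / 2) • v₁ := by
    rw [h01, lie_smul, hv.lie_f_zero] at hf
    rw [div_eq_inv_mul, mul_smul, hf, inv_smul_smul₀ two_ne_zero]
  have hf' : ⁅f, ⁅v₀, v₂⁆⁆ = ⁅v₁, v₂⁆ := by simp [leibniz_lie f, hv.lie_f_zero, hv.lie_f_two]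
  refine ⟨a / 2, ?_, h02, ?_⟩
  · rw [h01, mul_div_cancel₀ _ two_ne_zero]
  · rw [← hf', h02, lie_smul, hv.lie_f_one, smul_smul, mul_comm]

namespace IsSl2StandardTriple

variable {h e f v w u : L}

theorem exists_lie_v_w_eq_smul (hv : IsSl2StandardTriple h e f v w u)
    (hli : LinearIndependent K ![v, w, u]) (hmem : ⁅v, w⁆ ∈ Submodule.span K {v, w, u}) :
    ∃ c : K, ⁅v, w⁆ = c • u := by
  obtain ⟨a, b, c, hvw⟩ := Submodule.mem_span_triple.1 hmem
  have hh : ⁅h, ⁅v, w⁆⁆ = 0 := by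
    rw [leibniz_lie, hv.lie_h_v, hv.lie_h_w, lie_neg, add_neg_cancel]
  obtain ⟨rfl, hb, -⟩ := linearIndependent_triple_iff.1 hli a (-b) 0 <| by
    rw [← hvw, lie_add, lie_add, lie_smul, lie_smul, lie_smul, hv.lie_h_v, hv.lie_h_w,
      hv.lie_h_u] at hh
    rw [← hh]
    module
  exact ⟨c, by rw [← hvw, neg_eq_zero.1 hb]; module⟩

theorem exists_lie_u_eq_smul [CharZero K] (hv : IsSl2StandardTriple h e f v w u)
    (hli : LinearIndependent K ![v, w, u]) (hmem : ⁅u, v⁆ ∈ Submodule.span K {v, w, u}) :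
    ∃ a : K, ⁅u, v⁆ = a • v ∧ ⁅u, w⁆ = a • w := by
  obtain ⟨a, b, c, huv⟩ := Submodule.mem_span_triple.1 hmem
  have hh : ⁅h, ⁅u, v⁆⁆ = ⁅u, v⁆ := by simp [leibniz_lie h, hv.lie_h_u, hv.lie_h_v]
  obtain ⟨-, hb, hc⟩ := linearIndependent_triple_iff.1 hli 0 (2 * b) c <| by
    rw [← huv, lie_add, lie_add, lie_smul, lie_smul, lie_smul, hv.lie_h_v, hv.lie_h_w,
      hv.lie_h_u] at hh
    linear_combination (norm := module) -hh
  obtain rfl : b = 0 := by simpa using hb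
  subst hc
  replace huv : ⁅u, v⁆ = a • v := by rw [← huv]; module
  have hf : ⁅f, ⁅u, v⁆⁆ = ⁅u, w⁆ := by simp [leibniz_lie f, hv.lie_f_u, hv.lie_f_v]
  exact ⟨a, huv, by rw [← hf, huv, lie_smul, hv.lie_f_v]⟩

theorem smul_right {M : Type*} [AddCommGroup M] [Module K M] [LieRingModule L M] [LieModule K L M]
    {v w u : M} (hv : IsSl2StandardTriple h e f v w u) (t : K) :
    IsSl2StandardTriple h e f v w (t • u) where
  __ := hv
  lie_h_u := by rw [lie_smul, hv.lie_h_u, smul_zero]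
  lie_e_u := by rw [lie_smul, hv.lie_e_u, smul_zero]
  lie_f_u := by rw [lie_smul, hv.lie_f_u, smul_zero]

end IsSl2StandardTriple

-- The Jacobi identity for `u`, `v`, `w` reads `0 = 2 a c u`.
theorem mul_eq_zero_of_lie_eq_smul [CharZero K] {u v w : L} (hu : u ≠ 0) {a c : K}
    (hvw : ⁅v, w⁆ = c • u) (huv : ⁅u, v⁆ = a • v) (huw : ⁅u, w⁆ = a • w) : a * c = 0 := by
  have hj := leibniz_lie u v w
  rw [hvw, huv, huw, lie_smul, lie_self, smul_zero, smul_lie, lie_smul, hvw] at hj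
  have h2 : (2 * (a * c)) • u = 0 := by rw [hj]; module
  simpa [hu] using h2

theorem exists_eq_zero_of_lie_eq_smul [LieAlgebra.IsSolvable L] [Nontrivial L] {ι : Type*}
    {v : ι → L} (hv : Submodule.span K (Set.range v) = ⊤) {c : ι → K}
    (hc : ∀ i, ∃ x y : L, ⁅x, y⁆ = c i • v i) : ∃ i, c i = 0 := by
  by_contra! hc0
  refine (LieAlgebra.derivedSeries_lt_top_of_solvable K L).ne ?_
  rw [← LieSubmodule.toSubmodule_eq_top, eq_top_iff, ← hv, Submodule.span_le]
  rintro _ ⟨i, rfl⟩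
  obtain ⟨x, y, hxy⟩ := hc i
  rw [← inv_smul_smul₀ (hc0 i) (v i), ← hxy]
  exact Submodule.smul_mem _ _
    (LieSubmodule.lie_mem_lie (LieSubmodule.mem_top x) (LieSubmodule.mem_top y))

end BracketOfTriple

/-! ### Classification -/

section LeviBasis

variable {K M : Type*} [DivisionRing K] [AddCommGroup M] [Module K M]

theorem exists_basis_coe_eq_of_isCompl [FiniteDimensional K M] {p q : Submodule K M}
    (hpq : IsCompl p q) (hp : finrank K p = 3) (hq : finrank K q = 3) {x y z : p} {u v w : q}
    (hx : LinearIndependent K ![x, y, z]) (hu : LinearIndependent K ![u, v, w]) :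
    ∃ b : Basis (Fin 6) K M, ⇑b = ![(x : M), y, z, u, v, w] := by
  let bp := basisOfLinearIndependentOfCardEqFinrank hx (by simp [hp])
  let bq := basisOfLinearIndependentOfCardEqFinrank hu (by simp [hq])
  let b := ((bp.prod bq).map (Submodule.prodEquivOfIsCompl p q hpq)).reindex
    (finSumFinEquiv (m := 3) (n := 3))
  refine ⟨b, funext fun i => ?_⟩
  fin_cases i <;>
    simp [b, bp, bq, Basis.prod_apply, finSumFinEquiv, Fin.addCases, Fin.subNat, Fin.castLT]

end LeviBasis

section Decomposable

variable {R L M : Type*} [CommRing R] [LieRing L] [LieAlgebra R L] [AddCommGroup M] [Module R M]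

theorem map_lie_eq_zero_of_basis {ι : Type*} [LinearOrder ι] (b : Basis ι R L) (φ : L →ₗ[R] M)
    (h : ∀ i j, i < j → φ ⁅b i, b j⁆ = 0) (x y : L) : φ ⁅x, y⁆ = 0 := by
  have hB : (LieModule.toEnd R L L : L →ₗ[R] L →ₗ[R] L).compr₂ φ = 0 := by
    refine b.ext fun i => b.ext fun j => ?_
    change φ ⁅b i, b j⁆ = 0
    rcases lt_trichotomy i j with hij | rfl | hij
    · exact h i j hij
    · rw [lie_self, map_zero]
    · rw [← lie_skew, map_neg, h j i hij, neg_zero]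
  exact LinearMap.congr_fun₂ hB x y

theorem mem_center_of_basis {ι : Type*} (b : Basis ι R L) {z : L} (h : ∀ i, ⁅b i, z⁆ = 0) :
    z ∈ LieAlgebra.center R L := by
  have hz : (LieModule.toEnd R L L : L →ₗ[R] L →ₗ[R] L).flip z = 0 := b.ext h
  exact (LieModule.mem_maxTrivSubmodule R L L z).2 (LinearMap.congr_fun hz)

theorem not_isIndecomposable_of_mem_center {g : Type*} [LieRing g] [LieAlgebra ℝ g]
    [FiniteDimensional ℝ g] {z x : g} (hz : z ∈ LieAlgebra.center ℝ g) {φ : g →ₗ[ℝ] ℝ}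
    (hφ : ∀ x y : g, φ ⁅x, y⁆ = 0) (hφz : φ z ≠ 0) (hx : x ≠ 0) (hφx : φ x = 0) :
    ¬ IsIndecomposable g := by
  rintro ⟨-, hind⟩
  have hz0 : z ≠ 0 := fun h => hφz (by rw [h, map_zero])
  let I : LieIdeal ℝ g :=
    { ℝ ∙ z with
      lie_mem := fun {y m} hm => by
        obtain ⟨t, rfl⟩ := Submodule.mem_span_singleton.1 hm
        change ⁅y, t • z⁆ ∈ ℝ ∙ z
        rw [lie_smul, (LieModule.mem_maxTrivSubmodule ℝ g g z).1 hz y, smul_zero]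
        exact zero_mem _ }
  let J : LieIdeal ℝ g :=
    { LinearMap.ker φ with lie_mem := fun {y m} _ => LinearMap.mem_ker.2 (hφ y m) }
  have hJI : IsCompl (LinearMap.ker φ) (ℝ ∙ z) :=
    Dual.isCompl_ker_of_disjoint_of_ne_bot (fun h => hφz (by rw [h, LinearMap.zero_apply]))
      (Submodule.disjoint_span_singleton_of_notMem hφz) (by simpa using hz0)
  have hzI : z ∈ I := Submodule.mem_span_singleton_self z
  have hxJ : x ∈ J := hφx
  rcases hind I J (LieSubmodule.isCompl_toSubmodule.1 hJI.symm) with hI | hJ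
  · exact hz0 ((LieSubmodule.mem_bot z).1 (hI ▸ hzI))
  · exact hx ((LieSubmodule.mem_bot x).1 (hJ ▸ hxJ))

end Decomposable

section Frames

variable {g : Type*} [LieRing g] [LieAlgebra ℝ g] {b : Basis (Fin 6) ℝ g}

theorem nonempty_lieEquiv_L61_of_basis {x y z v₀ v₁ v₂ : g} (hb : ⇑b = ![x, y, z, v₀, v₁, v₂])
    (t : IsSo3Triple x y z) (h : IsSo3VectorTriple x y z v₀ v₁ v₂) (h01 : ⁅v₀, v₁⁆ = 0)
    (h02 : ⁅v₀, v₂⁆ = 0) (h12 : ⁅v₁, v₂⁆ = 0) : Nonempty (L61 ≃ₗ⁅ℝ⁆ g) := by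
  have hxz : ⁅x, z⁆ = -y := by rw [← lie_skew, t.lie_z_x]
  refine nonempty_ofLaw_lieEquiv_of_basis b fun i j hij => ?_
  rw [hb]
  fin_cases i <;> fin_cases j <;> first
    | exact absurd hij (by decide)
    | simp [Fin.sum_univ_six, realLaw, c61, ofTable, t.lie_x_y, t.lie_y_z, hxz, h.lie_x_zero,
        h.lie_x_one, h.lie_x_two, h.lie_y_zero, h.lie_y_one, h.lie_y_two, h.lie_z_zero,
        h.lie_z_one, h.lie_z_two, h01, h02, h12]

theorem nonempty_lieEquiv_L64_of_basis {h e f v₀ v₁ v₂ : g} (hb : ⇑b = ![h, e, f, v₀, v₁, v₂])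
    (t : IsSl2Triple h e f) (hv : IsSl2AdjointTriple ℝ h e f v₀ v₁ v₂) (h01 : ⁅v₀, v₁⁆ = 0)
    (h02 : ⁅v₀, v₂⁆ = 0) (h12 : ⁅v₁, v₂⁆ = 0) : Nonempty (L64 ≃ₗ⁅ℝ⁆ g) := by
  refine nonempty_ofLaw_lieEquiv_of_basis b fun i j hij => ?_
  rw [hb]
  fin_cases i <;> fin_cases j <;> first
    | exact absurd hij (by decide)
    | simp [Fin.sum_univ_six, realLaw, c64, ofTable, t.lie_h_e_smul ℝ, t.lie_lie_smul_f ℝ,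
        t.lie_e_f, hv.lie_h_zero, hv.lie_h_one, hv.lie_h_two, hv.lie_e_zero, hv.lie_e_one,
        hv.lie_e_two, hv.lie_f_zero, hv.lie_f_one, hv.lie_f_two, h01, h02, h12]

variable {h e f v w u : g}

theorem nonempty_lieEquiv_L62_of_basis (hb : ⇑b = ![h, e, f, v, w, u]) (t : IsSl2Triple h e f)
    (hv : IsSl2StandardTriple h e f v w u) (hvw : ⁅v, w⁆ = u) (hvu : ⁅v, u⁆ = 0)
    (hwu : ⁅w, u⁆ = 0) : Nonempty (L62 ≃ₗ⁅ℝ⁆ g) := by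
  refine nonempty_ofLaw_lieEquiv_of_basis b fun i j hij => ?_
  rw [hb]
  fin_cases i <;> fin_cases j <;> first
    | exact absurd hij (by decide)
    | simp [Fin.sum_univ_six, realLaw, c62, ofTable, t.lie_h_e_smul ℝ, t.lie_lie_smul_f ℝ,
        t.lie_e_f, hv.lie_h_v, hv.lie_h_w, hv.lie_h_u, hv.lie_e_v, hv.lie_e_w, hv.lie_e_u,
        hv.lie_f_v, hv.lie_f_w, hv.lie_f_u, hvw, hvu, hwu]

theorem nonempty_lieEquiv_L63_of_basis (hb : ⇑b = ![h, e, f, v, w, u]) (t : IsSl2Triple h e f)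
    (hv : IsSl2StandardTriple h e f v w u) (hvw : ⁅v, w⁆ = 0) (hvu : ⁅v, u⁆ = v)
    (hwu : ⁅w, u⁆ = w) : Nonempty (L63 ≃ₗ⁅ℝ⁆ g) := by
  refine nonempty_ofLaw_lieEquiv_of_basis b fun i j hij => ?_
  rw [hb]
  fin_cases i <;> fin_cases j <;> first
    | exact absurd hij (by decide)
    | simp [Fin.sum_univ_six, realLaw, c63, ofTable, t.lie_h_e_smul ℝ, t.lie_lie_smul_f ℝ,
        t.lie_e_f, hv.lie_h_v, hv.lie_h_w, hv.lie_h_u, hv.lie_e_v, hv.lie_e_w, hv.lie_e_u,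
        hv.lie_f_v, hv.lie_f_w, hv.lie_f_u, hvw, hvu, hwu]

theorem not_isIndecomposable_of_isSl2StandardTriple (hb : ⇑b = ![h, e, f, v, w, u])
    (t : IsSl2Triple h e f) (hv : IsSl2StandardTriple h e f v w u) (hvw : ⁅v, w⁆ = 0)
    (hvu : ⁅v, u⁆ = 0) (hwu : ⁅w, u⁆ = 0) : ¬ IsIndecomposable g := by
  have hfin : FiniteDimensional ℝ g := b.finiteDimensional_of_finite
  have hφ (i : Fin 6) : b.coord 5 (![h, e, f, v, w, u] i) = if i = 5 then 1 else 0 := by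
    rw [← hb, Basis.coord_apply, Basis.repr_self, Finsupp.single_apply]
  have hφh : b.coord 5 h = 0 := hφ 0
  have hφe : b.coord 5 e = 0 := hφ 1
  have hφf : b.coord 5 f = 0 := hφ 2
  have hφv : b.coord 5 v = 0 := hφ 3
  have hφw : b.coord 5 w = 0 := hφ 4
  have hφu : b.coord 5 u = 1 := hφ 5
  have hlt (i j : Fin 6) (hij : i < j) : b.coord 5 ⁅b i, b j⁆ = 0 := by
    rw [hb]
    generalize b.coord 5 = φ at hφh hφe hφf hφv hφw
    fin_cases i <;> fin_cases j <;> first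
      | exact absurd hij (by decide)
      | simp [t.lie_h_e_smul ℝ, t.lie_lie_smul_f ℝ, t.lie_e_f, hv.lie_h_v, hv.lie_h_w, hv.lie_h_u,
          hv.lie_e_v, hv.lie_e_w, hv.lie_e_u, hv.lie_f_v, hv.lie_f_w, hv.lie_f_u, hvw, hvu, hwu,
          hφh, hφe, hφf, hφv, hφw]
  have hu : u ∈ LieAlgebra.center ℝ g := mem_center_of_basis b fun i => by
    rw [hb]
    fin_cases i <;> simp [hv.lie_h_u, hv.lie_e_u, hv.lie_f_u, hvu, hwu]
  exact not_isIndecomposable_of_mem_center hu (map_lie_eq_zero_of_basis b _ hlt)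
    (hφu.trans_ne one_ne_zero) t.h_ne_zero hφh

end Frames

section RadicalFrames

variable {K g : Type*} [Field K] [LieRing g] [LieAlgebra K g] {r : LieIdeal K g}

theorem IsSo3VectorTriple.coe {s : LieSubalgebra K g} {x y z : s} {v₀ v₁ v₂ : r}
    (h : IsSo3VectorTriple x y z v₀ v₁ v₂) :
    IsSo3VectorTriple (x : g) (y : g) (z : g) (v₀ : g) (v₁ : g) (v₂ : g) where
  lie_x_zero := congrArg Subtype.val h.lie_x_zero
  lie_x_one := congrArg Subtype.val h.lie_x_one
  lie_x_two := congrArg Subtype.val h.lie_x_two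
  lie_y_zero := congrArg Subtype.val h.lie_y_zero
  lie_y_one := congrArg Subtype.val h.lie_y_one
  lie_y_two := congrArg Subtype.val h.lie_y_two
  lie_z_zero := congrArg Subtype.val h.lie_z_zero
  lie_z_one := congrArg Subtype.val h.lie_z_one
  lie_z_two := congrArg Subtype.val h.lie_z_two

theorem IsSl2AdjointTriple.coe {s : LieSubalgebra K g} {h e f : s} {v₀ v₁ v₂ : r}
    (hv : IsSl2AdjointTriple K h e f v₀ v₁ v₂) :
    IsSl2AdjointTriple K (h : g) (e : g) (f : g) (v₀ : g) (v₁ : g) (v₂ : g) where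
  lie_h_zero := congrArg Subtype.val hv.lie_h_zero
  lie_h_one := congrArg Subtype.val hv.lie_h_one
  lie_h_two := congrArg Subtype.val hv.lie_h_two
  lie_e_zero := congrArg Subtype.val hv.lie_e_zero
  lie_e_one := congrArg Subtype.val hv.lie_e_one
  lie_e_two := congrArg Subtype.val hv.lie_e_two
  lie_f_zero := congrArg Subtype.val hv.lie_f_zero
  lie_f_one := congrArg Subtype.val hv.lie_f_one
  lie_f_two := congrArg Subtype.val hv.lie_f_two

theorem IsSl2StandardTriple.coe {s : LieSubalgebra K g} {h e f : s} {v w u : r}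
    (hv : IsSl2StandardTriple h e f v w u) :
    IsSl2StandardTriple (h : g) (e : g) (f : g) (v : g) (w : g) (u : g) where
  lie_h_v := congrArg Subtype.val hv.lie_h_v
  lie_h_w := congrArg Subtype.val hv.lie_h_w
  lie_h_u := congrArg Subtype.val hv.lie_h_u
  lie_e_v := congrArg Subtype.val hv.lie_e_v
  lie_e_w := congrArg Subtype.val hv.lie_e_w
  lie_e_u := congrArg Subtype.val hv.lie_e_u
  lie_f_v := congrArg Subtype.val hv.lie_f_v
  lie_f_w := congrArg Subtype.val hv.lie_f_w
  lie_f_u := congrArg Subtype.val hv.lie_f_u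

theorem coe_isSl2Triple {s : LieSubalgebra K g} {h e f : s} (t : IsSl2Triple h e f) :
    IsSl2Triple (h : g) (e : g) (f : g) where
  h_ne_zero := fun h0 => t.h_ne_zero (Subtype.ext h0)
  lie_e_f := congrArg Subtype.val t.lie_e_f
  lie_h_e_nsmul := congrArg Subtype.val t.lie_h_e_nsmul
  lie_h_f_nsmul := congrArg Subtype.val t.lie_h_f_nsmul

variable {v₀ v₁ v₂ : r}

theorem linearIndependent_coe (hli : LinearIndependent K ![v₀, v₁, v₂]) :
    LinearIndependent K ![(v₀ : g), (v₁ : g), (v₂ : g)] :=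
  linearIndependent_triple_iff.2 fun a b c h =>
    linearIndependent_triple_iff.1 hli a b c (Subtype.ext h)

theorem coe_mem_span (hli : LinearIndependent K ![v₀, v₁, v₂]) (hr : finrank K r = 3) (m : r) :
    (m : g) ∈ Submodule.span K {(v₀ : g), (v₁ : g), (v₂ : g)} := by
  obtain ⟨a, b, c, h⟩ := exists_eq_of_linearIndependent_triple hli hr m
  exact Submodule.mem_span_triple.2 ⟨a, b, c, congrArg Subtype.val h.symm⟩

theorem exists_basis_coe_eq_of_isCompl_toSubmodule [FiniteDimensional K g] {s : LieSubalgebra K g}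
    (hsr : IsCompl s.toSubmodule r.toSubmodule) (hs : finrank K s = 3) (hr : finrank K r = 3)
    {x y z : s} (hx : LinearIndependent K ![x, y, z]) (hv : LinearIndependent K ![v₀, v₁, v₂]) :
    ∃ b : Basis (Fin 6) K g, ⇑b = ![(x : g), (y : g), (z : g), (v₀ : g), (v₁ : g), (v₂ : g)] :=
  exists_basis_coe_eq_of_isCompl hsr hs hr hx hv

variable [LieAlgebra.IsSolvable r]

theorem exists_eq_zero_of_coe_lie_eq_smul {v : Fin 3 → r} (hli : LinearIndependent K v)
    (hr : finrank K r = 3) {c : Fin 3 → K}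
    (hc : ∀ i, ∃ x y : r, ⁅(x : g), (y : g)⁆ = c i • (v i : g)) : ∃ i, c i = 0 := by
  have : Nontrivial r := nontrivial_of_finrank_pos (R := K) (by lia)
  have : FiniteDimensional K r := FiniteDimensional.of_finrank_pos (by lia)
  refine exists_eq_zero_of_lie_eq_smul (hli.span_eq_top_of_card_eq_finrank' (by simp [hr]))
    fun i => ?_
  obtain ⟨x, y, hxy⟩ := hc i
  exact ⟨x, y, Subtype.ext hxy⟩

theorem IsSo3VectorTriple.lie_eq_zero {x y z : g}
    (h : IsSo3VectorTriple x y z (v₀ : g) (v₁ : g) (v₂ : g))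
    (hli : LinearIndependent K ![v₀, v₁, v₂]) (hr : finrank K r = 3) :
    ⁅(v₀ : g), (v₁ : g)⁆ = 0 ∧ ⁅(v₀ : g), (v₂ : g)⁆ = 0 ∧ ⁅(v₁ : g), (v₂ : g)⁆ = 0 := by
  obtain ⟨c, h01, h12, h20⟩ :=
    h.exists_lie_eq_smul (linearIndependent_coe hli) (coe_mem_span hli hr ⁅v₀, v₁⁆)
  obtain ⟨-, rfl⟩ : ∃ _ : Fin 3, c = 0 :=
    exists_eq_zero_of_coe_lie_eq_smul hli hr <|
      Fin.forall_fin_succ.2 ⟨⟨v₁, v₂, h12⟩, Fin.forall_fin_two.2 ⟨⟨v₂, v₀, h20⟩, ⟨v₀, v₁, h01⟩⟩⟩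
  rw [zero_smul] at h01 h12 h20
  exact ⟨h01, by rw [← lie_skew, h20, neg_zero], h12⟩

theorem IsSl2AdjointTriple.lie_eq_zero [CharZero K] {h e f : g}
    (hv : IsSl2AdjointTriple K h e f (v₀ : g) (v₁ : g) (v₂ : g))
    (hli : LinearIndependent K ![v₀, v₁, v₂]) (hr : finrank K r = 3) :
    ⁅(v₀ : g), (v₁ : g)⁆ = 0 ∧ ⁅(v₀ : g), (v₂ : g)⁆ = 0 ∧ ⁅(v₁ : g), (v₂ : g)⁆ = 0 := by
  obtain ⟨a, h01, h02, h12⟩ :=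
    hv.exists_lie_eq_smul (linearIndependent_coe hli) (coe_mem_span hli hr ⁅v₀, v₁⁆)
  obtain ⟨i, hi⟩ : ∃ i, ![2 * a, a, 2 * a] i = 0 :=
    exists_eq_zero_of_coe_lie_eq_smul hli hr <|
      Fin.forall_fin_succ.2 ⟨⟨v₀, v₁, h01⟩, Fin.forall_fin_two.2 ⟨⟨v₀, v₂, h02⟩, ⟨v₁, v₂, h12⟩⟩⟩
  obtain rfl : a = 0 := by fin_cases i <;> simpa using hi
  simp only [mul_zero, zero_smul] at h01 h02 h12
  exact ⟨h01, h02, h12⟩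

end RadicalFrames

section LeviFactor

variable {g : Type*} [LieRing g] [LieAlgebra ℝ g] [FiniteDimensional ℝ g] {s : LieSubalgebra ℝ g}
  {r : LieIdeal ℝ g}

attribute [local instance] LieRing.ofAssociativeRing in
theorem nonempty_lieEquiv_L61_of_isSo3Triple [LieAlgebra.IsSolvable r]
    (hsr : IsCompl s.toSubmodule r.toSubmodule)
    (hs : finrank ℝ s = 3) (hr : finrank ℝ r = 3) (hact : LieModule.ker ℝ s r ≠ ⊤) {x y z : s}
    (t : IsSo3Triple x y z) (hz : z ≠ 0) : Nonempty (L61 ≃ₗ⁅ℝ⁆ g) := by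
  have hx : LieModule.toEnd ℝ s r x ≠ 0 := fun h =>
    hact (t.eq_top_of_mem hz hs (LieHom.mem_ker.2 h))
  obtain ⟨v₀, v₁, v₂, hli, hv⟩ := t.exists_isSo3VectorTriple hr hx
  obtain ⟨b, hb⟩ :=
    exists_basis_coe_eq_of_isCompl_toSubmodule hsr hs hr (t.linearIndependent hz) hli
  obtain ⟨h01, h02, h12⟩ := hv.coe.lie_eq_zero hli hr
  exact nonempty_lieEquiv_L61_of_basis hb (t.map s.incl) hv.coe h01 h02 h12

theorem nonempty_lieEquiv_L64_of_isSl2AdjointTriple [LieAlgebra.IsSolvable r]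
    (hsr : IsCompl s.toSubmodule r.toSubmodule) (hs : finrank ℝ s = 3) (hr : finrank ℝ r = 3)
    {h e f : s} (t : IsSl2Triple h e f) {v₀ v₁ v₂ : r} (hli : LinearIndependent ℝ ![v₀, v₁, v₂])
    (hv : IsSl2AdjointTriple ℝ h e f v₀ v₁ v₂) : Nonempty (L64 ≃ₗ⁅ℝ⁆ g) := by
  obtain ⟨b, hb⟩ :=
    exists_basis_coe_eq_of_isCompl_toSubmodule hsr hs hr (linearIndependent_of_isSl2Triple t) hli
  obtain ⟨h01, h02, h12⟩ := hv.coe.lie_eq_zero hli hr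
  exact nonempty_lieEquiv_L64_of_basis hb (coe_isSl2Triple t) hv.coe h01 h02 h12

theorem linearIndependent_smul_right {K M : Type*} [Field K] [AddCommGroup M] [Module K M]
    {x y z : M} (hli : LinearIndependent K ![x, y, z]) {t : K} (ht : t ≠ 0) :
    LinearIndependent K ![x, y, t • z] :=
  linearIndependent_triple_iff.2 fun a b c h => by
    obtain ⟨ha, hb, hc⟩ := linearIndependent_triple_iff.1 hli a b (c * t) (by rw [← h]; module)
    exact ⟨ha, hb, (mul_eq_zero.1 hc).resolve_right ht⟩

variable {h e f : s} {v w u : r}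

theorem nonempty_lieEquiv_L62_of_isSl2StandardTriple (hsr : IsCompl s.toSubmodule r.toSubmodule)
    (hs : finrank ℝ s = 3) (hr : finrank ℝ r = 3) (t : IsSl2Triple h e f)
    (hli : LinearIndependent ℝ ![v, w, u]) (hv : IsSl2StandardTriple h e f v w u) {c : ℝ}
    (hc : c ≠ 0) (hvw : ⁅(v : g), (w : g)⁆ = c • (u : g)) (hvu : ⁅(v : g), (u : g)⁆ = 0)
    (hwu : ⁅(w : g), (u : g)⁆ = 0) : Nonempty (L62 ≃ₗ⁅ℝ⁆ g) := by
  obtain ⟨b, hb⟩ := exists_basis_coe_eq_of_isCompl_toSubmodule hsr hs hr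
    (linearIndependent_of_isSl2Triple t) (linearIndependent_smul_right hli hc)
  refine nonempty_lieEquiv_L62_of_basis hb (coe_isSl2Triple t) (hv.smul_right c).coe hvw ?_ ?_
  · exact (lie_smul c (v : g) (u : g)).trans (by rw [hvu, smul_zero])
  · exact (lie_smul c (w : g) (u : g)).trans (by rw [hwu, smul_zero])

theorem nonempty_lieEquiv_L63_of_isSl2StandardTriple (hsr : IsCompl s.toSubmodule r.toSubmodule)
    (hs : finrank ℝ s = 3) (hr : finrank ℝ r = 3) (t : IsSl2Triple h e f)
    (hli : LinearIndependent ℝ ![v, w, u]) (hv : IsSl2StandardTriple h e f v w u) {a : ℝ}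
    (ha : a ≠ 0) (hvw : ⁅(v : g), (w : g)⁆ = 0) (hvu : ⁅(v : g), (u : g)⁆ = a • (v : g))
    (hwu : ⁅(w : g), (u : g)⁆ = a • (w : g)) : Nonempty (L63 ≃ₗ⁅ℝ⁆ g) := by
  obtain ⟨b, hb⟩ := exists_basis_coe_eq_of_isCompl_toSubmodule hsr hs hr
    (linearIndependent_of_isSl2Triple t) (linearIndependent_smul_right hli (inv_ne_zero ha))
  refine nonempty_lieEquiv_L63_of_basis hb (coe_isSl2Triple t) (hv.smul_right a⁻¹).coe hvw ?_ ?_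
  · exact (lie_smul a⁻¹ (v : g) (u : g)).trans (by rw [hvu, inv_smul_smul₀ ha])
  · exact (lie_smul a⁻¹ (w : g) (u : g)).trans (by rw [hwu, inv_smul_smul₀ ha])

theorem nonempty_lieEquiv_of_isSl2StandardTriple (hind : IsIndecomposable g)
    (hsr : IsCompl s.toSubmodule r.toSubmodule) (hs : finrank ℝ s = 3) (hr : finrank ℝ r = 3)
    (t : IsSl2Triple h e f) (hli : LinearIndependent ℝ ![v, w, u])
    (hv : IsSl2StandardTriple h e f v w u) :
    Nonempty (L62 ≃ₗ⁅ℝ⁆ g) ∨ Nonempty (L63 ≃ₗ⁅ℝ⁆ g) := by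
  have hli' := linearIndependent_coe hli
  obtain ⟨c, hvw⟩ := hv.coe.exists_lie_v_w_eq_smul hli' (coe_mem_span hli hr ⁅v, w⁆)
  obtain ⟨a, huv, huw⟩ := hv.coe.exists_lie_u_eq_smul hli' (coe_mem_span hli hr ⁅u, v⁆)
  have hac : a * c = 0 := mul_eq_zero_of_lie_eq_smul (hli'.ne_zero 2) hvw huv huw
  have hvu : ⁅(v : g), (u : g)⁆ = -a • (v : g) := by rw [← lie_skew, huv, neg_smul]
  have hwu : ⁅(w : g), (u : g)⁆ = -a • (w : g) := by rw [← lie_skew, huw, neg_smul]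
  rcases eq_or_ne c 0 with rfl | hc
  · rw [zero_smul] at hvw
    refine Or.inr (nonempty_lieEquiv_L63_of_isSl2StandardTriple hsr hs hr t hli hv
      (neg_ne_zero.2 ?_) hvw hvu hwu)
    rintro rfl
    rw [neg_zero, zero_smul] at hvu hwu
    obtain ⟨b, hb⟩ := exists_basis_coe_eq_of_isCompl_toSubmodule hsr hs hr
      (linearIndependent_of_isSl2Triple t) hli
    exact not_isIndecomposable_of_isSl2StandardTriple hb (coe_isSl2Triple t) hv.coe hvw hvu hwu
      hind
  · obtain rfl : a = 0 := (mul_eq_zero.1 hac).resolve_right hc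
    rw [neg_zero, zero_smul] at hvu hwu
    exact Or.inl (nonempty_lieEquiv_L62_of_isSl2StandardTriple hsr hs hr t hli hv hc hvw hvu hwu)

end LeviFactor

section LeviDecomposition

variable {g : Type*} [LieRing g] [LieAlgebra ℝ g]

attribute [local instance] LieRing.ofAssociativeRing in
theorem nonempty_lieEquiv_of_isSl2Triple [FiniteDimensional ℝ g] (hind : IsIndecomposable g)
    {s : LieSubalgebra ℝ g} {r : LieIdeal ℝ g} [LieAlgebra.IsSolvable r]
    (hsr : IsCompl s.toSubmodule r.toSubmodule) (hs : finrank ℝ s = 3) (hr : finrank ℝ r = 3)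
    (hact : LieModule.ker ℝ s r ≠ ⊤) {h e f : s} (t : IsSl2Triple h e f) :
    Nonempty (L62 ≃ₗ⁅ℝ⁆ g) ∨ Nonempty (L63 ≃ₗ⁅ℝ⁆ g) ∨ Nonempty (L64 ≃ₗ⁅ℝ⁆ g) := by
  have he : LieModule.toEnd ℝ s r e ≠ 0 := fun h0 =>
    hact (eq_top_of_mem_of_isSl2Triple t hs (LieHom.mem_ker.2 h0))
  rcases exists_isSl2AdjointTriple_or_isSl2StandardTriple t hr he with
    ⟨v₀, v₁, v₂, hli, hv⟩ | ⟨v, w, u, hli, hv⟩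
  · exact Or.inr (Or.inr (nonempty_lieEquiv_L64_of_isSl2AdjointTriple hsr hs hr t hli hv))
  · exact (nonempty_lieEquiv_of_isSl2StandardTriple hind hsr hs hr t hli hv).imp_right Or.inl

theorem nonempty_lieEquiv_of_hasNontrivialLeviDecomposition (h6 : finrank ℝ g = 6)
    (hind : IsIndecomposable g) (hlevi : HasNontrivialLeviDecomposition g) :
    Nonempty (g ≃ₗ⁅ℝ⁆ L61) ∨ Nonempty (g ≃ₗ⁅ℝ⁆ L62) ∨
      Nonempty (g ≃ₗ⁅ℝ⁆ L63) ∨ Nonempty (g ≃ₗ⁅ℝ⁆ L64) := by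
  have : FiniteDimensional ℝ g := FiniteDimensional.of_finrank_pos (by lia)
  obtain ⟨s, hs, -, hr, hsr, x, hx, y, hy, hxy⟩ := hlevi
  have hxy' : ⁅(⟨x, hx⟩ : s), (⟨y, hy⟩ : LieAlgebra.radical ℝ g)⁆ ≠ 0 :=
    fun h => hxy (congrArg Subtype.val h)
  have hd : finrank ℝ s + finrank ℝ (LieAlgebra.radical ℝ g) = 6 :=
    (Submodule.finrank_add_eq_of_isCompl hsr).trans h6
  have : Nontrivial (LieAlgebra.radical ℝ g) := (LieSubmodule.nontrivial_iff_ne_bot ℝ g g).2 hr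
  have hs3 : finrank ℝ s = 3 :=
    finrank_eq_three_of_finrank_add_finrank_eq_six hd finrank_pos ⟨_, _, hxy'⟩
  have hr3 : finrank ℝ (LieAlgebra.radical ℝ g) = 3 := by lia
  have hact := ker_ne_top_of_lie_ne_zero (K := ℝ) hxy'
  rcases exists_isSo3Triple_or_exists_isSl2Triple hs3 with ⟨_, _, _, hz, t⟩ | ⟨_, _, _, t⟩
  · exact Or.inl ((nonempty_lieEquiv_L61_of_isSo3Triple hsr hs3 hr3 hact t hz).map LieEquiv.symm)
  · exact Or.inr ((nonempty_lieEquiv_of_isSl2Triple hind hsr hs3 hr3 hact t).imp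
      (.map LieEquiv.symm) (.imp (.map LieEquiv.symm) (.map LieEquiv.symm)))

theorem radical_eq_bot_of_lieEquiv {s : Type*} [LieRing s] [LieAlgebra ℝ s]
    [FiniteDimensional ℝ s] [LieAlgebra.IsSemisimple ℝ s] (e : s ≃ₗ⁅ℝ⁆ g) :
    LieAlgebra.radical ℝ g = ⊥ := by
  have : FiniteDimensional ℝ g := e.toLinearEquiv.finiteDimensional
  have : LieAlgebra.IsKilling ℝ g := LieAlgebra.isKilling_of_equiv e
  exact LieAlgebra.HasTrivialRadical.radical_eq_bot

theorem not_isStable_and_isContractionOfSemisimple [FiniteDimensional ℝ g]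
    (hr : LieAlgebra.radical ℝ g ≠ ⊥) : ¬ (IsStable g ∧ IsContractionOfSemisimple g) := by
  rintro ⟨hg, s, _, _, _, _, hs⟩
  obtain ⟨e⟩ := hg.nonempty_lieEquiv_of_isContraction hs
  exact hr (radical_eq_bot_of_lieEquiv e)

end LeviDecomposition

end LowDimLie

open LowDimLie in
theorem proposition3 :
    (∀ (g : Type*) [LieRing g] [LieAlgebra ℝ g], Module.finrank ℝ g = 6 →
      IsIndecomposable g → HasNontrivialLeviDecomposition g →
        (Nonempty (g ≃ₗ⁅ℝ⁆ L61) ∨ Nonempty (g ≃ₗ⁅ℝ⁆ L62) ∨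
          Nonempty (g ≃ₗ⁅ℝ⁆ L63) ∨ Nonempty (g ≃ₗ⁅ℝ⁆ L64)) ∧
        (IsStable g ∨ IsContractionOfSemisimple g) ∧
        ¬ (IsStable g ∧ IsContractionOfSemisimple g)) ∧
    (Nonempty (L61 ≃ₗ⁅ℝ⁆ Iso3) ∧ IsContractionOfSemisimple L61 ∧
      IsContraction So4 L61 ∧ IsContraction So31 L61) ∧
    (Nonempty (L64 ≃ₗ⁅ℝ⁆ Isl2) ∧ IsContractionOfSemisimple L64 ∧
      IsContraction So22 L64 ∧ IsContraction So31 L64) ∧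
    (Subsingleton (H2 L62) ∧ IsStable L62) ∧
    (Subsingleton (H2 L63) ∧ IsStable L63) := by
  have h62 : IsStable L62 := isStable_of_subsingleton_H2 subsingleton_H2_L62
  have h63 : IsStable L63 := isStable_of_subsingleton_H2 subsingleton_H2_L63
  refine ⟨fun g _ _ h6 hind hlevi => ?_,
    ⟨nonempty_L61_equiv_Iso3, isContractionOfSemisimple_of_So31 isContraction_So31_L61,
      isContraction_So4_L61, isContraction_So31_L61⟩,
    ⟨nonempty_L64_equiv_Isl2, isContractionOfSemisimple_of_So31 isContraction_So31_L64,
      isContraction_So22_L64, isContraction_So31_L64⟩,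
    ⟨subsingleton_H2_L62, h62⟩, ⟨subsingleton_H2_L63, h63⟩⟩
  have : FiniteDimensional ℝ g := FiniteDimensional.of_finrank_pos (by lia)
  have hcl := nonempty_lieEquiv_of_hasNontrivialLeviDecomposition h6 hind hlevi
  obtain ⟨_, -, -, hr, -⟩ := hlevi
  refine ⟨hcl, ?_, not_isStable_and_isContractionOfSemisimple hr⟩
  rcases hcl with ⟨⟨e⟩⟩ | ⟨⟨e⟩⟩ | ⟨⟨e⟩⟩ | ⟨⟨e⟩⟩
  · exact Or.inr (isContractionOfSemisimple_of_So31 (isContraction_So31_L61.congr_right e))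
  · exact Or.inl (h62.of_lieEquiv e.symm)
  · exact Or.inl (h63.of_lieEquiv e.symm)
  · exact Or.inr (isContractionOfSemisimple_of_So31 (isContraction_So31_L64.congr_right e))
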